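/- Let $\kappa<\lambda$ be infinite regular cardinals with $\kappa^{<\kappa}=\kappa$ and $\lambda^{\kappa}=\lambda$, let $\delta<\kappa^{++}$ be an ordinal, and let $\mathcal F:[\lambda]^2\to\kappa^+$ be a $\kappa^+$-strongly unbounded function on $\lambda$; that is, for every $\vartheta<\kappa^+$ and every family $\mathcal A\subset[\lambda]^{<\kappa}$ of pairwise disjoint sets with $|\mathcal A|=\kappa^+$ there are different $a,b\in\mathcal A$ such that $\mathcal F\{\alpha,\beta\}>\vartheta$ for all $\alpha\in a$, $\beta\in b$. *Intervals.* For a nonempty ordinal interval $I=[\alpha,\beta)$ write $I^-=\alpha$, $I^+=\beta$. If $\beta$ is a limit, fix a closed cofinal subset $E(I)=\{\varepsilon^I_\nu:\nu<\mathrm{cf}(\beta)\}$ of $I$ (increasing enumeration) of order type $\mathrm{cf}(\beta)$ with $\varepsilon^I_0=\alpha$, and let $\mathcal E(I)=\{[\varepsilon^I_\nu,\varepsilon^I_{\nu+1}):\nu<\mathrm{cf}(\beta)\}$; if $\beta=\beta'+1$, let $E(I)=\{\alpha,\beta'\}$, and let $\mathcal E(I)$ consist of the nonempty ones among $[\alpha,\beta')$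 and $\{\beta'\}$. Put $\mathcal I_0=\{[0,\delta)\}$, $\mathcal I_{n+1}=\bigcup\{\mathcal E(I):I\in\mathcal I_n\}$ and $\mathbb I=\bigcup_n\mathcal I_n$. For $\alpha<\delta$ let $n(\alpha)=\min\{n:\exists I\in\mathcal I_n\ I^-=\alpha\}$ and let $I(\alpha,n)$ be the member of $\mathcal I_n$ containing $\alpha$. For a limit $\zeta<\delta$ let $J(\zeta)$ be the $I\in\mathcal I_{n(\zeta)}$ with $I^+=\zeta$ if there is one, and $J(\zeta)=I(\zeta,n(\zeta)-1)$ otherwise. *Orbits.* Let $L=\{\zeta<\delta:\mathrm{cf}(\zeta)\in\{\kappa,\kappa^+\}\}$. For $\zeta<\delta$ let $o(\zeta)=\bigcup\{E(I(\zeta,m))\cap\zeta:m<n(\zeta)\}$, and for $\zeta\in L$ let $\overline o(\zeta)=o(\zeta)\cup(E(J(\zeta))\cap\zeta)$. Let $B_S=\delta\times\kappa$, $B_\zeta=\{\zeta\}\times[\kappa,\lambda)$ for $\zeta\in L$, and $X=B_S\cup\bigcup_{\zeta\in L}B_\zeta$. For $x=\langle\alpha,\nu\rangle\in X$ let $\pi(x)=\alpha$,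 $\rho(x)=\nu$, and let $\pi_B(x)\in\{S\}\cup L$ be the index of the block containing $x$. Let $\mathrm{orb}(x)=o(\pi(x))$ if $x\in B_S$ and $\mathrm{orb}(x)=\overline o(\pi(x))$ otherwise. For $\{x,y\}\in[X]^2$ let $f\{x,y\}=o(\pi(x))\cup\{\varepsilon^{J(\pi(x))}_\nu:\nu<\mathcal F\{\rho(x),\rho(y)\}\}$ if $\pi_B(x)=\pi_B(y)\neq S$ and $\mathrm{cf}(\pi(x))=\kappa^+$, and $f\{x,y\}=\mathrm{orb}(x)\cap\mathrm{orb}(y)$ otherwise. Say that $\Lambda\in\mathbb I$ separates $x$ from $y$ if $\Lambda^-<\pi(x)<\Lambda^+<\pi(y)$. *The poset.* Let $\mathcal P$ be the set of triples $\langle A,\preceq,i\rangle$ such that (P1) $A\in[X]^{<\kappa}$; (P2) $\preceq$ is a partial order on $A$ such that $x\preceq y$ implies $x=y$ or $\pi(x)<\pi(y)$; (P3) if $x\preceq y$ and $\pi_B(x)\neq S$ then $x=y$; (P4) $i:[A]^2\to A\cup\{\mathrm{undef}\}$, and for each $\{x,y\}\in[A]^2$ and $a\in A$, ($a\preceq x$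 and $a\preceq y$) iff $a\preceq i\{x,y\}$ (where $a\preceq\mathrm{undef}$ never holds); (P5) if $\{x,y\}\in[A]^2$ and $x,y$ are $\preceq$-incomparable but have a common lower bound in $A$, then $\pi(i\{x,y\})\in f\{x,y\}$; (P6) if $\{x,y\}\in[A]^2$, $x\prec y$ and $\Lambda\in\mathbb I$ separates $x$ from $y$, then there is $z\in A$ with $x\prec z\prec y$ and $\pi(z)=\Lambda^+$. Order $\mathcal P$ by extension: $\langle A,\preceq,i\rangle\le\langle A',\preceq',i'\rangle$ iff $A'\subset A$, $\preceq'=\preceq\cap(A'\times A')$ and $i'\subset i$. **Lemma.** For every choice of the sets $E(I)$, the poset $\mathcal P$ satisfies the $\kappa^+$-chain condition: every set of pairwise incompatible elements of $\mathcal P$ has cardinality less than $\kappa^+$. -/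

import Mathlib

universe u

namespace OrbitForcing

open Cardinal Ordinal Order

/-- `F : [lam]² → κ⁺` is a `κ⁺`-strongly unbounded function on `lam`. Unordered pairs are elements
of `Sym2`; only the values at pairs of distinct ordinals below `lam` matter. -/
structure StronglyUnbounded (κ lam : Cardinal.{u}) (F : Sym2 Ordinal.{u} → Ordinal.{u}) :
    Prop where
  maps_to : ∀ α < lam.ord, ∀ β < lam.ord, α ≠ β → F s(α, β) < (succ κ).ord
  unbounded : ∀ ϑ < (succ κ).ord, ∀ 𝒜 : Set (Set Ordinal.{u}),
    (∀ a ∈ 𝒜, a ⊆ Set.Iio lam.ord ∧ #a < lift.{u + 1} κ) →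
    𝒜.PairwiseDisjoint id →
    #𝒜 = lift.{u + 1} (succ κ) →
    ∃ a ∈ 𝒜, ∃ b ∈ 𝒜, a ≠ b ∧ ∀ α ∈ a, ∀ β ∈ b, ϑ < F s(α, β)

/-- The ordinal interval `[lo, hi)`, with `I⁻ = lo` and `I⁺ = hi`. -/
@[ext]
structure OrdInterval : Type (u + 1) where
  lo : Ordinal.{u}
  hi : Ordinal.{u}

instance : Inhabited OrdInterval.{u} := ⟨⟨0, 0⟩⟩

/-- The set of ordinals in the interval. -/
def OrdInterval.toSet (I : OrdInterval.{u}) : Set Ordinal.{u} := Set.Ico I.lo I.hi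

/-- `e` restricted to `cf(I⁺)` is the increasing enumeration of a closed cofinal subset of `I` of
order type `cf(I⁺)` whose first element is `I⁻`. -/
structure IsClubEnum (I : OrdInterval.{u}) (e : Ordinal.{u} → Ordinal.{u}) : Prop where
  zero : e 0 = I.lo
  strictMono : ∀ μ ν, μ < ν → ν < I.hi.cof.ord → e μ < e ν
  continuous : ∀ ν < I.hi.cof.ord, IsSuccLimit ν → IsLUB (e '' Set.Iio ν) (e ν)
  lt_hi : ∀ ν < I.hi.cof.ord, e ν < I.hi
  cofinal : ∀ γ < I.hi, ∃ ν < I.hi.cof.ord, γ ≤ e ν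

/-- A choice, for every nonempty interval `I` with limit right endpoint, of (the increasing
enumeration of) the set `E(I)`. -/
def IsClubChoice (ε : OrdInterval.{u} → Ordinal.{u} → Ordinal.{u}) : Prop :=
  ∀ I : OrdInterval.{u}, I.lo < I.hi → IsSuccLimit I.hi → IsClubEnum I (ε I)

section Orbits

variable (δ : Ordinal.{u}) (ε : OrdInterval.{u} → Ordinal.{u} → Ordinal.{u})

/-- `E(I)`: the chosen club if `I⁺` is a limit, and `{I⁻, β'}` if `I⁺ = β' + 1`. -/
def clubSet (I : OrdInterval.{u}) : Set Ordinal.{u} :=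
  {γ | IsSuccLimit I.hi ∧ ∃ ν < I.hi.cof.ord, γ = ε I ν} ∪
  {γ | ∃ β', I.hi = β' + 1 ∧ (γ = I.lo ∨ γ = β')}

/-- The canonical partition of `I` into smaller intervals; the piece `[I⁻, β')` is
omitted when it is empty. -/
def pieces (I : OrdInterval.{u}) : Set OrdInterval.{u} :=
  {K | IsSuccLimit I.hi ∧ ∃ ν < I.hi.cof.ord, K = ⟨ε I ν, ε I (ν + 1)⟩} ∪
  {K | ∃ β', I.hi = β' + 1 ∧ (K = ⟨I.lo, β'⟩ ∨ K = ⟨β', β' + 1⟩) ∧ K.lo < K.hi}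

/-- The `n`-th partition of `[0, δ)` in the tree of intervals. -/
def level : ℕ → Set OrdInterval.{u}
  | 0 => {⟨0, δ⟩}
  | n + 1 => ⋃ I ∈ level n, pieces ε I

/-- The cofinal tree of intervals `𝕀`. -/
def tree : Set OrdInterval.{u} := ⋃ n, level δ ε n

/-- `n(α)`, the least `n` such that some interval of the `n`-th level starts at `α`. -/
noncomputable def rankOf (α : Ordinal.{u}) : ℕ :=
  sInf {n | ∃ I ∈ level δ ε n, I.lo = α}

/-- `I(α, n)`, the interval of the `n`-th level that contains `α`. -/
noncomputable def intervalAt (α : Ordinal.{u}) (n : ℕ) : OrdInterval.{u} :=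
  Classical.epsilon fun I => I ∈ level δ ε n ∧ α ∈ I.toSet

open Classical in
/-- `J(ζ)` for limit `ζ < δ`: the interval of level `n(ζ)` with right endpoint `ζ` if
there is one, and otherwise `I(ζ, n(ζ) - 1)`. It is the unique interval of level `n(ζ) - 1` or
`n(ζ)` such that `ζ` is a limit point of `E(J(ζ))`. -/
noncomputable def limitInterval (ζ : Ordinal.{u}) : OrdInterval.{u} :=
  if h : ∃ I ∈ level δ ε (rankOf δ ε ζ), I.hi = ζ then h.choose
  else intervalAt δ ε ζ (rankOf δ ε ζ - 1)

/-- The basic orbit `o(ζ)`. -/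
def basicOrbit (ζ : Ordinal.{u}) : Set Ordinal.{u} :=
  ⋃ m < rankOf δ ε ζ, clubSet ε (intervalAt δ ε ζ m) ∩ Set.Iio ζ

/-- The extended orbit of `ζ`. -/
def extendedOrbit (ζ : Ordinal.{u}) : Set Ordinal.{u} :=
  basicOrbit δ ε ζ ∪ (clubSet ε (limitInterval δ ε ζ) ∩ Set.Iio ζ)

end Orbits

/-- Points are pairs `⟨α, ν⟩` of ordinals; `π` and `ρ` are the two projections. -/
abbrev Pt : Type (u + 1) := Ordinal.{u} × Ordinal.{u}

section Poset

variable (κ lam : Cardinal.{u}) (δ : Ordinal.{u})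

/-- The set of `ζ < δ` of cofinality `κ` or `κ⁺`. -/
def bigLevels : Set Ordinal.{u} := {ζ | ζ < δ ∧ (ζ.cof = κ ∨ ζ.cof = succ κ)}

/-- The blocks: the index `none` plays the role of `S`, with `B_S = δ × κ`, and
`B_ζ = {ζ} × [κ, lam)`. -/
def block : Option Ordinal.{u} → Set Pt.{u}
  | none => {x | x.1 < δ ∧ x.2 < κ.ord}
  | some ζ => {x | x.1 = ζ ∧ κ.ord ≤ x.2 ∧ x.2 < lam.ord}

/-- The underlying set `X`, the union of `B_S` and the `B_ζ` for `ζ` of cofinality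
`κ` or `κ⁺`. -/
def underlying : Set Pt.{u} := block κ lam δ none ∪ ⋃ ζ ∈ bigLevels κ δ, block κ lam δ (some ζ)

open Classical in
/-- The index of the block containing a point of the underlying set. -/
noncomputable def blockOf (x : Pt.{u}) : Option Ordinal.{u} :=
  if x.2 < κ.ord then none else some x.1

theorem mem_block_blockOf {x : Pt.{u}} (hx : x ∈ underlying κ lam δ) :
    x ∈ block κ lam δ (blockOf κ x) := by
  rcases hx with h | h
  · have h2 : x.2 < κ.ord := h.2
    simpa [blockOf, h2] using h
  · simp only [Set.mem_iUnion] at h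
    obtain ⟨ζ, -, rfl, h1, h2⟩ := h
    simp [blockOf, not_lt.mpr h1, block, h1, h2]

variable (ε : OrdInterval.{u} → Ordinal.{u} → Ordinal.{u})
  (F : Sym2 Ordinal.{u} → Ordinal.{u})

open Classical in
/-- The orbit of a point: the basic orbit on `B_S`, the extended orbit elsewhere. -/
noncomputable def orbit (x : Pt.{u}) : Set Ordinal.{u} :=
  if blockOf κ x = none then basicOrbit δ ε x.1 else extendedOrbit δ ε x.1

open Classical in
/-- The set `f{x, y}`. -/
noncomputable def pairOrbit (x y : Pt.{u}) : Set Ordinal.{u} :=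
  if blockOf κ x = blockOf κ y ∧ blockOf κ x ≠ none ∧ x.1.cof = succ κ then
    basicOrbit δ ε x.1 ∪ {γ | ∃ ν < F s(x.2, y.2), γ = ε (limitInterval δ ε x.1) ν}
  else orbit κ δ ε x ∩ orbit κ δ ε y

/-- `Λ` separates `x` from `y`. -/
def Separates (Λ : OrdInterval.{u}) (x y : Pt.{u}) : Prop :=
  Λ.lo < x.1 ∧ x.1 < Λ.hi ∧ Λ.hi < y.1

/-- The conditions `⟨A, ≼, i⟩` of the forcing. The relation `≼` on `A` is a relation on all points
which holds only inside `A`; the function `i : [A]² → A ∪ {undef}` is a function on all unordered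
pairs which takes the value `none` (that is, `undef`) outside `[A]²`. -/
structure Cond where
  A : Set Pt.{u}
  le : Pt.{u} → Pt.{u} → Prop
  i : Sym2 Pt.{u} → Option Pt.{u}
  le_mem : ∀ x y, le x y → x ∈ A ∧ y ∈ A
  i_dom : ∀ x y, i s(x, y) ≠ none → x ∈ A ∧ y ∈ A ∧ x ≠ y
  i_val : ∀ x y z, i s(x, y) = some z → z ∈ A
  /-- (P1) -/
  subset_underlying : A ⊆ underlying κ lam δ
  card_lt : #A < lift.{u + 1} κ
  /-- (P2) -/
  le_refl : ∀ x ∈ A, le x x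
  le_trans : ∀ x y z, le x y → le y z → le x z
  le_antisymm : ∀ x y, le x y → le y x → x = y
  le_height : ∀ x y, le x y → x = y ∨ x.1 < y.1
  /-- (P3) -/
  le_block : ∀ x y, le x y → blockOf κ x ≠ none → x = y
  /-- (P4) -/
  inf_spec : ∀ x ∈ A, ∀ y ∈ A, x ≠ y → ∀ a ∈ A,
    (le a x ∧ le a y) ↔ ∃ z, i s(x, y) = some z ∧ le a z
  /-- (P5) -/
  inf_mem : ∀ x ∈ A, ∀ y ∈ A, x ≠ y → ¬ le x y → ¬ le y x → (∃ a ∈ A, le a x ∧ le a y) →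
    ∃ z, i s(x, y) = some z ∧ z.1 ∈ pairOrbit κ δ ε F x y
  /-- (P6) -/
  interpolate : ∀ x ∈ A, ∀ y ∈ A, x ≠ y → le x y → ∀ Λ ∈ tree δ ε, Separates Λ x y →
    ∃ z ∈ A, (le x z ∧ x ≠ z) ∧ (le z y ∧ z ≠ y) ∧ z.1 = Λ.hi

/-- Conditions are ordered by extension: `p ≤ q` means that `p` extends `q`. -/
instance : PartialOrder (Cond κ lam δ ε F) where
  le p q := q.A ⊆ p.A ∧ (∀ x ∈ q.A, ∀ y ∈ q.A, q.le x y ↔ p.le x y) ∧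
    ∀ x ∈ q.A, ∀ y ∈ q.A, x ≠ y → q.i s(x, y) = p.i s(x, y)
  le_refl p := ⟨subset_rfl, fun _ _ _ _ => Iff.rfl, fun _ _ _ _ _ => rfl⟩
  le_trans p q r h1 h2 := ⟨h2.1.trans h1.1,
    fun x hx y hy => (h2.2.1 x hx y hy).trans (h1.2.1 x (h2.1 hx) y (h2.1 hy)),
    fun x hx y hy h => (h2.2.2 x hx y hy h).trans (h1.2.2 x (h2.1 hx) y (h2.1 hy) h)⟩
  le_antisymm p q h1 h2 := by
    have hA : p.A = q.A := h2.1.antisymm h1.1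
    have hle : p.le = q.le := by
      funext x y
      apply propext
      constructor
      · intro h
        obtain ⟨hx, hy⟩ := p.le_mem x y h
        exact (h2.2.1 x hx y hy).1 h
      · intro h
        obtain ⟨hx, hy⟩ := q.le_mem x y h
        exact (h1.2.1 x hx y hy).1 h
    have hi : p.i = q.i := by
      funext e
      induction e using Sym2.ind with
      | _ x y =>
        by_cases hp : p.i s(x, y) = none
        · by_cases hq : q.i s(x, y) = none
          · rw [hp, hq]
          · obtain ⟨hx, hy, hxy⟩ := q.i_dom x y hq
            exact (h1.2.2 x hx y hy hxy).symm
        · obtain ⟨hx, hy, hxy⟩ := p.i_dom x y hp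
          exact h2.2.2 x hx y hy hxy
    cases p
    cases q
    subst hA hle hi
    rfl

end Poset

/-- The `θ`-chain condition: every set of pairwise incompatible conditions has
cardinality less than `θ`. -/
def ChainCondition (P : Type (u + 1)) [PartialOrder P] (θ : Cardinal.{u + 1}) : Prop :=
  ∀ S : Set P, (∀ p ∈ S, ∀ q ∈ S, p ≠ q → ¬ ∃ r : P, r ≤ p ∧ r ≤ q) → #S < θ

end OrbitForcing

/-!
Given more than `κ` conditions, two of them have a common extension. The argument thins the
conditions out to a uniform family, picks two members of it, and inserts a third copy of their
varying points below both of them.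

*Thinning out.* As `κ ^< κ = κ`, the `Δ`-system lemma (`exists_deltaSystem`) and repeated counting
give more than `κ` conditions which are enumerated by one index set `J` with `#J < κ`, with the same
order, the same meets and the same ranks of levels, and for which both the points and the levels of
the points form `Δ`-systems, with kernels `K` and `L` (`exists_uniformFamily`). Since
orbits of points of `S` and sets `f{x, y}` have size at most `κ`, meets of fixed points are fixed
(`UniformFamily.meet_mem`).

*Targets.* Let `j` be a varying index, that is `j ∉ K`. Either its level is a constant `γ`, and then
its points lie outside `S`, so that `γ` has cofinality `κ` or `κ⁺`; put `I = J(γ)`. Or the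
levels are pairwise distinct, and then, at the last stage at which the interval of the tree around
them does not depend on the condition, this interval `I` is cut into `κ⁺` pieces; its right
endpoint `γ` has cofinality `κ⁺` and the levels tend to it (`UniformFamily.exists_target`). In both
cases `E(I)` is cofinal in `γ`, which has cofinality at least `κ > #J`, so there is `e j ∈ E(I)` with
`e j < γ` above `I⁻`, above all fixed levels and all targets below `γ`, and above the `e l` with `l`
below `j` (`UniformFamily.exists_approximation`). All but `κ` of the conditions have their levels of
index `j` above `e j`, for all `j`.

*Amalgamation.* For two such conditions, let `w j`, for `j ∉ K`, be a new point of `S` at level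
`e j`. The orbits of both copies of `j` contain `e j` and the orbit of `e j`, because `e j` belongs
to `E(I)`, and an interval of the tree which has `e j` in its interior contains `I`. Hence the two
conditions together with the points `w j` form a condition in which the meet of the two copies of
`j` is `w j` (`IsomorphicPair.exists_common_extension`). Here, for `i` below `j`, the copy of `i` in
one of the three copies of `J` lies below the copy of `j` in another one if the former is `w i`, or
if there is a fixed index between `i` and `j`.

The requirement that the level of a meet be in `f{x, y}` is more than membership in both orbits only
if `x` and `y` are copies of points outside `S` at the same level `ζ` of cofinality `κ⁺`. Then `ζ`
is a fixed level, the indices in `E(J(ζ))` of all relevant levels are bounded by some `ϑ < κ⁺` which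
does not depend on the two conditions, and strong unboundedness of `F`, applied to the sets of second
coordinates of the varying points of fixed level, provides two conditions at which `F` exceeds `ϑ`
(`UniformFamily.exists_pair`).
-/

universe v w

namespace OrbitForcing

open Cardinal Ordinal Order

/-! ### Combinatorics of families of functions -/

theorem mk_iUnion_le_of_le {c : Cardinal.{v}} (hc : ℵ₀ ≤ c) {ι α : Type v} (hι : #ι ≤ c)
    (f : ι → Set α) (hf : ∀ i, #(f i) ≤ c) : #(⋃ i, f i) ≤ c :=
  (mk_iUnion_le f).trans
    ((mul_le_mul' hι (ciSup_le' hf)).trans (mul_eq_self hc).le)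

theorem mk_biUnion_le_of_le {c : Cardinal.{v}} (hc : ℵ₀ ≤ c) {ι α : Type v} {s : Set ι}
    (hs : #s ≤ c) (f : ι → Set α) (hf : ∀ i ∈ s, #(f i) ≤ c) : #(⋃ i ∈ s, f i) ≤ c := by
  rw [Set.biUnion_eq_iUnion]
  exact mk_iUnion_le_of_le hc hs _ fun i => hf i i.2

theorem mk_union_le_of_le {c : Cardinal.{v}} (hc : ℵ₀ ≤ c) {α : Type v} {s t : Set α}
    (hs : #s ≤ c) (ht : #t ≤ c) : #(s ∪ t : Set α) ≤ c :=
  (mk_union_le s t).trans (add_le_of_le hc hs ht)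

theorem exists_large_fiber {c : Cardinal.{v}} (hc : ℵ₀ ≤ c) {ι T : Type v} (f : ι → T)
    (hT : #T ≤ c) {B : Set ι} (hB : c < #B) :
    ∃ B' ⊆ B, c < #B' ∧ ∃ t, ∀ p ∈ B', f p = t := by
  by_contra! h
  refine hB.not_ge ?_
  have : B = ⋃ t, {p ∈ B | f p = t} := by
    ext p; simp
  rw [this]
  refine mk_iUnion_le_of_le hc hT _ fun t => ?_
  by_contra! hlt
  obtain ⟨p, hp, hpt⟩ := h _ (Set.sep_subset _ _) hlt t
  exact hpt hp.2

theorem mk_fun_le {c : Cardinal.{v}} (hpow : ∀ θ < c, c ^ θ ≤ c) {J T : Type v} (hJ : #J < c)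
    (hT : #T ≤ c) : #(J → T) ≤ c := by
  rw [← power_def]
  exact (power_le_power_right hT).trans (hpow _ hJ)

theorem exists_large_subset_const {c : Cardinal.{v}} (hc : ℵ₀ ≤ c) (hpow : ∀ θ < c, c ^ θ ≤ c)
    {ι J T : Type v} (hJ : #J < c) (hT : #T ≤ c) (a : ι → J → T) {B : Set ι} (hB : c < #B) :
    ∃ B' ⊆ B, c < #B' ∧ ∃ b : J → T, ∀ p ∈ B', ∀ j, a p j = b j := by
  obtain ⟨B', h1, h2, t, ht⟩ := exists_large_fiber hc a (mk_fun_le hpow hJ hT) hB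
  exact ⟨B', h1, h2, t, fun p hp j => congrFun (ht p hp) j⟩

/-- Closure under an operation that assigns at most `c` points to each partial `J`-sequence:
the closed set is the set of values of the well-founded trees that build points by `g`. -/
theorem exists_small_closed {c : Cardinal.{v}} (hc : ℵ₀ ≤ c) (hpow : ∀ θ < c, c ^ θ ≤ c)
    {J T : Type v} (hJ : #J < c) (G : (J → Option T) → Set T) (hG : ∀ s, #(G s) ≤ c) :
    ∃ C : Set T, #C ≤ c ∧ ∀ s : J → Option T, (∀ j t, s j = some t → t ∈ C) → G s ⊆ C := by
  classical
  have hemb : ∀ s, Nonempty (G s ↪ c.out) := fun s => by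
    rw [← le_def, mk_out]; exact hG s
  let emb := fun s => (hemb s).some
  let g : c.out → (J → Option T) → Option T := fun i s =>
    if h : ∃ t : G s, emb s t = i then some h.choose else none
  have hg : ∀ s, ∀ t ∈ G s, ∃ i, g i s = some t := by
    intro s t ht
    refine ⟨emb s ⟨t, ht⟩, ?_⟩
    have h : ∃ t' : G s, emb s t' = emb s ⟨t, ht⟩ := ⟨_, rfl⟩
    have := (emb s).injective h.choose_spec
    simp only [g, dif_pos h]
    rw [this]
  let β : Option c.out → Type v := fun a => a.elim PEmpty fun _ => J
  let val : WType β → Option T := WType.elim (Option T) fun x =>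
    match x with
    | ⟨none, _⟩ => none
    | ⟨some i, f⟩ => g i f
  have hW : #(WType β) ≤ c := by
    refine WType.cardinalMk_le_of_le ?_
    refine (sum_le_mk_mul_iSup _).trans ?_
    refine (mul_le_mul' (?_ : _ ≤ c) (ciSup_le' (a := c) ?_)).trans (mul_eq_self hc).le
    · rw [mk_option, mk_out]
      exact add_le_of_le hc le_rfl (one_le_aleph0.trans hc)
    · rintro (_ | i)
      · simpa [β] using one_le_aleph0.trans hc
      · exact hpow _ hJ
  refine ⟨{t | ∃ w, val w = some t}, ?_, ?_⟩
  · have hinj : Function.Injective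
        (fun t : {t | ∃ w, val w = some t} => t.2.choose) := by
      intro t t' h
      have h1 := t.2.choose_spec
      have h2 := t'.2.choose_spec
      simp only at h
      rw [h, h2] at h1
      exact Subtype.ext (Option.some.inj h1.symm)
    exact (mk_le_of_injective hinj).trans hW
  · intro s hs t ht
    have hw : ∀ j, ∃ w, val w = s j := by
      intro j
      cases h : s j with
      | none => exact ⟨WType.mk none PEmpty.elim, rfl⟩
      | some t => exact hs j t h
    choose w hw using hw
    obtain ⟨i, hi⟩ := hg s t ht
    refine ⟨WType.mk (some i) w, ?_⟩
    change g i (fun j => val (w j)) = some t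
    simp only [hw, hi]

/-- The `Δ`-system lemma for indexed families of functions: if `c ^ θ ≤ c` for all `θ < c`, then
more than `c` functions on an index set of size less than `c` contain more than `c` functions that
agree on some set `K` of indices and take pairwise distinct values off `K`. Otherwise, every
partial function `s` would have a maximal subfamily of extensions that is disjoint off `s` and has
size at most `c`; a set of size `c` closed under the passage from `s` to the values of this
subfamily contains all the values of all functions, so more than `c` of the functions coincide. -/
theorem exists_deltaSystem {c : Cardinal.{v}} (hc : ℵ₀ ≤ c) (hpow : ∀ θ < c, c ^ θ ≤ c)
    {ι J T : Type v} (hJ : #J < c) (a : ι → J → T) {B : Set ι} (hB : c < #B) :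
    ∃ B' ⊆ B, c < #B' ∧ ∃ K : Set J, (∀ j ∈ K, ∀ p ∈ B', ∀ q ∈ B', a p j = a q j) ∧
      ∀ p ∈ B', ∀ q ∈ B', p ≠ q → ∀ j ∉ K, ∀ k ∉ K, a p j ≠ a q k := by
  classical
  let Disj : (J → Option T) → Set ι → Prop := fun s W =>
    (∀ p ∈ W, p ∈ B ∧ ∀ j t, s j = some t → a p j = t) ∧
    ∀ p ∈ W, ∀ q ∈ W, p ≠ q → ∀ j k, s j = none → s k = none → a p j ≠ a q k
  have hmax : ∀ s, ∃ W, Maximal (· ∈ {W | Disj s W}) W := by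
    intro s
    refine zorn_subset _ fun ch hch hchain => ⟨⋃₀ ch, ⟨?_, ?_⟩, fun _ => Set.subset_sUnion_of_mem⟩
    · rintro p ⟨W, hW, hp⟩
      exact (hch hW).1 p hp
    · rintro p ⟨W, hW, hp⟩ q ⟨W', hW', hq⟩
      rcases hchain.total hW hW' with h | h
      · exact (hch hW').2 p (h hp) q hq
      · exact (hch hW).2 p hp q (h hq)
  choose W hW using hmax
  by_cases hbig : ∃ s, c < #(W s)
  · obtain ⟨s, hs⟩ := hbig
    obtain ⟨⟨h1, h2⟩, -⟩ := hW s
    refine ⟨W s, fun p hp => (h1 p hp).1, hs, {j | s j ≠ none}, ?_, ?_⟩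
    · intro j hj p hp q hq
      obtain ⟨t, ht⟩ := Option.ne_none_iff_exists'.1 hj
      rw [(h1 p hp).2 j t ht, (h1 q hq).2 j t ht]
    · intro p hp q hq hpq j hj k hk
      exact h2 p hp q hq hpq j k (by simpa using hj) (by simpa using hk)
  push Not at hbig
  obtain ⟨C, hC, hcl⟩ := exists_small_closed hc hpow hJ
    (fun s => ⋃ p ∈ W s, Set.range (a p)) fun s =>
      mk_biUnion_le_of_le hc (hbig s) _ fun p _ => mk_range_le.trans hJ.le
  have hall : ∀ p ∈ B, ∀ j, a p j ∈ C := by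
    intro p hp
    let s : J → Option T := fun j => if a p j ∈ C then some (a p j) else none
    have hs1 : ∀ j t, s j = some t → a p j ∈ C ∧ a p j = t := by
      intro j t h
      by_cases hj : a p j ∈ C
      · simp only [s, if_pos hj] at h
        exact ⟨hj, Option.some.inj h⟩
      · simp [s, if_neg hj] at h
    have hs2 : ∀ j, s j = none → a p j ∉ C := by
      intro j h hj
      simp [s, if_pos hj] at h
    have hsub := hcl s fun j t h => (hs1 j t h).2 ▸ (hs1 j t h).1
    have hval : ∀ q ∈ W s, ∀ j, a q j ∈ C := fun q hq j =>
      hsub (Set.mem_biUnion hq ⟨j, rfl⟩)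
    have hpW : p ∈ W s := by
      obtain ⟨⟨h1, h2⟩, h3⟩ := hW s
      refine h3 (y := insert p (W s)) ⟨?_, ?_⟩ (Set.subset_insert _ _) (Set.mem_insert _ _)
      · rintro q (rfl | hq)
        · exact ⟨hp, fun j t h => (hs1 j t h).2⟩
        · exact h1 q hq
      · rintro q (rfl | hq) r (rfl | hr) hqr j k hj hk heq
        · exact hqr rfl
        · exact hs2 j hj (heq ▸ hval r hr k)
        · exact hs2 k hk (heq ▸ hval q hq j)
        · exact h2 q hq r hr hqr j k hj hk heq
    exact hval p hpW
  obtain ⟨B', h1, h2, b, hb⟩ := exists_large_subset_const hc hpow hJ (T := Option C)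
    (by rw [mk_option]; exact add_le_of_le hc hC (one_le_aleph0.trans hc))
    (fun p j => if h : a p j ∈ C then some ⟨a p j, h⟩ else none) hB
  refine ⟨B', h1, h2, Set.univ, ?_, by simp⟩
  intro j _ p hp q hq
  have := (hb p hp j).trans (hb q hq j).symm
  rw [dif_pos (hall p (h1 hp) j), dif_pos (hall q (h1 hq) j)] at this
  exact congrArg Subtype.val (Option.some.inj this)

/-! ### The tree of intervals -/

section Tree

variable {δ : Ordinal.{u}} {ε : OrdInterval.{u} → Ordinal.{u} → Ordinal.{u}}

theorem isSuccLimit_cof_ord {o : Ordinal.{u}} (ho : IsSuccLimit o) : IsSuccLimit o.cof.ord :=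
  isSuccLimit_ord (aleph0_le_cof_iff.2 (one_lt_cof_iff.2 ho))

theorem IsClubEnum.mono {I : OrdInterval.{u}} {e : Ordinal.{u} → Ordinal.{u}}
    (he : IsClubEnum I e) {μ ν : Ordinal.{u}} (h : μ ≤ ν) (hν : ν < I.hi.cof.ord) : e μ ≤ e ν := by
  rcases h.eq_or_lt with rfl | h
  · exact le_rfl
  · exact (he.strictMono _ _ h hν).le

theorem IsClubEnum.lt_of_lt {I : OrdInterval.{u}} {e : Ordinal.{u} → Ordinal.{u}}
    (he : IsClubEnum I e) {μ ν : Ordinal.{u}} (hμ : μ < I.hi.cof.ord) (h : e μ < e ν) : μ < ν := by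
  by_contra! h'
  exact (he.mono h' hμ).not_gt h

theorem IsClubEnum.lo_le {I : OrdInterval.{u}} {e : Ordinal.{u} → Ordinal.{u}}
    (he : IsClubEnum I e) {ν : Ordinal.{u}} (hν : ν < I.hi.cof.ord) : I.lo ≤ e ν :=
  he.zero ▸ he.mono (zero_le (a := ν)) hν

theorem IsClubEnum.succ_lt {I : OrdInterval.{u}} (hI : IsSuccLimit I.hi) {ν : Ordinal.{u}}
    (hν : ν < I.hi.cof.ord) : ν + 1 < I.hi.cof.ord :=
  (isSuccLimit_cof_ord hI).add_one_lt hν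

theorem IsClubEnum.exists_between {I : OrdInterval.{u}} {e : Ordinal.{u} → Ordinal.{u}}
    (he : IsClubEnum I e) (hI : IsSuccLimit I.hi) {α : Ordinal.{u}} (hα : α ∈ I.toSet) :
    ∃ ν < I.hi.cof.ord, e ν ≤ α ∧ α < e (ν + 1) := by
  have hex : ∃ ν, ν < I.hi.cof.ord ∧ α < e ν := by
    obtain ⟨ν, hν, h⟩ := he.cofinal (α + 1) (hI.add_one_lt hα.2)
    exact ⟨ν, hν, (lt_add_one α).trans_le h⟩
  obtain ⟨ν, ⟨hν, hlt⟩, hmin⟩ :=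
    WellFounded.has_min Ordinal.lt_wf {ν | ν < I.hi.cof.ord ∧ α < e ν} hex
  have hmin' : ∀ μ < ν, e μ ≤ α := fun μ hμ => by
    by_contra! h
    exact hmin μ ⟨hμ.trans hν, h⟩ hμ
  rcases Ordinal.zero_or_succ_or_isSuccLimit ν with rfl | ⟨μ, rfl⟩ | hlim
  · rw [he.zero] at hlt
    exact absurd hα.1 hlt.not_ge
  · rw [Order.succ_eq_add_one] at hν hlt hmin'
    exact ⟨μ, (lt_add_one μ).trans hν, hmin' μ (lt_add_one μ), hlt⟩
  · have : e ν ≤ α := (he.continuous ν hν hlim).2 (by rintro _ ⟨μ, hμ, rfl⟩; exact hmin' μ hμ)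
    exact absurd hlt this.not_gt

theorem clubSet_subset (hε : IsClubChoice ε) {I : OrdInterval.{u}} (hI : I.lo < I.hi)
    {a : Ordinal.{u}} (ha : a ∈ clubSet ε I) : a ∈ I.toSet := by
  rcases ha with ⟨hl, ν, hν, rfl⟩ | ⟨β, hβ, rfl | rfl⟩
  · exact ⟨(hε I hI hl).lo_le hν, (hε I hI hl).lt_hi ν hν⟩
  · exact ⟨le_rfl, hI⟩
  · rw [hβ] at hI
    exact ⟨Order.lt_add_one_iff.1 hI, hβ ▸ lt_add_one a⟩

theorem mem_clubSet_of_isSuccLimit {I : OrdInterval.{u}} (hl : IsSuccLimit I.hi) {a : Ordinal.{u}} :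
    a ∈ clubSet ε I ↔ ∃ ν < I.hi.cof.ord, a = ε I ν := by
  constructor
  · rintro (⟨-, h⟩ | ⟨β, hβ, -⟩)
    · exact h
    · rw [hβ] at hl
      exact absurd hl (Order.not_isSuccLimit_succ _)
  · exact fun h => Or.inl ⟨hl, h⟩

theorem mem_pieces_of_isSuccLimit {I : OrdInterval.{u}} (hl : IsSuccLimit I.hi)
    {P : OrdInterval.{u}} :
    P ∈ pieces ε I ↔ ∃ ν < I.hi.cof.ord, P = ⟨ε I ν, ε I (ν + 1)⟩ := by
  constructor
  · rintro (⟨-, h⟩ | ⟨β, hβ, -⟩)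
    · exact h
    · rw [hβ] at hl
      exact absurd hl (Order.not_isSuccLimit_succ _)
  · exact fun h => Or.inl ⟨hl, h⟩

theorem exists_piece (hε : IsClubChoice ε) {I : OrdInterval.{u}} {α : Ordinal.{u}}
    (hα : α ∈ I.toSet) : ∃ P ∈ pieces ε I, α ∈ P.toSet := by
  have hI : I.lo < I.hi := hα.1.trans_lt hα.2
  rcases Ordinal.zero_or_succ_or_isSuccLimit I.hi with h0 | ⟨β, hβ⟩ | hl
  · rw [h0] at hI
    exact absurd hI not_lt_zero
  · rw [Order.succ_eq_add_one] at hβ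
    rcases lt_or_ge α β with h | h
    · exact ⟨⟨I.lo, β⟩, Or.inr ⟨β, hβ.symm, Or.inl rfl, hα.1.trans_lt h⟩, hα.1, h⟩
    · exact ⟨⟨β, β + 1⟩, Or.inr ⟨β, hβ.symm, Or.inr rfl, lt_add_one β⟩, h, hβ ▸ hα.2⟩
  · obtain ⟨ν, hν, h1, h2⟩ := (hε I hI hl).exists_between hl hα
    exact ⟨_, Or.inl ⟨hl, ν, hν, rfl⟩, h1, h2⟩

theorem piece_subset (hε : IsClubChoice ε) {I P : OrdInterval.{u}} (hI : I.lo < I.hi)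
    (hP : P ∈ pieces ε I) : I.lo ≤ P.lo ∧ P.lo < P.hi ∧ P.hi ≤ I.hi := by
  rcases hP with ⟨hl, ν, hν, rfl⟩ | ⟨β, hβ, rfl | rfl, h⟩
  · have he := hε I hI hl
    exact ⟨he.lo_le hν, he.strictMono _ _ (lt_add_one ν) (IsClubEnum.succ_lt hl hν),
      (he.lt_hi _ (IsClubEnum.succ_lt hl hν)).le⟩
  · exact ⟨le_rfl, h, hβ ▸ (lt_add_one β).le⟩
  · rw [hβ] at hI
    exact ⟨Order.lt_add_one_iff.1 hI, h, hβ.ge⟩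

theorem piece_hi_lt (hε : IsClubChoice ε) {I P : OrdInterval.{u}} (hI : I.lo < I.hi)
    (hl : IsSuccLimit I.hi) (hP : P ∈ pieces ε I) : P.hi < I.hi := by
  obtain ⟨ν, hν, rfl⟩ := (mem_pieces_of_isSuccLimit hl).1 hP
  exact (hε I hI hl).lt_hi _ (IsClubEnum.succ_lt hl hν)

/-- Among the points of a piece of `I`, only the first one can lie in `E(I)`. -/
theorem eq_lo_of_mem_piece (hε : IsClubChoice ε) {I P : OrdInterval.{u}} (hI : I.lo < I.hi)
    (hP : P ∈ pieces ε I) {a : Ordinal.{u}} (ha : a ∈ clubSet ε I) (haP : a ∈ P.toSet) :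
    a = P.lo := by
  rcases hP with ⟨hl, ν, hν, rfl⟩ | ⟨β, hβ, hP, h⟩
  · obtain ⟨μ, hμ, rfl⟩ := (mem_clubSet_of_isSuccLimit hl).1 ha
    have he := hε I hI hl
    have h1 : μ < ν + 1 := he.lt_of_lt hμ haP.2
    exact le_antisymm (he.mono (Order.lt_add_one_iff.1 h1) hν) haP.1
  · rcases ha with ⟨hl, -⟩ | ⟨β', hβ', ha⟩
    · rw [hβ] at hl
      exact absurd hl (Order.not_isSuccLimit_succ _)
    · obtain rfl : β = β' := by simpa using hβ.symm.trans hβ'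
      rw [hβ] at hI
      have hI := Order.lt_add_one_iff.1 hI
      rcases hP with rfl | rfl <;> rcases ha with rfl | rfl
      · rfl
      · exact absurd haP.2 (lt_irrefl _)
      · exact le_antisymm hI haP.1
      · rfl

theorem piece_lo_mem_clubSet {I P : OrdInterval.{u}}
    (hP : P ∈ pieces ε I) : P.lo ∈ clubSet ε I := by
  rcases hP with ⟨hl, ν, hν, rfl⟩ | ⟨β, hβ, rfl | rfl, -⟩
  · exact Or.inl ⟨hl, ν, hν, rfl⟩
  · exact Or.inr ⟨β, hβ, Or.inl rfl⟩
  · exact Or.inr ⟨β, hβ, Or.inr rfl⟩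

theorem piece_unique (hε : IsClubChoice ε) {I P Q : OrdInterval.{u}} (hI : I.lo < I.hi)
    (hP : P ∈ pieces ε I) (hQ : Q ∈ pieces ε I) {a : Ordinal.{u}} (haP : a ∈ P.toSet)
    (haQ : a ∈ Q.toSet) : P = Q := by
  have key : ∀ P ∈ pieces ε I, ∀ Q ∈ pieces ε I, a ∈ P.toSet → a ∈ Q.toSet → P.lo ≤ Q.lo →
      P.lo = Q.lo := by
    intro P hP Q hQ haP haQ h
    exact (eq_lo_of_mem_piece hε hI hP (piece_lo_mem_clubSet hQ) ⟨h, haQ.1.trans_lt haP.2⟩).symm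
  have hlo : P.lo = Q.lo := by
    rcases le_total P.lo Q.lo with h | h
    · exact key P hP Q hQ haP haQ h
    · exact (key Q hQ P hP haQ haP h).symm
  rcases hP with ⟨hl, ν, hν, rfl⟩ | ⟨β, hβ, hP, h⟩
  · obtain ⟨μ, hμ, rfl⟩ := (mem_pieces_of_isSuccLimit hl).1 hQ
    have he := hε I hI hl
    simp only at hlo
    obtain rfl : ν = μ := by
      rcases lt_trichotomy ν μ with h | h | h
      · exact absurd hlo (he.strictMono _ _ h hμ).ne
      · exact h
      · exact absurd hlo (he.strictMono _ _ h hν).ne'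
    rfl
  · rcases hQ with ⟨hl, -⟩ | ⟨β', hβ', hQ, h'⟩
    · rw [hβ] at hl
      exact absurd hl (Order.not_isSuccLimit_succ _)
    · obtain rfl : β = β' := by simpa using hβ.symm.trans hβ'
      rcases hP with rfl | rfl <;> rcases hQ with rfl | rfl
      · rfl
      · exact absurd h (by simp only at hlo ⊢; exact hlo ▸ lt_irrefl _)
      · exact absurd h' (by simp only at hlo ⊢; exact hlo ▸ lt_irrefl _)
      · rfl

theorem mem_level_succ {n : ℕ} {K : OrdInterval.{u}} :
    K ∈ level δ ε (n + 1) ↔ ∃ I ∈ level δ ε n, K ∈ pieces ε I := by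
  simp only [level, Set.mem_iUnion, exists_prop]

theorem level_lt (hε : IsClubChoice ε) (hδ : 0 < δ) {n : ℕ} {I : OrdInterval.{u}}
    (hI : I ∈ level δ ε n) : I.lo < I.hi ∧ I.hi ≤ δ := by
  induction n generalizing I with
  | zero => obtain rfl : I = ⟨0, δ⟩ := hI; exact ⟨hδ, le_rfl⟩
  | succ n ih =>
    obtain ⟨K, hK, hI⟩ := mem_level_succ.1 hI
    have h := piece_subset hε (ih hK).1 hI
    exact ⟨h.2.1, h.2.2.trans (ih hK).2⟩

theorem level_unique (hε : IsClubChoice ε) (hδ : 0 < δ) {n : ℕ} {I K : OrdInterval.{u}}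
    (hI : I ∈ level δ ε n) (hK : K ∈ level δ ε n) {a : Ordinal.{u}} (haI : a ∈ I.toSet)
    (haK : a ∈ K.toSet) : I = K := by
  induction n generalizing I K with
  | zero =>
    obtain rfl : I = ⟨0, δ⟩ := hI
    obtain rfl : K = ⟨0, δ⟩ := hK
    rfl
  | succ n ih =>
    obtain ⟨I', hI', hI⟩ := mem_level_succ.1 hI
    obtain ⟨K', hK', hK⟩ := mem_level_succ.1 hK
    have h1 := piece_subset hε (level_lt hε hδ hI').1 hI
    have h2 := piece_subset hε (level_lt hε hδ hK').1 hK
    obtain rfl := ih hI' hK' ⟨h1.1.trans haI.1, haI.2.trans_le h1.2.2⟩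
      ⟨h2.1.trans haK.1, haK.2.trans_le h2.2.2⟩
    exact piece_unique hε (level_lt hε hδ hI').1 hI hK haI haK

theorem exists_level (hε : IsClubChoice ε) (n : ℕ) {α : Ordinal.{u}} (hα : α < δ) :
    ∃ I ∈ level δ ε n, α ∈ I.toSet := by
  induction n with
  | zero => exact ⟨⟨0, δ⟩, rfl, zero_le, hα⟩
  | succ n ih =>
    obtain ⟨I, hI, h⟩ := ih
    obtain ⟨P, hP, hPα⟩ := exists_piece hε h
    exact ⟨P, Set.mem_biUnion hI hP, hPα⟩

theorem intervalAt_spec (hε : IsClubChoice ε) (n : ℕ) {α : Ordinal.{u}} (hα : α < δ) :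
    intervalAt δ ε α n ∈ level δ ε n ∧ α ∈ (intervalAt δ ε α n).toSet :=
  Classical.epsilon_spec (p := fun I => I ∈ level δ ε n ∧ α ∈ I.toSet) (exists_level hε n hα)

theorem intervalAt_eq (hε : IsClubChoice ε) {n : ℕ} {α : Ordinal.{u}} {I : OrdInterval.{u}}
    (hα : α < δ) (hI : I ∈ level δ ε n) (h : α ∈ I.toSet) : intervalAt δ ε α n = I :=
  level_unique hε (pos_of_gt hα) (intervalAt_spec hε n hα).1 hI (intervalAt_spec hε n hα).2 h

theorem tree_lt (hε : IsClubChoice ε) (hδ : 0 < δ) {I : OrdInterval.{u}} (hI : I ∈ tree δ ε) :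
    I.lo < I.hi ∧ I.hi ≤ δ := by
  obtain ⟨n, hn⟩ := Set.mem_iUnion.1 hI
  exact level_lt hε hδ hn

theorem exists_ancestor (hε : IsClubChoice ε) (hδ : 0 < δ) (m d : ℕ) {K : OrdInterval.{u}}
    (hK : K ∈ level δ ε (m + d + 1)) :
    ∃ I ∈ level δ ε m, ∃ P ∈ pieces ε I, P.lo ≤ K.lo ∧ K.hi ≤ P.hi := by
  induction d generalizing K with
  | zero =>
    obtain ⟨I, hI, h⟩ := mem_level_succ.1 hK
    exact ⟨I, hI, K, h, le_rfl, le_rfl⟩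
  | succ d ih =>
    obtain ⟨K', hK', h⟩ := mem_level_succ.1 hK
    have hs := piece_subset hε (level_lt hε hδ hK').1 h
    obtain ⟨I, hI, P, hP, h1, h2⟩ := ih hK'
    exact ⟨I, hI, P, hP, h1.trans hs.1, hs.2.2.trans h2⟩

/-- Two intervals of the tree with a common point are nested, and a proper subinterval `K` of `I`
is contained in a piece of `I`. -/
theorem tree_dichotomy (hε : IsClubChoice ε) (hδ : 0 < δ) {I K : OrdInterval.{u}}
    (hI : I ∈ tree δ ε) (hK : K ∈ tree δ ε) {a : Ordinal.{u}} (haI : a ∈ I.toSet)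
    (haK : a ∈ K.toSet) :
    (K.lo ≤ I.lo ∧ I.hi ≤ K.hi) ∨ ∃ P ∈ pieces ε I, P.lo ≤ K.lo ∧ K.hi ≤ P.hi := by
  obtain ⟨m, hm⟩ := Set.mem_iUnion.1 hI
  obtain ⟨n, hn⟩ := Set.mem_iUnion.1 hK
  rcases lt_trichotomy m n with h | rfl | h
  · obtain ⟨d, rfl⟩ := Nat.exists_eq_add_of_lt h
    obtain ⟨I', hI', P, hP, h1, h2⟩ := exists_ancestor hε hδ m d hn
    have hs := piece_subset hε (level_lt hε hδ hI').1 hP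
    obtain rfl := level_unique hε hδ hm hI' haI
      ⟨hs.1.trans (h1.trans haK.1), haK.2.trans_le (h2.trans hs.2.2)⟩
    exact Or.inr ⟨P, hP, h1, h2⟩
  · obtain rfl := level_unique hε hδ hm hn haI haK
    exact Or.inl ⟨le_rfl, le_rfl⟩
  · obtain ⟨d, rfl⟩ := Nat.exists_eq_add_of_lt h
    obtain ⟨K', hK', P, hP, h1, h2⟩ := exists_ancestor hε hδ n d hm
    have hs := piece_subset hε (level_lt hε hδ hK').1 hP
    obtain rfl := level_unique hε hδ hn hK' haK
      ⟨hs.1.trans (h1.trans haI.1), haI.2.trans_le (h2.trans hs.2.2)⟩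
    exact Or.inl ⟨hs.1.trans h1, h2.trans hs.2.2⟩

/-- An interval of the tree with limit right endpoint is determined by that endpoint. -/
theorem tree_eq_of_hi_eq (hε : IsClubChoice ε) (hδ : 0 < δ) {I K : OrdInterval.{u}}
    (hI : I ∈ tree δ ε) (hK : K ∈ tree δ ε) (hl : IsSuccLimit I.hi) (h : I.hi = K.hi) :
    I = K := by
  have hI' := (tree_lt hε hδ hI).1
  have hK' := (tree_lt hε hδ hK).1
  have hmI : max I.lo K.lo ∈ I.toSet := ⟨le_max_left _ _, max_lt hI' (h ▸ hK')⟩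
  have hmK : max I.lo K.lo ∈ K.toSet := ⟨le_max_right _ _, max_lt (h ▸ hI') hK'⟩
  have key : ∀ I K : OrdInterval.{u}, I ∈ tree δ ε → K ∈ tree δ ε → IsSuccLimit I.hi →
      I.hi = K.hi → max I.lo K.lo ∈ I.toSet → max I.lo K.lo ∈ K.toSet → K.lo ≤ I.lo := by
    intro I K hI hK hl h h1 h2
    rcases tree_dichotomy hε hδ hI hK h1 h2 with h3 | ⟨P, hP, -, h3⟩
    · exact h3.1
    · have := piece_hi_lt hε (tree_lt hε hδ hI).1 hl hP
      exact absurd (h ▸ h3) this.not_ge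
  have h1 := key I K hI hK hl h hmI hmK
  have h2 := key K I hK hI (h ▸ hl) h.symm (max_comm I.lo K.lo ▸ hmK) (max_comm I.lo K.lo ▸ hmI)
  exact OrdInterval.ext (le_antisymm h2 h1) h

/-- An interval of the tree that has a point of `E(I)` in its interior contains `I`. -/
theorem subset_of_mem_clubSet (hε : IsClubChoice ε) (hδ : 0 < δ) {I Λ : OrdInterval.{u}}
    (hI : I ∈ tree δ ε) (hΛ : Λ ∈ tree δ ε) {e : Ordinal.{u}} (he : e ∈ clubSet ε I)
    (h1 : Λ.lo < e) (h2 : e < Λ.hi) : Λ.lo ≤ I.lo ∧ I.hi ≤ Λ.hi := by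
  have hI' := (tree_lt hε hδ hI).1
  rcases tree_dichotomy hε hδ hI hΛ (clubSet_subset hε hI' he) ⟨h1.le, h2⟩ with h | ⟨P, hP, h3, h4⟩
  · exact h
  · have := eq_lo_of_mem_piece hε hI' hP he ⟨h3.trans h1.le, h2.trans_le h4⟩
    exact absurd (this ▸ h3) h1.not_ge

/-- Every ordinal below `δ` is the left endpoint of an interval of the tree, since the right
endpoints of the intervals containing it strictly decrease until this happens. -/
theorem exists_level_lo_eq (hε : IsClubChoice ε) {α : Ordinal.{u}} (hα : α < δ) :
    ∃ n, ∃ I ∈ level δ ε n, I.lo = α := by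
  by_contra! hcon
  have key : ∀ η : Ordinal.{u}, ∀ n, ∀ I ∈ level δ ε n, α ∈ I.toSet → I.hi = η → False := by
    intro η
    induction η using WellFoundedLT.induction with
    | ind η ih =>
      rintro n I hI hαI rfl
      have hI' := (level_lt hε (pos_of_gt hα) hI).1
      obtain ⟨P, hP, hαP⟩ := exists_piece hε hαI
      have hP' : P ∈ level δ ε (n + 1) := Set.mem_biUnion hI hP
      refine ih P.hi ?_ (n + 1) P hP' hαP rfl
      rcases hP with ⟨hl, ν, hν, rfl⟩ | ⟨β, hβ, rfl | rfl, h⟩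
      · exact (hε I hI' hl).lt_hi _ (IsClubEnum.succ_lt hl hν)
      · rw [hβ]; exact lt_add_one β
      · exact absurd (le_antisymm hαP.1 (Order.lt_add_one_iff.1 hαP.2)) (hcon _ _ hP')
  exact key δ 0 ⟨0, δ⟩ rfl ⟨zero_le, hα⟩ rfl

theorem level_lo_persist (hε : IsClubChoice ε) (hδ : 0 < δ) {n m : ℕ} (h : n ≤ m)
    {I : OrdInterval.{u}} (hI : I ∈ level δ ε n) : ∃ K ∈ level δ ε m, K.lo = I.lo := by
  induction m, h using Nat.le_induction with
  | base => exact ⟨I, hI, rfl⟩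
  | succ m _ ih =>
    obtain ⟨K, hK, h⟩ := ih
    have hK' := (level_lt hε hδ hK).1
    obtain ⟨P, hP, hKP⟩ := exists_piece hε (I := K) ⟨le_rfl, hK'⟩
    refine ⟨P, Set.mem_biUnion hK hP, le_antisymm (hKP.1.trans h.le) ?_⟩
    exact h ▸ (piece_subset hε hK' hP).1

theorem rankOf_spec (hε : IsClubChoice ε) {α : Ordinal.{u}} (hα : α < δ) :
    ∃ I ∈ level δ ε (rankOf δ ε α), I.lo = α :=
  Nat.sInf_mem (s := {n | ∃ I ∈ level δ ε n, I.lo = α}) (exists_level_lo_eq hε hα)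

theorem rankOf_le_iff (hε : IsClubChoice ε) {α : Ordinal.{u}} (hα : α < δ) {n : ℕ}
    {I : OrdInterval.{u}} (hI : I ∈ level δ ε n) (h : α ∈ I.toSet) :
    rankOf δ ε α ≤ n ↔ I.lo = α := by
  constructor
  · intro hn
    obtain ⟨K, hK, hKα⟩ := rankOf_spec hε hα
    obtain ⟨K', hK', hKK⟩ := level_lo_persist hε (pos_of_gt hα) hn hK
    have hlo : K'.lo = α := hKK.trans hKα
    have := level_unique hε (pos_of_gt hα) hI hK' h
      ⟨hlo.le, hlo ▸ (level_lt hε (pos_of_gt hα) hK').1⟩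
    rw [this, hlo]
  · intro hlo
    exact Nat.sInf_le ⟨I, hI, hlo⟩

/-- The basic orbit of `ζ` collects the points below `ζ` of the sets `E(M)`, where `M` ranges over
the intervals of the tree that contain `ζ` in their interior. -/
theorem mem_basicOrbit (hε : IsClubChoice ε) {ζ : Ordinal.{u}} (hζ : ζ < δ) {a : Ordinal.{u}} :
    a ∈ basicOrbit δ ε ζ ↔
      a < ζ ∧ ∃ M ∈ tree δ ε, M.lo < ζ ∧ ζ < M.hi ∧ a ∈ clubSet ε M := by
  simp only [basicOrbit, Set.mem_iUnion]
  constructor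
  · rintro ⟨m, hm, ha, haζ⟩
    obtain ⟨h1, h2⟩ := intervalAt_spec (δ := δ) hε m hζ
    refine ⟨haζ, _, Set.mem_iUnion.2 ⟨m, h1⟩, lt_of_le_of_ne h2.1 fun h => ?_, h2.2, ha⟩
    exact hm.not_ge ((rankOf_le_iff hε hζ h1 h2).2 h)
  · rintro ⟨haζ, M, hM, h1, h2, ha⟩
    obtain ⟨m, hm⟩ := Set.mem_iUnion.1 hM
    have hζM : ζ ∈ M.toSet := ⟨h1.le, h2⟩
    refine ⟨m, ?_, ?_, haζ⟩
    · by_contra! h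
      exact h1.ne ((rankOf_le_iff hε hζ hm hζM).1 h)
    · rwa [intervalAt_eq hε hζ hm hζM]

end Tree

/-! ### Orbits -/

section OrbitLemmas

variable {κ lam : Cardinal.{u}} {δ : Ordinal.{u}} {ε : OrdInterval.{u} → Ordinal.{u} → Ordinal.{u}}

theorem limitInterval_spec (hε : IsClubChoice ε) {ζ : Ordinal.{u}} (hζ : ζ < δ)
    (hl : IsSuccLimit ζ) :
    limitInterval δ ε ζ ∈ tree δ ε ∧ IsSuccLimit (limitInterval δ ε ζ).hi ∧
      (limitInterval δ ε ζ).lo < ζ ∧ ((limitInterval δ ε ζ).hi = ζ ∨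
        ζ < (limitInterval δ ε ζ).hi ∧ ∃ ν < (limitInterval δ ε ζ).hi.cof.ord, IsSuccLimit ν ∧
          ε (limitInterval δ ε ζ) ν = ζ) := by
  have hδ : 0 < δ := pos_of_gt hζ
  have hζ0 : 0 < ζ := hl.bot_lt
  by_cases h : ∃ I ∈ level δ ε (rankOf δ ε ζ), I.hi = ζ
  · have hJ : limitInterval δ ε ζ = h.choose := by rw [limitInterval, dif_pos h]
    obtain ⟨h1, h2⟩ := h.choose_spec
    rw [← hJ] at h1 h2
    have hlo := (level_lt hε hδ h1).1
    rw [h2] at hlo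
    exact ⟨Set.mem_iUnion.2 ⟨_, h1⟩, h2.symm ▸ hl, hlo, Or.inl h2⟩
  · have hJ : limitInterval δ ε ζ = intervalAt δ ε ζ (rankOf δ ε ζ - 1) := by
      rw [limitInterval, dif_neg h]
    obtain ⟨n, hn⟩ : ∃ n, rankOf δ ε ζ = n + 1 := by
      refine Nat.exists_eq_succ_of_ne_zero fun h0 => ?_
      have := (rankOf_le_iff hε hζ (n := 0) (I := ⟨0, δ⟩) rfl ⟨zero_le, hζ⟩).1 h0.le
      exact hζ0.ne this
    rw [hn] at h hJ
    rw [Nat.add_sub_cancel] at hJ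
    obtain ⟨h1, h2⟩ := intervalAt_spec (δ := δ) hε n hζ
    rw [← hJ] at h1 h2
    generalize limitInterval δ ε ζ = J at *
    have hlt := (level_lt hε hδ h1).1
    have hlo : J.lo < ζ := by
      refine lt_of_le_of_ne h2.1 fun he => ?_
      have := (rankOf_le_iff hε hζ h1 h2).2 he
      omega
    -- The interval of the next level that contains `ζ` starts at `ζ`.
    obtain ⟨P, hP, hPζ⟩ := exists_piece hε h2
    have hPl : P ∈ level δ ε (n + 1) := mem_level_succ.2 ⟨J, h1, hP⟩
    have hPlo : P.lo = ζ := (rankOf_le_iff hε hζ hPl hPζ).1 hn.le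
    have hJl : IsSuccLimit J.hi := by
      rcases hP with ⟨hl, -⟩ | ⟨β, hβ, rfl | rfl, -⟩
      · exact hl
      · exact absurd hPlo hlo.ne
      · simp only at hPlo
        subst hPlo
        exact absurd ⟨⟨J.lo, β⟩, mem_level_succ.2 ⟨J, h1, Or.inr ⟨β, hβ, Or.inl rfl, hlo⟩⟩, rfl⟩ h
    refine ⟨Set.mem_iUnion.2 ⟨_, h1⟩, hJl, hlo, Or.inr ⟨h2.2, ?_⟩⟩
    obtain ⟨ν, hν, rfl⟩ := (mem_pieces_of_isSuccLimit hJl).1 hP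
    simp only at hPlo
    refine ⟨ν, hν, ?_, hPlo⟩
    rcases Ordinal.zero_or_succ_or_isSuccLimit ν with rfl | ⟨μ, rfl⟩ | hlim
    · rw [(hε J hlt hJl).zero] at hPlo
      exact absurd hPlo hlo.ne
    · rw [Order.succ_eq_add_one] at hν hPlo
      exact absurd ⟨⟨ε J μ, ε J (μ + 1)⟩, mem_level_succ.2 ⟨J, h1, Or.inl ⟨hJl, μ,
        (lt_add_one μ).trans hν, rfl⟩⟩, hPlo⟩ h
    · exact hlim

theorem le_limitInterval_hi (hε : IsClubChoice ε) {ζ : Ordinal.{u}} (hζ : ζ < δ)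
    (hl : IsSuccLimit ζ) : ζ ≤ (limitInterval δ ε ζ).hi := by
  rcases (limitInterval_spec hε hζ hl).2.2.2 with h | h
  · exact h.ge
  · exact h.1.le

/-- The points of `E(J(ζ))` are cofinal in `ζ`. -/
theorem limitInterval_cofinal (hε : IsClubChoice ε) {ζ : Ordinal.{u}} (hζ : ζ < δ)
    (hl : IsSuccLimit ζ) {b : Ordinal.{u}} (hb : b < ζ) :
    ∃ e ∈ clubSet ε (limitInterval δ ε ζ), b < e ∧ e < ζ := by
  obtain ⟨h1, h2, h3, h4⟩ := limitInterval_spec hε hζ hl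
  have he := hε _ (tree_lt hε (pos_of_gt hζ) h1).1 h2
  rcases h4 with h4 | ⟨h4, ν, hν, hνl, h5⟩
  · obtain ⟨ν, hν, h⟩ := he.cofinal (b + 1) (h4.symm ▸ hl.add_one_lt hb)
    exact ⟨_, Or.inl ⟨h2, ν, hν, rfl⟩, (lt_add_one b).trans_le h,
      (he.lt_hi ν hν).trans_eq h4⟩
  · by_contra! hcon
    have : ζ ≤ b := by
      rw [← h5]
      refine (he.continuous ν hν hνl).2 ?_
      rintro _ ⟨μ, hμ, rfl⟩
      by_contra! hlt
      exact (hcon _ (Or.inl ⟨h2, μ, hμ.trans hν, rfl⟩) hlt).not_gt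
        ((he.strictMono _ _ hμ hν).trans_eq h5)
    exact this.not_gt hb

theorem eq_limitInterval_of_hi_eq (hε : IsClubChoice ε) {ζ : Ordinal.{u}} (hζ : ζ < δ)
    (hl : IsSuccLimit ζ) {I : OrdInterval.{u}} (hI : I ∈ tree δ ε) (h : I.hi = ζ) :
    I = limitInterval δ ε ζ := by
  have hδ : 0 < δ := pos_of_gt hζ
  obtain ⟨h1, h2, h3, h4⟩ := limitInterval_spec hε hζ hl
  rcases h4 with h4 | ⟨h4, -⟩
  · exact tree_eq_of_hi_eq hε hδ hI h1 (h ▸ hl) (h.trans h4.symm)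
  · exfalso
    have hIlt := (tree_lt hε hδ hI).1
    have hJlt := (tree_lt hε hδ h1).1
    obtain ⟨e, he, hIe, heζ⟩ := limitInterval_cofinal hε hζ hl (h ▸ hIlt)
    have hsub := subset_of_mem_clubSet hε hδ h1 hI he hIe (heζ.trans_eq h.symm)
    exact (hsub.2.trans_eq h).not_gt h4

theorem cof_hi_le (hδκ : δ < (succ (succ κ)).ord) {o : Ordinal.{u}} (ho : o ≤ δ) :
    o.cof ≤ succ κ := by
  refine (cof_le_card o).trans (Order.lt_succ_iff.1 ?_)
  exact lt_ord.1 (ho.trans_lt hδκ)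

theorem limitInterval_hi_eq (hε : IsClubChoice ε) (hδκ : δ < (succ (succ κ)).ord)
    {ζ : Ordinal.{u}} (hζ : ζ < δ) (hl : IsSuccLimit ζ) (hcof : ζ.cof = succ κ) :
    (limitInterval δ ε ζ).hi = ζ := by
  obtain ⟨h1, h2, h3, h4⟩ := limitInterval_spec hε hζ hl
  have hlt := tree_lt hε (pos_of_gt hζ) h1
  rcases h4 with h4 | ⟨h4, ν, hν, hνl, h5⟩
  · exact h4
  · exfalso
    have he := hε _ hlt.1 h2
    have hcard : ν.card < succ κ := (lt_ord.1 hν).trans_le (cof_hi_le hδκ hlt.2)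
    have hsup : sSup (ε (limitInterval δ ε ζ) '' Set.Iio ν) < ζ := by
      refine sSup_lt_of_lt_cof ?_ ?_
      · rw [← lift_cof, hcof]
        refine mk_image_le.trans_lt ?_
        rw [Cardinal.mk_Iio_ordinal]
        exact lift_lt.2 hcard
      · rintro _ ⟨μ, hμ, rfl⟩
        exact (he.strictMono _ _ hμ hν).trans_eq h5
    have hlub := he.continuous ν hν hνl
    have := hlub.csSup_eq ⟨_, ⟨0, hνl.bot_lt, rfl⟩⟩
    rw [this, h5] at hsup
    exact lt_irrefl _ hsup

theorem mem_underlying_iff {x : Pt.{u}} : x ∈ underlying κ lam δ ↔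
    x.1 < δ ∧ (x.2 < κ.ord ∨
      ((x.1.cof = κ ∨ x.1.cof = succ κ) ∧ κ.ord ≤ x.2 ∧ x.2 < lam.ord)) := by
  simp only [underlying, block, bigLevels, Set.mem_union, Set.mem_iUnion, Set.mem_ofPred_eq,
    exists_prop]
  constructor
  · rintro (⟨h1, h2⟩ | ⟨ζ, ⟨h1, h2⟩, rfl, h3⟩)
    · exact ⟨h1, Or.inl h2⟩
    · exact ⟨h1, Or.inr ⟨h2, h3⟩⟩
  · rintro ⟨h1, h2 | ⟨h2, h3⟩⟩
    · exact Or.inl ⟨h1, h2⟩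
    · exact Or.inr ⟨x.1, ⟨h1, h2⟩, rfl, h3⟩

theorem blockOf_eq_none {x : Pt.{u}} : blockOf κ x = none ↔ x.2 < κ.ord := by
  unfold blockOf
  split_ifs with h <;> simp [h]

theorem blockOf_of_ne_none {x : Pt.{u}} (h : blockOf κ x ≠ none) : blockOf κ x = some x.1 := by
  rw [Ne, blockOf_eq_none] at h
  simp [blockOf, h]

theorem cof_of_blockOf_ne_none {x : Pt.{u}} (hx : x ∈ underlying κ lam δ)
    (h : blockOf κ x ≠ none) : x.1.cof = κ ∨ x.1.cof = succ κ := by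
  rw [Ne, blockOf_eq_none] at h
  rcases (mem_underlying_iff.1 hx).2 with h1 | h1
  · exact absurd h1 h
  · exact h1.1

theorem isSuccLimit_of_blockOf_ne_none (hκ : ℵ₀ ≤ κ) {x : Pt.{u}} (hx : x ∈ underlying κ lam δ)
    (h : blockOf κ x ≠ none) : IsSuccLimit x.1 := by
  have : ℵ₀ ≤ x.1.cof := by
    rcases cof_of_blockOf_ne_none hx h with h | h <;> rw [h]
    · exact hκ
    · exact hκ.trans (le_succ κ)
  exact one_lt_cof_iff.1 (aleph0_le_cof_iff.1 this)

theorem mem_orbit (hε : IsClubChoice ε) (hκ : ℵ₀ ≤ κ) {x : Pt.{u}} (hx : x ∈ underlying κ lam δ)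
    {a : Ordinal.{u}} : a ∈ orbit κ δ ε x ↔ a < x.1 ∧ ∃ M ∈ tree δ ε, a ∈ clubSet ε M ∧
      ((M.lo < x.1 ∧ x.1 < M.hi) ∨ blockOf κ x ≠ none ∧ M = limitInterval δ ε x.1) := by
  have hxδ := (mem_underlying_iff.1 hx).1
  unfold orbit
  split_ifs with h
  · rw [mem_basicOrbit hε hxδ]
    simp only [h]
    constructor
    · rintro ⟨h1, M, hM, h2, h3, h4⟩
      exact ⟨h1, M, hM, h4, Or.inl ⟨h2, h3⟩⟩
    · rintro ⟨h1, M, hM, h4, ⟨h2, h3⟩ | ⟨h2, -⟩⟩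
      · exact ⟨h1, M, hM, h2, h3, h4⟩
      · exact absurd rfl h2
  · rw [extendedOrbit, Set.mem_union, mem_basicOrbit hε hxδ]
    constructor
    · rintro (⟨h1, M, hM, h2, h3, h4⟩ | ⟨h1, h2⟩)
      · exact ⟨h1, M, hM, h4, Or.inl ⟨h2, h3⟩⟩
      · exact ⟨h2, _, (limitInterval_spec hε hxδ (isSuccLimit_of_blockOf_ne_none hκ hx h)).1, h1,
          Or.inr ⟨h, rfl⟩⟩
    · rintro ⟨h1, M, hM, h4, ⟨h2, h3⟩ | ⟨-, rfl⟩⟩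
      · exact Or.inl ⟨h1, M, hM, h2, h3, h4⟩
      · exact Or.inr ⟨h4, h1⟩

theorem lt_of_mem_orbit (hε : IsClubChoice ε) (hκ : ℵ₀ ≤ κ) {x : Pt.{u}}
    (hx : x ∈ underlying κ lam δ) {a : Ordinal.{u}} (ha : a ∈ orbit κ δ ε x) : a < x.1 :=
  ((mem_orbit hε hκ hx).1 ha).1

/-- The initial segment of an orbit below `e` is contained in the basic orbit of `e`. -/
theorem mem_basicOrbit_of_mem_orbit (hε : IsClubChoice ε) (hκ : ℵ₀ ≤ κ) {x : Pt.{u}}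
    (hx : x ∈ underlying κ lam δ) {a e : Ordinal.{u}} (ha : a ∈ orbit κ δ ε x) (hae : a < e)
    (hex : e < x.1) : a ∈ basicOrbit δ ε e := by
  have hxδ := (mem_underlying_iff.1 hx).1
  obtain ⟨-, M, hM, haM, h⟩ := (mem_orbit hε hκ hx).1 ha
  have hle : x.1 ≤ M.hi := by
    rcases h with h | ⟨h, rfl⟩
    · exact h.2.le
    · exact le_limitInterval_hi hε hxδ (isSuccLimit_of_blockOf_ne_none hκ hx h)
  refine (mem_basicOrbit hε (hex.trans hxδ)).2 ⟨hae, M, hM, ?_, hex.trans_le hle, haM⟩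
  exact (clubSet_subset hε (tree_lt hε (pos_of_gt hxδ) hM).1 haM).1.trans_lt hae

/-- `I` is an interval of the tree whose set `E(I)` contributes to the
orbit of `x`. -/
structure Anchors (κ : Cardinal.{u}) (δ : Ordinal.{u})
    (ε : OrdInterval.{u} → Ordinal.{u} → Ordinal.{u}) (I : OrdInterval.{u}) (x : Pt.{u}) :
    Prop where
  mem_tree : I ∈ tree δ ε
  pos : (I.lo < x.1 ∧ x.1 < I.hi) ∨ blockOf κ x ≠ none ∧ I = limitInterval δ ε x.1

theorem Anchors.mem_orbit (hε : IsClubChoice ε) (hκ : ℵ₀ ≤ κ) {x : Pt.{u}}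
    (hx : x ∈ underlying κ lam δ) {I : OrdInterval.{u}} (h : Anchors κ δ ε I x) {e : Ordinal.{u}}
    (he : e ∈ clubSet ε I) (hex : e < x.1) : e ∈ orbit κ δ ε x :=
  (OrbitForcing.mem_orbit hε hκ hx).2 ⟨hex, I, h.mem_tree, he, h.pos⟩

theorem Anchors.basicOrbit_subset (hε : IsClubChoice ε) (hκ : ℵ₀ ≤ κ) {x : Pt.{u}}
    (hx : x ∈ underlying κ lam δ) {I : OrdInterval.{u}} (h : Anchors κ δ ε I x) {e : Ordinal.{u}}
    (he : e ∈ clubSet ε I) (hIe : I.lo < e) (hex : e < x.1) :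
    basicOrbit δ ε e ⊆ orbit κ δ ε x := by
  have hxδ := (mem_underlying_iff.1 hx).1
  have hδ : 0 < δ := pos_of_gt hxδ
  intro a ha
  obtain ⟨hae, M, hM, h1, h2, h3⟩ := (mem_basicOrbit hε (hex.trans hxδ)).1 ha
  refine (OrbitForcing.mem_orbit hε hκ hx).2 ⟨hae.trans hex, M, hM, h3, ?_⟩
  have hsub := subset_of_mem_clubSet hε hδ h.mem_tree hM he h1 h2
  rcases h.pos with h4 | ⟨h4, rfl⟩
  · exact Or.inl ⟨h1.trans hex, h4.2.trans_le hsub.2⟩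
  · have hl := isSuccLimit_of_blockOf_ne_none hκ hx h4
    rcases ((le_limitInterval_hi hε hxδ hl).trans hsub.2).lt_or_eq with h5 | h5
    · exact Or.inl ⟨h1.trans hex, h5⟩
    · exact Or.inr ⟨h4, eq_limitInterval_of_hi_eq hε hxδ hl hM h5.symm⟩

/-- If the orbit of `x` contains a point of `I` other than its left endpoint, then it contains all
the points of `E(I)` below the level of `x`. -/
theorem mem_orbit_of_mem_clubSet (hε : IsClubChoice ε) (hκ : ℵ₀ ≤ κ) {x : Pt.{u}}
    (hx : x ∈ underlying κ lam δ) {I : OrdInterval.{u}} (hI : I ∈ tree δ ε)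
    (hl : IsSuccLimit I.hi) {α : Ordinal.{u}} (h1 : I.lo < α) (h2 : α < I.hi)
    (hα : α ∈ orbit κ δ ε x) {e : Ordinal.{u}} (he : e ∈ clubSet ε I) (hex : e < x.1) :
    e ∈ orbit κ δ ε x := by
  have hxδ := (mem_underlying_iff.1 hx).1
  have hδ : 0 < δ := pos_of_gt hxδ
  obtain ⟨hαx, M, hM, hαM, h⟩ := (mem_orbit hε hκ hx).1 hα
  refine (mem_orbit hε hκ hx).2 ⟨hex, ?_⟩
  have hMlt := (tree_lt hε hδ hM).1
  have hαM' := clubSet_subset hε hMlt hαM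
  have hMI : I.lo ≤ M.lo ∧ M.hi ≤ I.hi := by
    rcases tree_dichotomy hε hδ hM hI hαM' ⟨h1.le, h2⟩ with h | ⟨P, hP, h3, h4⟩
    · exact h
    · have := eq_lo_of_mem_piece hε hMlt hP hαM ⟨h3.trans h1.le, h2.trans_le h4⟩
      exact absurd (this ▸ h3) h1.not_ge
  rcases tree_dichotomy hε hδ hI hM ⟨h1.le, h2⟩ hαM' with h3 | ⟨P, hP, h3, h4⟩
  · obtain rfl : I = M := OrdInterval.ext (le_antisymm hMI.1 h3.1) (le_antisymm h3.2 hMI.2)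
    exact ⟨I, hI, he, h⟩
  · have hle : x.1 ≤ M.hi := by
      rcases h with h | ⟨h, rfl⟩
      · exact h.2.le
      · exact le_limitInterval_hi hε hxδ (isSuccLimit_of_blockOf_ne_none hκ hx h)
    have hPI := piece_hi_lt hε (tree_lt hε hδ hI).1 hl hP
    exact ⟨I, hI, he, Or.inl ⟨h1.trans hαx, hle.trans_lt (h4.trans_lt hPI)⟩⟩

theorem basicOrbit_subset_orbit (x : Pt.{u}) :
    basicOrbit δ ε x.1 ⊆ orbit κ δ ε x := by
  unfold orbit
  split_ifs
  · exact subset_rfl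
  · exact Set.subset_union_left

/-! ### Cardinalities of orbits -/

theorem mk_clubSet_inter_le (hε : IsClubChoice ε) (hκ : ℵ₀ ≤ κ) (hδκ : δ < (succ (succ κ)).ord)
    {I : OrdInterval.{u}} (hI : I.lo < I.hi) (hIδ : I.hi ≤ δ) {η : Ordinal.{u}} (hη : η < I.hi) :
    #(clubSet ε I ∩ Set.Iio η : Set Ordinal.{u}) ≤ lift.{u + 1} κ := by
  have hκ' : ℵ₀ ≤ lift.{u + 1} κ := aleph0_le_lift.2 hκ
  rcases Ordinal.zero_or_succ_or_isSuccLimit I.hi with h0 | ⟨β, hβ⟩ | hl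
  · rw [h0] at hI
    exact absurd hI not_lt_zero
  · rw [Order.succ_eq_add_one] at hβ
    have hsub : clubSet ε I ∩ Set.Iio η ⊆ {I.lo, β} := by
      rintro a ⟨⟨hl, -⟩ | ⟨β', hβ', ha⟩, -⟩
      · rw [← hβ] at hl
        exact absurd hl (Order.not_isSuccLimit_succ _)
      · obtain rfl : β = β' := by simpa using hβ.trans hβ'
        exact ha
    exact (mk_le_mk_of_subset hsub).trans ((Set.Finite.lt_aleph0 (Set.toFinite _)).le.trans hκ')
  · have he := hε I hI hl
    obtain ⟨ν, hν, hle⟩ := he.cofinal η hη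
    have hsub : clubSet ε I ∩ Set.Iio η ⊆ ε I '' Set.Iio ν := by
      rintro a ⟨ha, haη⟩
      obtain ⟨μ, hμ, rfl⟩ := (mem_clubSet_of_isSuccLimit hl).1 ha
      exact ⟨μ, he.lt_of_lt hμ (lt_of_lt_of_le haη hle), rfl⟩
    refine (mk_le_mk_of_subset hsub).trans (mk_image_le.trans ?_)
    rw [Cardinal.mk_Iio_ordinal, Cardinal.lift_le]
    exact Order.lt_succ_iff.1 ((lt_ord.1 hν).trans_le (cof_hi_le hδκ hIδ))

theorem mk_basicOrbit_le (hε : IsClubChoice ε) (hκ : ℵ₀ ≤ κ) (hδκ : δ < (succ (succ κ)).ord)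
    {ζ : Ordinal.{u}} (hζ : ζ < δ) : #(basicOrbit δ ε ζ) ≤ lift.{u + 1} κ := by
  have hκ' : ℵ₀ ≤ lift.{u + 1} κ := aleph0_le_lift.2 hκ
  have hsub : basicOrbit δ ε ζ ⊆
      ⋃ m : ULift.{u + 1} ℕ, clubSet ε (intervalAt δ ε ζ m.down) ∩ Set.Iio ζ := by
    intro a ha
    simp only [basicOrbit, Set.mem_iUnion] at ha ⊢
    obtain ⟨m, -, h⟩ := ha
    exact ⟨⟨m⟩, h⟩
  refine (mk_le_mk_of_subset hsub).trans (mk_iUnion_le_of_le hκ' ?_ _ fun m => ?_)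
  · simpa using hκ
  · obtain ⟨h1, h2⟩ := intervalAt_spec (δ := δ) hε m.down hζ
    have := level_lt hε (pos_of_gt hζ) h1
    exact mk_clubSet_inter_le hε hκ hδκ this.1 this.2 h2.2

theorem mk_extendedOrbit_inter_le (hε : IsClubChoice ε) (hκ : ℵ₀ ≤ κ)
    (hδκ : δ < (succ (succ κ)).ord) {ζ η : Ordinal.{u}} (hζ : ζ < δ) (hl : IsSuccLimit ζ)
    (hη : η < ζ) : #(extendedOrbit δ ε ζ ∩ Set.Iio η : Set Ordinal.{u}) ≤ lift.{u + 1} κ := by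
  have hκ' : ℵ₀ ≤ lift.{u + 1} κ := aleph0_le_lift.2 hκ
  obtain ⟨h1, -⟩ := limitInterval_spec hε hζ hl
  have h2 := tree_lt hε (pos_of_gt hζ) h1
  refine (mk_le_mk_of_subset (t := basicOrbit δ ε ζ ∪
    (clubSet ε (limitInterval δ ε ζ) ∩ Set.Iio η)) ?_).trans
    (mk_union_le_of_le hκ' (mk_basicOrbit_le hε hκ hδκ hζ)
      (mk_clubSet_inter_le hε hκ hδκ h2.1 h2.2 (hη.trans_le (le_limitInterval_hi hε hζ hl))))
  rintro a ⟨ha | ha, haη⟩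
  · exact Or.inl ha
  · exact Or.inr ⟨ha.1, haη⟩

theorem mk_extendedOrbit_le (hε : IsClubChoice ε) (hκ : ℵ₀ ≤ κ)
    (hδκ : δ < (succ (succ κ)).ord) {ζ : Ordinal.{u}} (hζ : ζ < δ) (hl : IsSuccLimit ζ)
    (hcof : ζ.cof = κ) : #(extendedOrbit δ ε ζ) ≤ lift.{u + 1} κ := by
  have hκ' : ℵ₀ ≤ lift.{u + 1} κ := aleph0_le_lift.2 hκ
  refine mk_union_le_of_le hκ' (mk_basicOrbit_le hε hκ hδκ hζ) ?_
  obtain ⟨h1, h2, h3, h4⟩ := limitInterval_spec hε hζ hl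
  have hlt := tree_lt hε (pos_of_gt hζ) h1
  rcases h4 with h4 | ⟨h4, -⟩
  · refine (mk_le_mk_of_subset (t := ε (limitInterval δ ε ζ) ''
      Set.Iio (limitInterval δ ε ζ).hi.cof.ord) ?_).trans (mk_image_le.trans ?_)
    · rintro a ⟨ha, -⟩
      obtain ⟨μ, hμ, rfl⟩ := (mem_clubSet_of_isSuccLimit h2).1 ha
      exact ⟨μ, hμ, rfl⟩
    · rw [h4, Cardinal.mk_Iio_ordinal, card_ord, hcof]
  · exact mk_clubSet_inter_le hε hκ hδκ hlt.1 hlt.2 h4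

variable {F : Sym2 Ordinal.{u} → Ordinal.{u}}

theorem mem_pairOrbit_of_not {x y : Pt.{u}} (h : ¬ (blockOf κ x = blockOf κ y ∧
    blockOf κ x ≠ none ∧ x.1.cof = succ κ)) :
    pairOrbit κ δ ε F x y = orbit κ δ ε x ∩ orbit κ δ ε y := by
  rw [pairOrbit, if_neg h]

theorem fst_eq_of_blockOf_eq {x y : Pt.{u}} (h : blockOf κ x = blockOf κ y)
    (hx : blockOf κ x ≠ none) : x.1 = y.1 := by
  have hy : blockOf κ y ≠ none := h ▸ hx
  rw [blockOf_of_ne_none hx, blockOf_of_ne_none hy] at h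
  exact Option.some.inj h

theorem pairOrbit_comm (x y : Pt.{u}) :
    pairOrbit κ δ ε F x y = pairOrbit κ δ ε F y x := by
  by_cases h : blockOf κ x = blockOf κ y ∧ blockOf κ x ≠ none ∧ x.1.cof = succ κ
  · have h1 := fst_eq_of_blockOf_eq h.1 h.2.1
    have h' : blockOf κ y = blockOf κ x ∧ blockOf κ y ≠ none ∧ y.1.cof = succ κ :=
      ⟨h.1.symm, h.1 ▸ h.2.1, h1 ▸ h.2.2⟩
    rw [pairOrbit, if_pos h, pairOrbit, if_pos h', h1, Sym2.eq_swap]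
  · have h' : ¬ (blockOf κ y = blockOf κ x ∧ blockOf κ y ≠ none ∧ y.1.cof = succ κ) := by
      rintro ⟨h1, h2, h3⟩
      exact h ⟨h1.symm, h1 ▸ h2, fst_eq_of_blockOf_eq h1 h2 ▸ h3⟩
    rw [mem_pairOrbit_of_not h, mem_pairOrbit_of_not h', Set.inter_comm]

theorem F_lt (hF : StronglyUnbounded κ lam F) {x y : Pt.{u}} (hx : x ∈ underlying κ lam δ)
    (hy : y ∈ underlying κ lam δ) (hxy : x ≠ y) (h : blockOf κ x = blockOf κ y)
    (h' : blockOf κ x ≠ none) : F s(x.2, y.2) < (succ κ).ord := by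
  have hlt : ∀ z ∈ underlying κ lam δ, blockOf κ z ≠ none → z.2 < lam.ord := by
    intro z hz hz'
    rw [Ne, blockOf_eq_none] at hz'
    exact ((mem_underlying_iff.1 hz).2.resolve_left hz').2.2
  exact hF.maps_to _ (hlt x hx h') _ (hlt y hy (h ▸ h')) fun h2 =>
    hxy (Prod.ext (fst_eq_of_blockOf_eq h h') h2)

theorem pairOrbit_subset (hε : IsClubChoice ε) (hκ : ℵ₀ ≤ κ) (hδκ : δ < (succ (succ κ)).ord)
    (hF : StronglyUnbounded κ lam F) {x y : Pt.{u}} (hx : x ∈ underlying κ lam δ)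
    (hy : y ∈ underlying κ lam δ) (hxy : x ≠ y) :
    pairOrbit κ δ ε F x y ⊆ orbit κ δ ε x ∩ orbit κ δ ε y := by
  by_cases h : blockOf κ x = blockOf κ y ∧ blockOf κ x ≠ none ∧ x.1.cof = succ κ
  · have h1 := fst_eq_of_blockOf_eq h.1 h.2.1
    have hlt := F_lt hF hx hy hxy h.1 h.2.1
    have hxδ := (mem_underlying_iff.1 hx).1
    have hl := isSuccLimit_of_blockOf_ne_none hκ hx h.2.1
    have hhi := limitInterval_hi_eq hε hδκ hxδ hl h.2.2
    have heq : orbit κ δ ε y = orbit κ δ ε x := by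
      rw [orbit, orbit, if_neg h.2.1, if_neg (h.1 ▸ h.2.1), h1]
    rw [heq, Set.inter_self]
    rw [pairOrbit, if_pos h]
    rintro a (ha | ⟨ν, hν, rfl⟩)
    · exact basicOrbit_subset_orbit x ha
    · obtain ⟨h3, h4, -⟩ := limitInterval_spec hε hxδ hl
      have hν' : ν < (limitInterval δ ε x.1).hi.cof.ord := by
        rw [hhi, h.2.2]
        exact hν.trans hlt
      have he := hε _ (tree_lt hε (pos_of_gt hxδ) h3).1 h4
      rw [orbit, if_neg h.2.1]
      exact Or.inr ⟨Or.inl ⟨h4, ν, hν', rfl⟩, (he.lt_hi ν hν').trans_eq hhi⟩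
  · rw [mem_pairOrbit_of_not h]

theorem mk_orbit_le_of_blockOf_eq_none (hε : IsClubChoice ε) (hκ : ℵ₀ ≤ κ)
    (hδκ : δ < (succ (succ κ)).ord) {x : Pt.{u}} (hx : x ∈ underlying κ lam δ)
    (h : blockOf κ x = none) : #(orbit κ δ ε x) ≤ lift.{u + 1} κ := by
  rw [orbit, if_pos h]
  exact mk_basicOrbit_le hε hκ hδκ (mem_underlying_iff.1 hx).1

/-- For distinct points `x`, `y`, the set `f{x, y}` has size at most `κ`: the orbit of a point has
size `κ⁺` only if its level has cofinality `κ⁺`, and then its initial segments have size at most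
`κ`. -/
theorem mk_pairOrbit_le (hε : IsClubChoice ε) (hκ : ℵ₀ ≤ κ) (hδκ : δ < (succ (succ κ)).ord)
    (hF : StronglyUnbounded κ lam F) {x y : Pt.{u}} (hx : x ∈ underlying κ lam δ)
    (hy : y ∈ underlying κ lam δ) (hxy : x ≠ y) :
    #(pairOrbit κ δ ε F x y) ≤ lift.{u + 1} κ := by
  have hκ' : ℵ₀ ≤ lift.{u + 1} κ := aleph0_le_lift.2 hκ
  by_cases h : blockOf κ x = blockOf κ y ∧ blockOf κ x ≠ none ∧ x.1.cof = succ κ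
  · rw [pairOrbit, if_pos h]
    refine mk_union_le_of_le hκ' (mk_basicOrbit_le hε hκ hδκ (mem_underlying_iff.1 hx).1) ?_
    refine (mk_le_mk_of_subset (t := ε (limitInterval δ ε x.1) ''
      Set.Iio (F s(x.2, y.2))) ?_).trans (mk_image_le.trans ?_)
    · rintro a ⟨ν, hν, rfl⟩
      exact ⟨ν, hν, rfl⟩
    · rw [Cardinal.mk_Iio_ordinal, Cardinal.lift_le]
      exact Order.lt_succ_iff.1 (lt_ord.1 (F_lt hF hx hy hxy h.1 h.2.1))
  rw [mem_pairOrbit_of_not h]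
  -- If neither point lies in the block `S`, the orbit of the higher one is cut below the other.
  have key : ∀ x ∈ underlying κ lam δ, ∀ y ∈ underlying κ lam δ, blockOf κ y ≠ none →
      x.1 < y.1 → #(orbit κ δ ε x ∩ orbit κ δ ε y : Set Ordinal.{u}) ≤ lift.{u + 1} κ := by
    intro x hx y hy hby hlt
    refine (mk_le_mk_of_subset ?_).trans (mk_extendedOrbit_inter_le hε hκ hδκ
      (mem_underlying_iff.1 hy).1 (isSuccLimit_of_blockOf_ne_none hκ hy hby) hlt)
    rintro a ⟨ha, ha'⟩
    rw [orbit, if_neg hby] at ha'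
    exact ⟨ha', lt_of_mem_orbit hε hκ hx ha⟩
  by_cases hbx : blockOf κ x = none
  · exact (mk_le_mk_of_subset Set.inter_subset_left).trans
      (mk_orbit_le_of_blockOf_eq_none hε hκ hδκ hx hbx)
  by_cases hby : blockOf κ y = none
  · exact (mk_le_mk_of_subset Set.inter_subset_right).trans
      (mk_orbit_le_of_blockOf_eq_none hε hκ hδκ hy hby)
  rcases lt_trichotomy x.1 y.1 with hlt | heq | hlt
  · exact key x hx y hy hby hlt
  · have hb : blockOf κ x = blockOf κ y := by
      rw [blockOf_of_ne_none hbx, blockOf_of_ne_none hby, heq]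
    have hcof : x.1.cof = κ :=
      (cof_of_blockOf_ne_none hx hbx).resolve_right fun h' => h ⟨hb, hbx, h'⟩
    refine (mk_le_mk_of_subset Set.inter_subset_left).trans ?_
    rw [orbit, if_neg hbx]
    exact mk_extendedOrbit_le hε hκ hδκ (mem_underlying_iff.1 hx).1
      (isSuccLimit_of_blockOf_ne_none hκ hx hbx) hcof
  · rw [Set.inter_comm]
    exact key y hy x hx hbx hlt

end OrbitLemmas

/-! ### Conditions presented by an indexed order -/

section Presented

variable {κ lam : Cardinal.{u}} {δ : Ordinal.{u}} {ε : OrdInterval.{u} → Ordinal.{u} → Ordinal.{u}}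
  {F : Sym2 Ordinal.{u} → Ordinal.{u}}

/-- A condition can be given by a preorder on a set `G` of names of points: the function `i` need
not be specified, since (P4) says that `i{x, y}` is the greatest common lower bound of `x` and
`y`. -/
theorem exists_cond_of_preorder {G : Type w} (pt : G → Pt.{u}) (le : G → G → Prop)
    (hcongr : ∀ u v, pt u = pt v → ∀ a, (le u a ↔ le v a) ∧ (le a u ↔ le a v))
    (hsub : ∀ g, pt g ∈ underlying κ lam δ)
    (hcard : #(Set.range pt) < lift.{u + 1} κ)
    (hrefl : ∀ u, le u u) (htrans : ∀ u v t, le u v → le v t → le u t)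
    (hheight : ∀ u v, le u v → pt u = pt v ∨ (pt u).1 < (pt v).1)
    (hblock : ∀ u v, le u v → blockOf κ (pt u) ≠ none → pt u = pt v)
    (hmeet : ∀ u v, pt u ≠ pt v → (∃ a, le a u ∧ le a v) →
      ∃ z, (∀ a, le a u ∧ le a v ↔ le a z) ∧
        (¬ le u v → ¬ le v u → (pt z).1 ∈ pairOrbit κ δ ε F (pt u) (pt v)))
    (hinterp : ∀ u v, pt u ≠ pt v → le u v → ∀ Λ ∈ tree δ ε, Separates Λ (pt u) (pt v) →
      ∃ z, le u z ∧ pt u ≠ pt z ∧ le z v ∧ pt z ≠ pt v ∧ (pt z).1 = Λ.hi) :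
    ∃ r : Cond κ lam δ ε F, r.A = Set.range pt ∧ (∀ u v, r.le (pt u) (pt v) ↔ le u v) ∧
      (∀ u v z, pt u ≠ pt v → (∀ a, le a u ∧ le a v ↔ le a z) →
        r.i s(pt u, pt v) = some (pt z)) ∧
      (∀ u v, pt u ≠ pt v → (¬ ∃ a, le a u ∧ le a v) → r.i s(pt u, pt v) = none) := by
  classical
  have hanti : ∀ u v, le u v → le v u → pt u = pt v := by
    intro u v h1 h2
    rcases hheight u v h1 with h | h
    · exact h
    rcases hheight v u h2 with h' | h'
    · exact h'.symm
    · exact absurd h' h.not_gt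
  let le' : Pt.{u} → Pt.{u} → Prop := fun x y => ∃ u v, pt u = x ∧ pt v = y ∧ le u v
  have hle' : ∀ u v, le' (pt u) (pt v) ↔ le u v := by
    intro u v
    constructor
    · rintro ⟨u', v', hu, hv, h⟩
      exact ((hcongr u' u hu v).1).1 (((hcongr v' v hv u').2).1 h)
    · exact fun h => ⟨u, v, rfl, rfl, h⟩
  let IsMeet : Sym2 Pt.{u} → Pt.{u} → Prop := fun p x =>
    ∃ u v z, p = s(pt u, pt v) ∧ pt u ≠ pt v ∧ pt z = x ∧ ∀ a, le a u ∧ le a v ↔ le a z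
  have hMeet : ∀ u v x, IsMeet s(pt u, pt v) x →
      pt u ≠ pt v ∧ ∃ z, pt z = x ∧ ∀ a, le a u ∧ le a v ↔ le a z := by
    rintro u v x ⟨u', v', z, h1, h2, h3, h4⟩
    rcases Sym2.eq_iff.1 h1 with ⟨h5, h6⟩ | ⟨h5, h6⟩
    · refine ⟨h5 ▸ h6 ▸ h2, z, h3, fun a => ?_⟩
      rw [(hcongr u u' h5 a).2, (hcongr v v' h6 a).2, h4]
    · refine ⟨h5 ▸ h6 ▸ h2.symm, z, h3, fun a => ?_⟩
      rw [(hcongr u v' h5 a).2, (hcongr v u' h6 a).2, and_comm, h4]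
  let i : Sym2 Pt.{u} → Option Pt.{u} := fun p =>
    if h : ∃ x, IsMeet p x then some h.choose else none
  have hi_some : ∀ p x, i p = some x → IsMeet p x := by
    intro p x h
    by_cases hp : ∃ x, IsMeet p x
    · simp only [i, dif_pos hp] at h
      exact Option.some.inj h ▸ hp.choose_spec
    · have hn : i p = none := dif_neg hp
      rw [hn] at h
      exact absurd h (by simp)
  have hi_meet : ∀ u v z, pt u ≠ pt v → (∀ a, le a u ∧ le a v ↔ le a z) →
      i s(pt u, pt v) = some (pt z) := by
    intro u v z huv hz
    have hp : ∃ x, IsMeet s(pt u, pt v) x := ⟨pt z, u, v, z, rfl, huv, rfl, hz⟩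
    have h1 : i s(pt u, pt v) = some hp.choose := dif_pos hp
    obtain ⟨-, z', h2, h3⟩ := hMeet u v _ hp.choose_spec
    rw [h1, ← h2, Option.some.injEq]
    exact hanti z' z ((hz z').1 ((h3 z').2 (hrefl z'))) ((h3 z).1 ((hz z).2 (hrefl z)))
  have hi_none : ∀ u v, pt u ≠ pt v → (¬ ∃ a, le a u ∧ le a v) → i s(pt u, pt v) = none := by
    intro u v _ hno
    refine dif_neg ?_
    rintro ⟨x, hx⟩
    obtain ⟨-, z, -, h⟩ := hMeet u v x hx
    exact hno ⟨z, (h z).2 (hrefl z)⟩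
  let r : Cond κ lam δ ε F :=
    { A := Set.range pt
      le := le'
      i := i
      le_mem := by
        rintro x y ⟨u, v, rfl, rfl, -⟩
        exact ⟨⟨u, rfl⟩, ⟨v, rfl⟩⟩
      i_dom := by
        intro x y h
        obtain ⟨z, hz⟩ := Option.ne_none_iff_exists'.1 h
        obtain ⟨u, v, z', h1, h2, -, -⟩ := hi_some _ _ hz
        rcases Sym2.eq_iff.1 h1 with ⟨rfl, rfl⟩ | ⟨rfl, rfl⟩
        · exact ⟨⟨u, rfl⟩, ⟨v, rfl⟩, h2⟩
        · exact ⟨⟨v, rfl⟩, ⟨u, rfl⟩, h2.symm⟩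
      i_val := by
        intro x y z h
        obtain ⟨u, v, z', -, -, h3, -⟩ := hi_some _ _ h
        exact ⟨z', h3⟩
      subset_underlying := by
        rintro _ ⟨g, rfl⟩
        exact hsub g
      card_lt := hcard
      le_refl := by
        rintro _ ⟨g, rfl⟩
        exact ⟨g, g, rfl, rfl, hrefl g⟩
      le_trans := by
        rintro _ _ _ ⟨u, v, rfl, rfl, h⟩ ⟨v', t, hv, rfl, h'⟩
        exact ⟨u, t, rfl, rfl, htrans _ _ _ h (((hcongr v' v hv t).1).1 h')⟩
      le_antisymm := by
        rintro _ _ ⟨u, v, rfl, rfl, h⟩ h'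
        exact hanti u v h ((hle' v u).1 h')
      le_height := by
        rintro _ _ ⟨u, v, rfl, rfl, h⟩
        exact hheight u v h
      le_block := by
        rintro _ _ ⟨u, v, rfl, rfl, h⟩ hb
        exact hblock u v h hb
      inf_spec := by
        rintro _ ⟨u, rfl⟩ _ ⟨v, rfl⟩ huv _ ⟨a, rfl⟩
        rw [hle', hle']
        constructor
        · intro h
          obtain ⟨z, hz, -⟩ := hmeet u v huv ⟨a, h⟩
          exact ⟨pt z, hi_meet u v z huv hz, (hle' a z).2 ((hz a).1 h)⟩
        · rintro ⟨x, hx, h⟩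
          obtain ⟨-, z, rfl, hz⟩ := hMeet u v x (hi_some _ _ hx)
          exact (hz a).2 ((hle' a z).1 h)
      inf_mem := by
        rintro _ ⟨u, rfl⟩ _ ⟨v, rfl⟩ huv h1 h2 ⟨_, ⟨a, rfl⟩, h3, h4⟩
        rw [hle'] at h1 h2 h3 h4
        obtain ⟨z, hz, hz'⟩ := hmeet u v huv ⟨a, h3, h4⟩
        exact ⟨pt z, hi_meet u v z huv hz, hz' h1 h2⟩
      interpolate := by
        rintro _ ⟨u, rfl⟩ _ ⟨v, rfl⟩ huv h Λ hΛ hsep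
        obtain ⟨z, h1, h2, h3, h4, h5⟩ := hinterp u v huv ((hle' u v).1 h) Λ hΛ hsep
        exact ⟨pt z, ⟨z, rfl⟩, ⟨(hle' u z).2 h1, h2⟩, ⟨(hle' z v).2 h3, h4⟩, h5⟩ }
  exact ⟨r, rfl, hle', hi_meet, hi_none⟩

end Presented

/-! ### Amalgamation of two isomorphic conditions -/

section Amalgamation

variable {κ lam : Cardinal.{u}} {δ : Ordinal.{u}} {ε : OrdInterval.{u} → Ordinal.{u} → Ordinal.{u}}
  {F : Sym2 Ordinal.{u} → Ordinal.{u}}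

/-- Two conditions `p false` and `p true` enumerated by the same index set `J`, with the same order
`R`, the same meets `M` and the same block type (`S` or not) at every index; they agree on the
indices in `K` and have no other common points. -/
structure IsomorphicPair (p : Bool → Cond κ lam δ ε F) {J : Type (u + 1)} (x : Bool → J → Pt.{u})
    (R : J → J → Prop) (M : J → J → Option J) (bS : J → Prop) (K : Set J) : Prop where
  inj : ∀ b, Function.Injective (x b)
  range_eq : ∀ b, Set.range (x b) = (p b).A
  le_iff : ∀ b j k, (p b).le (x b j) (x b k) ↔ R j k
  i_eq : ∀ b j k, (p b).i s(x b j, x b k) = (M j k).map (x b)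
  block_iff : ∀ b j, blockOf κ (x b j) = none ↔ bS j
  agree : ∀ j ∈ K, ∀ b, x b j = x true j
  disj : ∀ j ∉ K, ∀ k ∉ K, x true j ≠ x false k
  /-- Meets with points of the common part belong to the common part, unless the latter lie
  outside the block `S`. -/
  meet_mem : ∀ j k l, k ∈ K → ¬ R j k → (bS k ∨ j ∈ K) → M j k = some l → l ∈ K
  level_ne : ∀ j ∉ K, ∀ k ∉ K, bS j → bS k → (x true j).1 ≠ (x false k).1

/-- The points of the common part together with the new points `w j`, for `j ∉ K`: a third copy of
the index set `J`. -/
noncomputable def middle {J : Type (u + 1)} (x : Bool → J → Pt.{u}) (K : Set J) (w : J → Pt.{u})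
    (j : J) : Pt.{u} :=
  open Classical in if j ∈ K then x true j else w j

/-- New points `w j`, for `j ∉ K`, to be placed below the two copies `x true j` and `x false j` of
`j`. The level of `w j` is close to that of the copies: the orbits of the copies extend its
orbit and contain its level, and no interval of the tree separates it from them. -/
structure Bridge (p : Bool → Cond κ lam δ ε F) {J : Type (u + 1)} (x : Bool → J → Pt.{u})
    (R : J → J → Prop) (bS : J → Prop) (K : Set J) (w : J → Pt.{u}) :
    Prop where
  block_w : ∀ j, (w j).2 < κ.ord
  w_inj : Function.Injective w
  w_notMem : ∀ j b, w j ∉ (p b).A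
  mem_orbit : ∀ j ∉ K, ∀ b, (w j).1 ∈ orbit κ δ ε (x b j)
  orbit_subset : ∀ j ∉ K, ∀ b, basicOrbit δ ε (w j).1 ⊆ orbit κ δ ε (x b j)
  lt_of_rel : ∀ l ∉ K, ∀ j ∉ K, R l j → l ≠ j → (w l).1 < (w j).1
  lt_of_mem : ∀ k ∈ K, ∀ j ∉ K, R k j → (x true k).1 < (w j).1
  not_separated : ∀ j ∉ K, ∀ Λ ∈ tree δ ε, Λ.lo < (w j).1 → (w j).1 < Λ.hi → ∀ b,
    (x b j).1 ≤ Λ.hi ∧ (bS j → Λ.lo < (x b j).1 ∧ (x b j).1 < Λ.hi)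
  between_or_mem : ∀ l ∉ K, ∀ j ∉ K, R l j → l ≠ j →
    (∃ c ∈ K, R l c ∧ R c j) ∨ (w l).1 ∈ basicOrbit δ ε (w j).1
  orbit_transfer : ∀ l ∉ K, ∀ j, R l j → l ≠ j → ∀ b, (x b l).1 ∈ orbit κ δ ε (x b j) →
    (w l).1 ∈ orbit κ δ ε (x b j)
  /-- The values of `F` at the two copies of the points outside `S` are large. -/
  pairOrbit_mem : ∀ j ∉ K, ∀ k ∉ K, blockOf κ (x true j) = blockOf κ (x false k) →
    blockOf κ (x true j) ≠ none → (x true j).1.cof = succ κ → ∀ l,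
    (middle x K w l).1 ∈ orbit κ δ ε (x true j) →
    (middle x K w l).1 ∈ pairOrbit κ δ ε F (x true j) (x false k)

namespace IsomorphicPair

variable {p : Bool → Cond κ lam δ ε F} {J : Type (u + 1)} {x : Bool → J → Pt.{u}}
  {R : J → J → Prop} {M : J → J → Option J} {bS : J → Prop} {K : Set J}

theorem mem_A (h : IsomorphicPair p x R M bS K) (b : Bool) (j : J) : x b j ∈ (p b).A :=
  h.range_eq b ▸ ⟨j, rfl⟩

theorem mem_underlying (h : IsomorphicPair p x R M bS K) (b : Bool) (j : J) :
    x b j ∈ underlying κ lam δ :=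
  (p b).subset_underlying (h.mem_A b j)

theorem refl (h : IsomorphicPair p x R M bS K) (j : J) : R j j :=
  (h.le_iff true j j).1 ((p true).le_refl _ (h.mem_A true j))

theorem trans (h : IsomorphicPair p x R M bS K) {i j k : J} (h1 : R i j) (h2 : R j k) : R i k :=
  (h.le_iff true i k).1
    ((p true).le_trans _ _ _ ((h.le_iff true i j).2 h1) ((h.le_iff true j k).2 h2))

theorem antisymm (h : IsomorphicPair p x R M bS K) {i j : J} (h1 : R i j) (h2 : R j i) : i = j :=
  h.inj true ((p true).le_antisymm _ _ ((h.le_iff true i j).2 h1) ((h.le_iff true j i).2 h2))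

theorem lt_of_rel (h : IsomorphicPair p x R M bS K) {i j : J} (h1 : R i j) (hne : i ≠ j)
    (b : Bool) : (x b i).1 < (x b j).1 :=
  ((p b).le_height _ _ ((h.le_iff b i j).2 h1)).resolve_left fun he => hne (h.inj b he)

theorem le_of_rel (h : IsomorphicPair p x R M bS K) {i j : J} (h1 : R i j) (b : Bool) :
    (x b i).1 ≤ (x b j).1 := by
  by_cases hne : i = j
  · rw [hne]
  · exact (h.lt_of_rel h1 hne b).le

theorem bS_of_rel (h : IsomorphicPair p x R M bS K) {i j : J} (h1 : R i j) (hne : i ≠ j) :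
    bS i := by
  by_contra hb
  exact hne (h.inj true ((p true).le_block _ _ ((h.le_iff true i j).2 h1)
    fun hb' => hb ((h.block_iff true i).1 hb')))

theorem meet_iff (h : IsomorphicPair p x R M bS K) {j k : J} (hjk : j ≠ k) (a : J) :
    (R a j ∧ R a k) ↔ ∃ l, M j k = some l ∧ R a l := by
  rw [← h.le_iff true a j, ← h.le_iff true a k,
    (p true).inf_spec _ (h.mem_A true j) _ (h.mem_A true k) (fun he => hjk (h.inj true he)) _
      (h.mem_A true a), h.i_eq]
  constructor
  · rintro ⟨z, hz, haz⟩
    obtain ⟨l, hl, rfl⟩ := Option.map_eq_some_iff.1 hz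
    exact ⟨l, hl, (h.le_iff true a l).1 haz⟩
  · rintro ⟨l, hl, hal⟩
    exact ⟨x true l, by rw [hl]; rfl, (h.le_iff true a l).2 hal⟩

theorem meet_glb (h : IsomorphicPair p x R M bS K) {j k l : J} (hjk : j ≠ k)
    (hl : M j k = some l) (a : J) : (R a j ∧ R a k) ↔ R a l := by
  rw [h.meet_iff hjk, hl]
  simp

theorem exists_glb (h : IsomorphicPair p x R M bS K) {a j k : J} (h1 : R a j) (h2 : R a k) :
    ∃ l, ∀ i, (R i j ∧ R i k) ↔ R i l := by
  by_cases hjk : j = k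
  · exact ⟨j, fun i => by simp [hjk]⟩
  · obtain ⟨l, hl, -⟩ := (h.meet_iff hjk a).1 ⟨h1, h2⟩
    exact ⟨l, h.meet_glb hjk hl⟩

theorem glb_mem_pairOrbit (h : IsomorphicPair p x R M bS K) {j k l : J} (h1 : ¬ R j k)
    (h2 : ¬ R k j) (hl : ∀ i, (R i j ∧ R i k) ↔ R i l) (b : Bool) :
    M j k = some l ∧ (x b l).1 ∈ pairOrbit κ δ ε F (x b j) (x b k) := by
  have hjk : j ≠ k := fun he => h1 (he ▸ h.refl j)
  obtain ⟨l', hl', hll'⟩ := (h.meet_iff hjk l).1 ((hl l).2 (h.refl l))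
  obtain rfl : l = l' := h.antisymm hll' ((hl l').1 ((h.meet_glb hjk hl' l').2 (h.refl l')))
  refine ⟨hl', ?_⟩
  obtain ⟨hlj, hlk⟩ := (hl l).2 (h.refl l)
  obtain ⟨z, hz, hz'⟩ := (p b).inf_mem _ (h.mem_A b j) _ (h.mem_A b k)
    (fun he => hjk (h.inj b he)) (fun he => h1 ((h.le_iff b _ _).1 he))
    (fun he => h2 ((h.le_iff b _ _).1 he))
    ⟨x b l, h.mem_A b l, (h.le_iff b _ _).2 hlj, (h.le_iff b _ _).2 hlk⟩
  rw [h.i_eq, hl'] at hz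
  rwa [← Option.some.inj hz] at hz'

theorem exists_between (h : IsomorphicPair p x R M bS K) {j k : J} (h1 : R j k) (hjk : j ≠ k)
    (b : Bool) {Λ : OrdInterval.{u}} (hΛ : Λ ∈ tree δ ε) (hs : Separates Λ (x b j) (x b k)) :
    ∃ t, R j t ∧ j ≠ t ∧ R t k ∧ t ≠ k ∧ (x b t).1 = Λ.hi := by
  obtain ⟨z, hz, ⟨h2, h3⟩, ⟨h4, h5⟩, h6⟩ := (p b).interpolate _ (h.mem_A b j) _ (h.mem_A b k)
    (fun he => hjk (h.inj b he)) ((h.le_iff b _ _).2 h1) Λ hΛ hs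
  rw [← h.range_eq b] at hz
  obtain ⟨t, rfl⟩ := hz
  exact ⟨t, (h.le_iff b _ _).1 h2, fun he => h3 (he ▸ rfl), (h.le_iff b _ _).1 h4,
    fun he => h5 (he ▸ rfl), h6⟩

/-- An interval that separates the two copies of a pair on both sides yields an interpolating point
in the common part, because the levels off the common part are different on the two sides. -/
theorem exists_between_mem (h : IsomorphicPair p x R M bS K) {j k : J} (h1 : R j k) (hjk : j ≠ k)
    {Λ : OrdInterval.{u}} (hΛ : Λ ∈ tree δ ε) (hs : ∀ b, Separates Λ (x b j) (x b k)) :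
    ∃ c ∈ K, R j c ∧ j ≠ c ∧ R c k ∧ c ≠ k ∧ (x true c).1 = Λ.hi := by
  obtain ⟨t, a1, a2, a3, a4, a5⟩ := h.exists_between h1 hjk true hΛ (hs true)
  obtain ⟨t', b1, b2, b3, b4, b5⟩ := h.exists_between h1 hjk false hΛ (hs false)
  by_cases ht : t ∈ K
  · exact ⟨t, ht, a1, a2, a3, a4, a5⟩
  by_cases ht' : t' ∈ K
  · exact ⟨t', ht', b1, b2, b3, b4, by rw [← h.agree t' ht' false, b5]⟩
  exact absurd (a5.trans b5.symm)
    (h.level_ne t ht t' ht' (h.bS_of_rel a3 a4) (h.bS_of_rel b3 b4))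

theorem exists_common_below (h : IsomorphicPair p x R M bS K) {i c d : J} (hc : c ∈ K)
    (hd : d ∈ K) (h1 : R i c) (h2 : R i d) : ∃ e ∈ K, R i e ∧ R e c ∧ R e d := by
  by_cases hcd : R c d
  · exact ⟨c, hc, h1, h.refl c, hcd⟩
  have hne : c ≠ d := fun he => hcd (he ▸ h.refl c)
  obtain ⟨l, hl, hil⟩ := (h.meet_iff hne i).1 ⟨h1, h2⟩
  obtain ⟨h3, h4⟩ := (h.meet_glb hne hl l).2 (h.refl l)
  exact ⟨l, h.meet_mem c d l hd hcd (Or.inr hc) hl, hil, h3, h4⟩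

/-- The order of the amalgam. The pair `(j, some b)` stands for the copy of `j` in `p b`, and
`(j, none)` for its copy in the middle. -/
def amalgamLE (R : J → J → Prop) (K : Set J) (u v : J × Option Bool) : Prop :=
  R u.1 v.1 ∧ (u.2 = v.2 ∨ u.2 = none ∨ ∃ c ∈ K, R u.1 c ∧ R c v.1)

/-- The points named by the pairs in `amalgamLE`; a point of the common part has three names. -/
noncomputable def amalgamPt (x : Bool → J → Pt.{u}) (K : Set J) (w : J → Pt.{u})
    (u : J × Option Bool) : Pt.{u} :=
  u.2.elim (middle x K w u.1) fun b => x b u.1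

variable {w : J → Pt.{u}}

theorem amalgamPt_of_mem (h : IsomorphicPair p x R M bS K) {j : J} (hj : j ∈ K) (s : Option Bool)
    (b : Bool) : amalgamPt x K w (j, s) = x b j := by
  cases s with
  | none => simp [amalgamPt, middle, hj, h.agree j hj b]
  | some b' => simp [amalgamPt, h.agree j hj b, h.agree j hj b']

theorem amalgamPt_none {j : J} (hj : j ∉ K) : amalgamPt x K w (j, none) = w j := by
  simp [amalgamPt, middle, hj]

theorem amalgamPt_some (b : Bool) (j : J) : amalgamPt x K w (j, some b) = x b j := rfl

theorem amalgamLE_of_mem_left (h : IsomorphicPair p x R M bS K) {j : J} (hj : j ∈ K)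
    (s : Option Bool) (v : J × Option Bool) : amalgamLE R K (j, s) v ↔ R j v.1 :=
  ⟨fun h1 => h1.1, fun h1 => ⟨h1, Or.inr (Or.inr ⟨j, hj, h.refl j, h1⟩)⟩⟩

theorem amalgamLE_of_mem_right (h : IsomorphicPair p x R M bS K) {j : J} (hj : j ∈ K)
    (s : Option Bool) (v : J × Option Bool) : amalgamLE R K v (j, s) ↔ R v.1 j :=
  ⟨fun h1 => h1.1, fun h1 => ⟨h1, Or.inr (Or.inr ⟨j, hj, h1, h.refl j⟩)⟩⟩

theorem amalgamLE_same {j k : J} (h1 : R j k) (s : Option Bool) : amalgamLE R K (j, s) (k, s) :=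
  ⟨h1, Or.inl rfl⟩

theorem amalgamLE_none {j k : J} (h1 : R j k) (s : Option Bool) :
    amalgamLE R K (j, none) (k, s) :=
  ⟨h1, Or.inr (Or.inl rfl)⟩

theorem amalgamLE_trans (h : IsomorphicPair p x R M bS K) {u v t : J × Option Bool}
    (h1 : amalgamLE R K u v) (h2 : amalgamLE R K v t) : amalgamLE R K u t := by
  refine ⟨h.trans h1.1 h2.1, ?_⟩
  rcases h1.2 with h3 | h3 | ⟨c, hc, h3, h4⟩
  · rcases h2.2 with h5 | h5 | ⟨c, hc, h5, h6⟩
    · exact Or.inl (h3.trans h5)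
    · exact Or.inr (Or.inl (h3.trans h5))
    · exact Or.inr (Or.inr ⟨c, hc, h.trans h1.1 h5, h6⟩)
  · exact Or.inr (Or.inl h3)
  · exact Or.inr (Or.inr ⟨c, hc, h3, h.trans h4 h2.1⟩)

theorem amalgamPt_eq_iff (h : IsomorphicPair p x R M bS K) (hw : Bridge p x R bS K w)
    {u v : J × Option Bool} :
    amalgamPt x K w u = amalgamPt x K w v ↔ u = v ∨ u.1 = v.1 ∧ u.1 ∈ K := by
  obtain ⟨j, s⟩ := u
  obtain ⟨k, t⟩ := v
  constructor
  · intro heq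
    by_cases hj : j ∈ K
    · right
      refine ⟨?_, hj⟩
      cases t with
      | some b =>
        rw [h.amalgamPt_of_mem hj s b, amalgamPt_some] at heq
        exact h.inj b heq
      | none =>
        by_cases hk : k ∈ K
        · rw [h.amalgamPt_of_mem hj s true, h.amalgamPt_of_mem hk none true] at heq
          exact h.inj true heq
        · rw [h.amalgamPt_of_mem hj s true, amalgamPt_none hk] at heq
          exact absurd (heq ▸ h.mem_A true j) (hw.w_notMem k true)
    · by_cases hk : k ∈ K
      · right
        cases s with
        | some b =>
          rw [h.amalgamPt_of_mem hk t b, amalgamPt_some] at heq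
          exact absurd (h.inj b heq ▸ hk) hj
        | none =>
          rw [h.amalgamPt_of_mem hk t true, amalgamPt_none hj] at heq
          exact absurd (heq ▸ h.mem_A true k) (hw.w_notMem j true)
      · left
        cases s with
        | none =>
          cases t with
          | none =>
            rw [amalgamPt_none hj, amalgamPt_none hk] at heq
            rw [hw.w_inj heq]
          | some b =>
            rw [amalgamPt_none hj, amalgamPt_some] at heq
            exact absurd (heq ▸ h.mem_A b k) (hw.w_notMem j b)
        | some b =>
          cases t with
          | none =>
            rw [amalgamPt_none hk, amalgamPt_some] at heq
            exact absurd (heq ▸ h.mem_A b j) (hw.w_notMem k b)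
          | some b' =>
            rw [amalgamPt_some, amalgamPt_some] at heq
            cases b <;> cases b'
            · rw [h.inj _ heq]
            · exact absurd heq.symm (h.disj k hk j hj)
            · exact absurd heq (h.disj j hj k hk)
            · rw [h.inj _ heq]
  · rintro (heq | ⟨h1, h2⟩)
    · rw [heq]
    · simp only at h1 h2
      subst h1
      rw [h.amalgamPt_of_mem h2 s true, h.amalgamPt_of_mem h2 t true]

theorem fst_ne_of_amalgamPt_ne (h : IsomorphicPair p x R M bS K)
    (hw : Bridge p x R bS K w) {j k : J} (hjk : j ≠ k) (s t : Option Bool) :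
    amalgamPt x K w (j, s) ≠ amalgamPt x K w (k, t) := by
  rw [Ne, h.amalgamPt_eq_iff hw]
  rintro (h1 | h1)
  · exact hjk (congrArg Prod.fst h1)
  · exact hjk h1.1

end IsomorphicPair

end Amalgamation

section Amalgamation

variable {κ lam : Cardinal.{u}} {δ : Ordinal.{u}} {ε : OrdInterval.{u} → Ordinal.{u} → Ordinal.{u}}
  {F : Sym2 Ordinal.{u} → Ordinal.{u}}

namespace IsomorphicPair

variable {p : Bool → Cond κ lam δ ε F} {J : Type (u + 1)} {x : Bool → J → Pt.{u}}
  {R : J → J → Prop} {M : J → J → Option J} {bS : J → Prop} {K : Set J} {w : J → Pt.{u}}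

theorem middle_of_mem (h : IsomorphicPair p x R M bS K) {j : J} (hj : j ∈ K) (b : Bool) :
    middle x K w j = x b j :=
  h.amalgamPt_of_mem hj none b

theorem middle_of_notMem {j : J} (hj : j ∉ K) : middle x K w j = w j := by
  simp [middle, hj]

theorem w_lt (hε : IsClubChoice ε) (hκ : ℵ₀ ≤ κ) (h : IsomorphicPair p x R M bS K)
    (hw : Bridge p x R bS K w) {j : J} (hj : j ∉ K) (b : Bool) : (w j).1 < (x b j).1 :=
  lt_of_mem_orbit hε hκ (h.mem_underlying b j) (hw.mem_orbit j hj b)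

theorem blockOf_w (hw : Bridge p x R bS K w) (j : J) : blockOf κ (w j) = none :=
  blockOf_eq_none.2 (hw.block_w j)

theorem amalgamPt_mem_underlying (hε : IsClubChoice ε) (hκ : ℵ₀ ≤ κ)
    (h : IsomorphicPair p x R M bS K) (hw : Bridge p x R bS K w) (u : J × Option Bool) :
    amalgamPt x K w u ∈ underlying κ lam δ := by
  obtain ⟨j, s | b⟩ := u
  · by_cases hj : j ∈ K
    · rw [h.amalgamPt_of_mem hj none true]
      exact h.mem_underlying true j
    · rw [amalgamPt_none hj]
      exact mem_underlying_iff.2 ⟨(h.w_lt hε hκ hw hj true).trans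
        (mem_underlying_iff.1 (h.mem_underlying true j)).1, Or.inl (hw.block_w j)⟩
  · exact h.mem_underlying b j

theorem amalgamPt_le_of_rel (hε : IsClubChoice ε) (hκ : ℵ₀ ≤ κ)
    (h : IsomorphicPair p x R M bS K) (hw : Bridge p x R bS K w) {j c : J} (hc : c ∈ K)
    (hjc : R j c) (s : Option Bool) :
    (amalgamPt x K w (j, s)).1 ≤ (x true c).1 ∧
      (j ≠ c → (amalgamPt x K w (j, s)).1 < (x true c).1) := by
  have key : ∀ b, amalgamPt x K w (j, s) = x b j →
      (amalgamPt x K w (j, s)).1 ≤ (x true c).1 ∧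
      (j ≠ c → (amalgamPt x K w (j, s)).1 < (x true c).1) := by
    intro b hb
    rw [hb, ← h.agree c hc b]
    exact ⟨h.le_of_rel hjc b, fun hne => h.lt_of_rel hjc hne b⟩
  rcases s with _ | b
  · by_cases hj : j ∈ K
    · exact key true (h.amalgamPt_of_mem hj none true)
    · rw [amalgamPt_none hj]
      have := (h.w_lt hε hκ hw hj true).trans_le (h.le_of_rel hjc true)
      exact ⟨this.le, fun _ => this⟩
  · exact key b rfl

theorem le_amalgamPt_of_rel (h : IsomorphicPair p x R M bS K) (hw : Bridge p x R bS K w)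
    {k c : J} (hc : c ∈ K) (hck : R c k) (s : Option Bool) :
    (x true c).1 ≤ (amalgamPt x K w (k, s)).1 ∧
      (c ≠ k → (x true c).1 < (amalgamPt x K w (k, s)).1) := by
  have key : ∀ b, amalgamPt x K w (k, s) = x b k →
      (x true c).1 ≤ (amalgamPt x K w (k, s)).1 ∧
      (c ≠ k → (x true c).1 < (amalgamPt x K w (k, s)).1) := by
    intro b hb
    rw [hb, ← h.agree c hc b]
    exact ⟨h.le_of_rel hck b, fun hne => h.lt_of_rel hck hne b⟩
  rcases s with _ | b
  · by_cases hk : k ∈ K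
    · exact key true (h.amalgamPt_of_mem hk none true)
    · rw [amalgamPt_none hk]
      have := hw.lt_of_mem c hc k hk hck
      exact ⟨this.le, fun _ => this⟩
  · exact key b rfl

theorem amalgam_height (hε : IsClubChoice ε) (hκ : ℵ₀ ≤ κ)
    (h : IsomorphicPair p x R M bS K) (hw : Bridge p x R bS K w) {u v : J × Option Bool}
    (huv : amalgamLE R K u v) :
    amalgamPt x K w u = amalgamPt x K w v ∨ (amalgamPt x K w u).1 < (amalgamPt x K w v).1 := by
  obtain ⟨j, s⟩ := u
  obtain ⟨k, t⟩ := v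
  obtain ⟨hjk, h1⟩ := huv
  simp only at hjk h1
  have hK : (∃ c ∈ K, R j c ∧ R c k) → amalgamPt x K w (j, s) = amalgamPt x K w (k, t) ∨
      (amalgamPt x K w (j, s)).1 < (amalgamPt x K w (k, t)).1 := by
    rintro ⟨c, hc, hjc, hck⟩
    have h2 := h.amalgamPt_le_of_rel hε hκ hw hc hjc s
    have h3 := h.le_amalgamPt_of_rel hw hc hck t
    by_cases hne : j = c
    · subst hne
      by_cases hne' : j = k
      · exact Or.inl ((h.amalgamPt_eq_iff hw).2 (Or.inr ⟨hne', hc⟩))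
      · exact Or.inr (h2.1.trans_lt (h3.2 hne'))
    · exact Or.inr ((h2.2 hne).trans_le h3.1)
  by_cases hj : j ∈ K
  · exact hK ⟨j, hj, h.refl j, hjk⟩
  by_cases hk : k ∈ K
  · exact hK ⟨k, hk, hjk, h.refl k⟩
  rcases h1 with rfl | rfl | h1
  · by_cases hne : j = k
    · exact Or.inl (by rw [hne])
    · right
      rcases s with _ | b
      · rw [amalgamPt_none hj, amalgamPt_none hk]
        exact hw.lt_of_rel j hj k hk hjk hne
      · exact h.lt_of_rel hjk hne b
  · rcases t with _ | b
    · by_cases hne : j = k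
      · exact Or.inl (by rw [hne])
      · right
        rw [amalgamPt_none hj, amalgamPt_none hk]
        exact hw.lt_of_rel j hj k hk hjk hne
    · right
      rw [amalgamPt_none hj]
      exact (h.w_lt hε hκ hw hj b).trans_le (h.le_of_rel hjk b)
  · exact hK h1

theorem amalgam_block (h : IsomorphicPair p x R M bS K) (hw : Bridge p x R bS K w)
    {u v : J × Option Bool} (huv : amalgamLE R K u v)
    (hb : blockOf κ (amalgamPt x K w u) ≠ none) :
    amalgamPt x K w u = amalgamPt x K w v := by
  obtain ⟨j, s⟩ := u
  obtain ⟨k, t⟩ := v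
  obtain ⟨hjk, h1⟩ := huv
  simp only at hjk h1
  rw [h.amalgamPt_eq_iff hw]
  simp only
  by_cases hj : j ∈ K
  · right
    rw [h.amalgamPt_of_mem hj s true] at hb
    refine ⟨?_, hj⟩
    by_contra hne
    exact hb ((h.block_iff true j).2 (h.bS_of_rel hjk hne))
  · left
    rcases s with _ | b
    · rw [amalgamPt_none hj] at hb
      exact absurd (blockOf_w hw j) hb
    · rw [amalgamPt_some, Ne, h.block_iff] at hb
      have hjk' : j = k := by
        by_contra hne
        exact hb (h.bS_of_rel hjk hne)
      subst hjk'
      rcases h1 with rfl | h1 | ⟨c, hc, h2, h3⟩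
      · rfl
      · simp at h1
      · exact absurd (h.antisymm h2 h3 ▸ hc) hj

/-! ### Meets in the amalgam -/

theorem amalgam_glb_same (h : IsomorphicPair p x R M bS K) {j k l : J}
    (hl : ∀ i, (R i j ∧ R i k) ↔ R i l) (s : Option Bool) (a : J × Option Bool) :
    amalgamLE R K a (j, s) ∧ amalgamLE R K a (k, s) ↔ amalgamLE R K a (l, s) := by
  obtain ⟨i, r⟩ := a
  obtain ⟨hlj, hlk⟩ := (hl l).2 (h.refl l)
  constructor
  · rintro ⟨⟨h1, h2⟩, ⟨h3, h4⟩⟩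
    simp only at h1 h2 h3 h4
    refine ⟨(hl i).1 ⟨h1, h3⟩, ?_⟩
    rcases h2 with h2 | h2 | ⟨c, hc, h5, h6⟩
    · exact Or.inl h2
    · exact Or.inr (Or.inl h2)
    rcases h4 with h4 | h4 | ⟨d, hd, h7, h8⟩
    · exact Or.inl h4
    · exact Or.inr (Or.inl h4)
    obtain ⟨e, he, hie, hec, hed⟩ := h.exists_common_below hc hd h5 h7
    exact Or.inr (Or.inr ⟨e, he, hie, (hl e).1 ⟨h.trans hec h6, h.trans hed h8⟩⟩)
  · intro hal
    exact ⟨h.amalgamLE_trans hal (amalgamLE_same hlj s), h.amalgamLE_trans hal (amalgamLE_same hlk s)⟩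

/-- For incomparable points on different sides of the amalgam, the greatest common lower bound lies
in the middle. -/
theorem amalgam_glb_cross (h : IsomorphicPair p x R M bS K) {j k l : J} (hj : j ∉ K) (hk : k ∉ K)
    {s t : Option Bool} (hst : s ≠ t) (huv : ¬ amalgamLE R K (j, s) (k, t))
    (hvu : ¬ amalgamLE R K (k, t) (j, s)) (hl : ∀ i, (R i j ∧ R i k) ↔ R i l)
    (a : J × Option Bool) :
    amalgamLE R K a (j, s) ∧ amalgamLE R K a (k, t) ↔ amalgamLE R K a (l, none) := by
  obtain ⟨i, r⟩ := a
  obtain ⟨hlj, hlk⟩ := (hl l).2 (h.refl l)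
  -- A point of the common part above `i` and below one of `j`, `k` can be lowered below both.
  have key : ∀ j k : J, ∀ s t : Option Bool, j ∉ K → (∀ i, (R i j ∧ R i k) → R i l) →
      ¬ amalgamLE R K (k, t) (j, s) → R i k → ∀ c ∈ K, R i c → R c j → ∃ d ∈ K, R i d ∧ R d l := by
    intro j k s t hj hl hvu hik c hc hic hcj
    have hkc : ¬ R k c := fun hkc => hvu ⟨h.trans hkc hcj, Or.inr (Or.inr ⟨c, hc, hkc, hcj⟩)⟩
    have hne : k ≠ c := fun he => hkc (he ▸ h.refl k)
    obtain ⟨m, hm, him⟩ := (h.meet_iff hne i).1 ⟨hik, hic⟩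
    obtain ⟨hmk, hmc⟩ := (h.meet_glb hne hm m).2 (h.refl m)
    have hbc : bS c := h.bS_of_rel hcj fun he => hj (he ▸ hc)
    exact ⟨m, h.meet_mem k c m hc hkc (Or.inl hbc) hm, him, hl m ⟨h.trans hmc hcj, hmk⟩⟩
  constructor
  · rintro ⟨⟨h1, h2⟩, ⟨h3, h4⟩⟩
    simp only at h1 h2 h3 h4
    refine ⟨(hl i).1 ⟨h1, h3⟩, ?_⟩
    simp only
    rcases h2 with rfl | h2 | ⟨c, hc, h5, h6⟩
    · rcases h4 with h4 | h4 | ⟨d, hd, h7, h8⟩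
      · exact absurd h4 hst
      · exact Or.inl h4
      · exact Or.inr (Or.inr (key k j t r hk (fun i hi => (hl i).1 ⟨hi.2, hi.1⟩) huv h1 d hd h7 h8))
    · exact Or.inl h2
    · exact Or.inr (Or.inr (key j k s t hj (fun i hi => (hl i).1 hi) hvu h3 c hc h5 h6))
  · intro hal
    exact ⟨h.amalgamLE_trans hal (amalgamLE_none hlj s), h.amalgamLE_trans hal (amalgamLE_none hlk t)⟩

/-- The level of the middle copy of `l` passes from the orbit of one copy of `j` to the orbits of
all its copies. -/
theorem middle_mem_orbit (hε : IsClubChoice ε) (hκ : ℵ₀ ≤ κ) (h : IsomorphicPair p x R M bS K)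
    (hw : Bridge p x R bS K w) {l j : J} (hlj : R l j) (hne : l ≠ j) {b : Bool}
    (hmem : (middle x K w l).1 ∈ orbit κ δ ε (x b j)) (s : Option Bool) :
    (middle x K w l).1 ∈ orbit κ δ ε (amalgamPt x K w (j, s)) := by
  by_cases hj : j ∈ K
  · rwa [h.amalgamPt_of_mem hj s b]
  have hlt : (middle x K w l).1 < (w j).1 := by
    by_cases hl : l ∈ K
    · rw [h.middle_of_mem hl true]
      exact hw.lt_of_mem l hl j hj hlj
    · rw [middle_of_notMem hl]
      exact hw.lt_of_rel l hl j hj hlj hne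
  have hmem' := mem_basicOrbit_of_mem_orbit hε hκ (h.mem_underlying b j) hmem hlt
    (h.w_lt hε hκ hw hj b)
  rcases s with _ | b'
  · rw [amalgamPt_none hj, orbit, if_pos (blockOf_w hw j)]
    exact hmem'
  · exact hw.orbit_subset j hj b' hmem'

theorem middle_mem_orbit_of_glb (hε : IsClubChoice ε) (hκ : ℵ₀ ≤ κ)
    (hδκ : δ < (succ (succ κ)).ord) (hF : StronglyUnbounded κ lam F)
    (h : IsomorphicPair p x R M bS K) (hw : Bridge p x R bS K w) {j k l : J} (h1 : ¬ R j k)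
    (h2 : ¬ R k j) (hl : ∀ i, (R i j ∧ R i k) ↔ R i l) (s : Option Bool) :
    (middle x K w l).1 ∈ orbit κ δ ε (amalgamPt x K w (j, s)) := by
  obtain ⟨hlj, hlk⟩ := (hl l).2 (h.refl l)
  have hne : l ≠ j := fun he => h1 (he ▸ hlk)
  have hjk : j ≠ k := fun he => h1 (he ▸ h.refl j)
  have hmem := (pairOrbit_subset hε hκ hδκ hF (h.mem_underlying true j) (h.mem_underlying true k)
    (fun he => hjk (h.inj true he)) (h.glb_mem_pairOrbit h1 h2 hl true).2).1
  refine h.middle_mem_orbit hε hκ hw hlj hne (b := true) ?_ s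
  by_cases hlK : l ∈ K
  · rwa [h.middle_of_mem hlK true]
  · rw [middle_of_notMem hlK]
    exact hw.orbit_transfer l hlK j hlj hne true hmem

theorem middle_mem_orbit_of_cross (hε : IsClubChoice ε) (hκ : ℵ₀ ≤ κ)
    (hδκ : δ < (succ (succ κ)).ord) (hF : StronglyUnbounded κ lam F)
    (h : IsomorphicPair p x R M bS K) (hw : Bridge p x R bS K w) {j k l : J} (hj : j ∉ K)
    (hk : k ∉ K) {s t : Option Bool} (huv : ¬ amalgamLE R K (j, s) (k, t))
    (hvu : ¬ amalgamLE R K (k, t) (j, s)) (hl : ∀ i, (R i j ∧ R i k) ↔ R i l) :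
    (middle x K w l).1 ∈ orbit κ δ ε (amalgamPt x K w (j, s)) := by
  obtain ⟨hlj, hlk⟩ := (hl l).2 (h.refl l)
  by_cases hjk : R j k
  · obtain rfl : j = l := h.antisymm ((hl j).1 ⟨h.refl j, hjk⟩) hlj
    rcases s with _ | b
    · exact absurd (amalgamLE_none hjk t) huv
    · rw [middle_of_notMem hj, amalgamPt_some]
      exact hw.mem_orbit j hj b
  by_cases hkj : R k j
  · obtain rfl : k = l := h.antisymm ((hl k).1 ⟨hkj, h.refl k⟩) hlk
    have hne : k ≠ j := fun he => hjk (he ▸ h.refl k)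
    rw [middle_of_notMem hk]
    rcases hw.between_or_mem k hk j hj hkj hne with ⟨c, hc, h1, h2⟩ | hmem
    · exact absurd ⟨hkj, Or.inr (Or.inr ⟨c, hc, h1, h2⟩)⟩ hvu
    · rcases s with _ | b
      · rw [amalgamPt_none hj, orbit, if_pos (blockOf_w hw j)]
        exact hmem
      · exact hw.orbit_subset j hj b hmem
  exact h.middle_mem_orbit_of_glb hε hκ hδκ hF hw hjk hkj hl s

theorem amalgam_meet_same (hε : IsClubChoice ε) (hκ : ℵ₀ ≤ κ)
    (hδκ : δ < (succ (succ κ)).ord) (hF : StronglyUnbounded κ lam F)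
    (h : IsomorphicPair p x R M bS K) (hw : Bridge p x R bS K w) {j k l : J}
    (hl : ∀ i, (R i j ∧ R i k) ↔ R i l) {s : Option Bool}
    (huv : ¬ amalgamLE R K (j, s) (k, s)) (hvu : ¬ amalgamLE R K (k, s) (j, s)) :
    (amalgamPt x K w (l, s)).1 ∈
      pairOrbit κ δ ε F (amalgamPt x K w (j, s)) (amalgamPt x K w (k, s)) := by
  have h1 : ¬ R j k := fun hjk => huv (amalgamLE_same hjk s)
  have h2 : ¬ R k j := fun hjk => hvu (amalgamLE_same hjk s)
  have hglb := h.glb_mem_pairOrbit h1 h2 hl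
  rcases s with _ | b
  · by_cases hjk : j ∈ K ∧ k ∈ K
    · have hlK : l ∈ K := h.meet_mem j k l hjk.2 h1 (Or.inr hjk.1) (hglb true).1
      rw [h.amalgamPt_of_mem hjk.1 none true, h.amalgamPt_of_mem hjk.2 none true,
        h.amalgamPt_of_mem hlK none true]
      exact (hglb true).2
    · rw [mem_pairOrbit_of_not]
      · exact ⟨h.middle_mem_orbit_of_glb hε hκ hδκ hF hw h1 h2 hl none,
          h.middle_mem_orbit_of_glb hε hκ hδκ hF hw h2 h1 (fun i => and_comm.trans (hl i)) none⟩
      · rintro ⟨hb1, hb2, -⟩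
        refine hjk ⟨?_, ?_⟩
        · by_contra hj
          rw [amalgamPt_none hj] at hb2
          exact hb2 (blockOf_w hw j)
        · by_contra hk
          rw [hb1, amalgamPt_none hk] at hb2
          exact hb2 (blockOf_w hw k)
  · exact (hglb b).2

theorem amalgam_meet_cross (hε : IsClubChoice ε) (hκ : ℵ₀ ≤ κ)
    (hδκ : δ < (succ (succ κ)).ord) (hF : StronglyUnbounded κ lam F)
    (h : IsomorphicPair p x R M bS K) (hw : Bridge p x R bS K w) {j k l : J} (hj : j ∉ K)
    (hk : k ∉ K) {s t : Option Bool} (hst : s ≠ t) (huv : ¬ amalgamLE R K (j, s) (k, t))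
    (hvu : ¬ amalgamLE R K (k, t) (j, s)) (hl : ∀ i, (R i j ∧ R i k) ↔ R i l) :
    (amalgamPt x K w (l, none)).1 ∈
      pairOrbit κ δ ε F (amalgamPt x K w (j, s)) (amalgamPt x K w (k, t)) := by
  have h1 := h.middle_mem_orbit_of_cross hε hκ hδκ hF hw hj hk huv hvu hl
  have h2 := h.middle_mem_orbit_of_cross hε hκ hδκ hF hw hk hj hvu huv
    (fun i => and_comm.trans (hl i))
  by_cases hb : blockOf κ (amalgamPt x K w (j, s)) = blockOf κ (amalgamPt x K w (k, t)) ∧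
      blockOf κ (amalgamPt x K w (j, s)) ≠ none ∧ (amalgamPt x K w (j, s)).1.cof = succ κ
  · obtain ⟨hb1, hb2, hb3⟩ := hb
    rcases s with _ | b
    · rw [amalgamPt_none hj] at hb2
      exact absurd (blockOf_w hw j) hb2
    rcases t with _ | b'
    · rw [hb1, amalgamPt_none hk] at hb2
      exact absurd (blockOf_w hw k) hb2
    simp only [amalgamPt_some] at *
    cases b <;> cases b'
    · exact absurd rfl hst
    · rw [pairOrbit_comm]
      have hfst := fst_eq_of_blockOf_eq hb1 hb2
      exact hw.pairOrbit_mem k hk j hj hb1.symm (hb1 ▸ hb2) (hfst ▸ hb3) l h2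
    · exact hw.pairOrbit_mem j hj k hk hb1 hb2 hb3 l h1
    · exact absurd rfl hst
  · rw [mem_pairOrbit_of_not hb]
    exact ⟨h1, h2⟩

theorem amalgam_meet (hε : IsClubChoice ε) (hκ : ℵ₀ ≤ κ)
    (hδκ : δ < (succ (succ κ)).ord) (hF : StronglyUnbounded κ lam F)
    (h : IsomorphicPair p x R M bS K) (hw : Bridge p x R bS K w) (u v : J × Option Bool)
    (hex : ∃ a, amalgamLE R K a u ∧ amalgamLE R K a v) :
    ∃ z, (∀ a, amalgamLE R K a u ∧ amalgamLE R K a v ↔ amalgamLE R K a z) ∧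
      (¬ amalgamLE R K u v → ¬ amalgamLE R K v u → (amalgamPt x K w z).1 ∈
        pairOrbit κ δ ε F (amalgamPt x K w u) (amalgamPt x K w v)) := by
  by_cases huv : amalgamLE R K u v
  · exact ⟨u, fun a => ⟨fun ha => ha.1, fun ha => ⟨ha, h.amalgamLE_trans ha huv⟩⟩,
      fun hn => absurd huv hn⟩
  by_cases hvu : amalgamLE R K v u
  · exact ⟨v, fun a => ⟨fun ha => ha.2, fun ha => ⟨h.amalgamLE_trans ha hvu, ha⟩⟩,
      fun _ hn => absurd hvu hn⟩
  obtain ⟨j, s⟩ := u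
  obtain ⟨k, t⟩ := v
  obtain ⟨a, ha1, ha2⟩ := hex
  obtain ⟨l, hl⟩ := h.exists_glb ha1.1 ha2.1
  by_cases hj : j ∈ K
  · have hpt : amalgamPt x K w (j, s) = amalgamPt x K w (j, t) :=
      (h.amalgamPt_eq_iff hw).2 (Or.inr ⟨rfl, hj⟩)
    have hle1 : ∀ a, amalgamLE R K a (j, s) ↔ amalgamLE R K a (j, t) := fun a => by
      rw [h.amalgamLE_of_mem_right hj, h.amalgamLE_of_mem_right hj]
    have hle2 : ∀ a, amalgamLE R K (j, s) a ↔ amalgamLE R K (j, t) a := fun a => by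
      rw [h.amalgamLE_of_mem_left hj, h.amalgamLE_of_mem_left hj]
    rw [hle2] at huv
    rw [hle1] at hvu
    refine ⟨(l, t), fun a => ?_, fun _ _ => ?_⟩
    · rw [hle1, h.amalgam_glb_same hl]
    · rw [hpt]
      exact h.amalgam_meet_same hε hκ hδκ hF hw hl huv hvu
  by_cases hk : k ∈ K
  · have hpt : amalgamPt x K w (k, t) = amalgamPt x K w (k, s) :=
      (h.amalgamPt_eq_iff hw).2 (Or.inr ⟨rfl, hk⟩)
    have hle1 : ∀ a, amalgamLE R K a (k, t) ↔ amalgamLE R K a (k, s) := fun a => by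
      rw [h.amalgamLE_of_mem_right hk, h.amalgamLE_of_mem_right hk]
    have hle2 : ∀ a, amalgamLE R K (k, t) a ↔ amalgamLE R K (k, s) a := fun a => by
      rw [h.amalgamLE_of_mem_left hk, h.amalgamLE_of_mem_left hk]
    rw [hle1] at huv
    rw [hle2] at hvu
    refine ⟨(l, s), fun a => ?_, fun _ _ => ?_⟩
    · rw [hle1, h.amalgam_glb_same hl]
    · rw [hpt]
      exact h.amalgam_meet_same hε hκ hδκ hF hw hl huv hvu
  by_cases hst : s = t
  · subst hst
    exact ⟨(l, s), h.amalgam_glb_same hl s, fun _ _ =>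
      h.amalgam_meet_same hε hκ hδκ hF hw hl huv hvu⟩
  · exact ⟨(l, none), h.amalgam_glb_cross hj hk hst huv hvu hl, fun _ _ =>
      h.amalgam_meet_cross hε hκ hδκ hF hw hj hk hst huv hvu hl⟩

end IsomorphicPair

end Amalgamation

section Amalgamation

variable {κ lam : Cardinal.{u}} {δ : Ordinal.{u}} {ε : OrdInterval.{u} → Ordinal.{u} → Ordinal.{u}}
  {F : Sym2 Ordinal.{u} → Ordinal.{u}}

namespace IsomorphicPair

variable {p : Bool → Cond κ lam δ ε F} {J : Type (u + 1)} {x : Bool → J → Pt.{u}}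
  {R : J → J → Prop} {M : J → J → Option J} {bS : J → Prop} {K : Set J} {w : J → Pt.{u}}

/-! ### Interpolation in the amalgam -/

theorem amalgam_between_up (hε : IsClubChoice ε) (hκ : ℵ₀ ≤ κ)
    (h : IsomorphicPair p x R M bS K) (hw : Bridge p x R bS K w) {c k : J} (hc : c ∈ K)
    (hck : R c k) (hne : c ≠ k) (t : Option Bool) {Λ : OrdInterval.{u}} (hΛ : Λ ∈ tree δ ε)
    (hs : Separates Λ (x true c) (amalgamPt x K w (k, t))) :
    ∃ z : J × Option Bool, R c z.1 ∧ c ≠ z.1 ∧ amalgamLE R K z (k, t) ∧ z.1 ≠ k ∧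
      (amalgamPt x K w z).1 = Λ.hi := by
  have key : ∀ b, amalgamPt x K w (k, t) = x b k → (∀ i, R i k → amalgamLE R K (i, some b) (k, t)) →
      ∃ z : J × Option Bool, R c z.1 ∧ c ≠ z.1 ∧ amalgamLE R K z (k, t) ∧ z.1 ≠ k ∧
      (amalgamPt x K w z).1 = Λ.hi := by
    intro b hb hle
    rw [hb, ← h.agree c hc b] at hs
    obtain ⟨i, h1, h2, h3, h4, h5⟩ := h.exists_between hck hne b hΛ hs
    exact ⟨(i, some b), h1, h2, hle i h3, h4, h5⟩
  rcases t with _ | b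
  · by_cases hk : k ∈ K
    · exact key true (h.amalgamPt_of_mem hk none true) fun i hi =>
        (h.amalgamLE_of_mem_right hk none _).2 hi
    · rw [amalgamPt_none hk] at hs
      obtain ⟨i, hi, h1, h2, h3, h4, h5⟩ := h.exists_between_mem hck hne hΛ fun b => by
        rw [Separates, h.agree c hc b]
        exact ⟨hs.1, hs.2.1, hs.2.2.trans (h.w_lt hε hκ hw hk b)⟩
      refine ⟨(i, none), h1, h2, amalgamLE_none h3 none, h4, ?_⟩
      rw [h.amalgamPt_of_mem hi none true, h5]
  · exact key b rfl fun i hi => amalgamLE_same hi _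

theorem amalgam_between_down (h : IsomorphicPair p x R M bS K)
    (hw : Bridge p x R bS K w) {j c : J} (hc : c ∈ K) (hjc : R j c) (hne : j ≠ c)
    (s : Option Bool) {Λ : OrdInterval.{u}} (hΛ : Λ ∈ tree δ ε)
    (hs : Separates Λ (amalgamPt x K w (j, s)) (x true c)) :
    ∃ z : J × Option Bool, amalgamLE R K (j, s) z ∧ j ≠ z.1 ∧ R z.1 c ∧ z.1 ≠ c ∧
      (amalgamPt x K w z).1 = Λ.hi := by
  have key : ∀ b, Separates Λ (x b j) (x b c) →
      (∀ i, R j i → amalgamLE R K (j, s) (i, some b)) →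
      ∃ z : J × Option Bool, amalgamLE R K (j, s) z ∧ j ≠ z.1 ∧ R z.1 c ∧ z.1 ≠ c ∧
      (amalgamPt x K w z).1 = Λ.hi := by
    intro b hb hle
    obtain ⟨i, h1, h2, h3, h4, h5⟩ := h.exists_between hjc hne b hΛ hb
    exact ⟨(i, some b), hle i h1, h2, h3, h4, h5⟩
  rcases s with _ | b
  · refine key true ?_ fun i hi => amalgamLE_none hi _
    by_cases hj : j ∈ K
    · rwa [h.amalgamPt_of_mem hj none true] at hs
    · rw [amalgamPt_none hj] at hs
      have h1 := (hw.not_separated j hj Λ hΛ hs.1 hs.2.1 true).2 (h.bS_of_rel hjc hne)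
      exact ⟨h1.1, h1.2, hs.2.2⟩
  · refine key b ?_ fun i hi => amalgamLE_same hi _
    rw [h.agree c hc b]
    exact hs

theorem amalgam_between (hε : IsClubChoice ε) (hκ : ℵ₀ ≤ κ)
    (h : IsomorphicPair p x R M bS K) (hw : Bridge p x R bS K w) {u v : J × Option Bool}
    (hne : amalgamPt x K w u ≠ amalgamPt x K w v) (huv : amalgamLE R K u v)
    {Λ : OrdInterval.{u}} (hΛ : Λ ∈ tree δ ε)
    (hs : Separates Λ (amalgamPt x K w u) (amalgamPt x K w v)) :
    ∃ z : J × Option Bool, amalgamLE R K u z ∧ u.1 ≠ z.1 ∧ amalgamLE R K z v ∧ z.1 ≠ v.1 ∧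
      (amalgamPt x K w z).1 = Λ.hi := by
  obtain ⟨j, s⟩ := u
  obtain ⟨k, t⟩ := v
  obtain ⟨hjk, h1⟩ := huv
  simp only at hjk h1
  have hup : ∀ c ∈ K, R j c → R c k → c ≠ k →
      Separates Λ (x true c) (amalgamPt x K w (k, t)) →
      ∃ z : J × Option Bool, amalgamLE R K (j, s) z ∧ j ≠ z.1 ∧ amalgamLE R K z (k, t) ∧ z.1 ≠ k ∧
      (amalgamPt x K w z).1 = Λ.hi := by
    intro c hc hjc hck hcne hsep
    obtain ⟨z, h2, h3, h4, h5, h6⟩ := h.amalgam_between_up hε hκ hw hc hck hcne t hΛ hsep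
    refine ⟨z, ⟨h.trans hjc h2, Or.inr (Or.inr ⟨c, hc, hjc, h2⟩)⟩, ?_, h4, h5, h6⟩
    rintro rfl
    exact h3 (h.antisymm h2 hjc)
  have hK : (∃ c ∈ K, R j c ∧ R c k) →
      ∃ z : J × Option Bool, amalgamLE R K (j, s) z ∧ j ≠ z.1 ∧ amalgamLE R K z (k, t) ∧ z.1 ≠ k ∧
      (amalgamPt x K w z).1 = Λ.hi := by
    rintro ⟨c, hc, hjc, hck⟩
    by_cases hjc' : j = c
    · subst hjc'
      refine hup j hc hjc hjk (fun he => hne ?_) ?_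
      · exact (h.amalgamPt_eq_iff hw).2 (Or.inr ⟨he, hc⟩)
      · rwa [h.amalgamPt_of_mem hc s true] at hs
    have hlt := (h.amalgamPt_le_of_rel hε hκ hw hc hjc s).2 hjc'
    have hdown : Λ.hi < (x true c).1 →
        ∃ z : J × Option Bool, amalgamLE R K (j, s) z ∧ j ≠ z.1 ∧ amalgamLE R K z (k, t) ∧
          z.1 ≠ k ∧ (amalgamPt x K w z).1 = Λ.hi := by
      intro hlt'
      obtain ⟨z, h2, h3, h4, h5, h6⟩ := h.amalgam_between_down hw hc hjc hjc' s hΛ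
        ⟨hs.1, hs.2.1, hlt'⟩
      refine ⟨z, h2, h3, ⟨h.trans h4 hck, Or.inr (Or.inr ⟨c, hc, h4, hck⟩)⟩, ?_, h6⟩
      rintro rfl
      exact h5 (h.antisymm h4 hck)
    by_cases hck' : c = k
    · subst hck'
      refine hdown ?_
      have := hs.2.2
      rwa [h.amalgamPt_of_mem hc t true] at this
    rcases lt_trichotomy Λ.hi (x true c).1 with h2 | h2 | h2
    · exact hdown h2
    · refine ⟨(c, none), ⟨hjc, Or.inr (Or.inr ⟨c, hc, hjc, h.refl c⟩)⟩, hjc',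
        amalgamLE_none hck t, hck', ?_⟩
      rw [h.amalgamPt_of_mem hc none true, h2]
    · exact hup c hc hjc hck hck' ⟨hs.1.trans hlt, h2, hs.2.2⟩
  by_cases hj : j ∈ K
  · exact hK ⟨j, hj, h.refl j, hjk⟩
  by_cases hk : k ∈ K
  · exact hK ⟨k, hk, hjk, h.refl k⟩
  have hside : ∀ b, t = some b → j ≠ k → Separates Λ (x b j) (x b k) →
      (∀ i, R j i → amalgamLE R K (j, s) (i, some b)) →
      ∃ z : J × Option Bool, amalgamLE R K (j, s) z ∧ j ≠ z.1 ∧ amalgamLE R K z (k, t) ∧ z.1 ≠ k ∧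
      (amalgamPt x K w z).1 = Λ.hi := by
    rintro b rfl hjk' hsep hle
    obtain ⟨i, h2, h3, h4, h5, h6⟩ := h.exists_between hjk hjk' b hΛ hsep
    exact ⟨(i, some b), hle i h2, h3, amalgamLE_same h4 _, h5, h6⟩
  have hnone : s = none →
      ∃ z : J × Option Bool, amalgamLE R K (j, s) z ∧ j ≠ z.1 ∧ amalgamLE R K z (k, t) ∧ z.1 ≠ k ∧
      (amalgamPt x K w z).1 = Λ.hi := by
    rintro rfl
    have hs' := hs
    rw [amalgamPt_none hj] at hs'
    have hsep := hw.not_separated j hj Λ hΛ hs'.1 hs'.2.1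
    rcases t with _ | b
    · have hjk' : j ≠ k := fun he => hne (by rw [he])
      rw [amalgamPt_none hk] at hs'
      obtain ⟨c, hc, h2, h3, h4, h5, h6⟩ := h.exists_between_mem hjk hjk' hΛ fun b =>
        ⟨((hsep b).2 (h.bS_of_rel hjk hjk')).1, ((hsep b).2 (h.bS_of_rel hjk hjk')).2,
          hs'.2.2.trans (h.w_lt hε hκ hw hk b)⟩
      exact ⟨(c, none), amalgamLE_none h2 none, h3, amalgamLE_none h4 none, h5, by
        rw [h.amalgamPt_of_mem hc none true, h6]⟩
    · by_cases hjk' : j = k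
      · subst hjk'
        exact absurd (hsep b).1 hs'.2.2.not_ge
      · have hb := (hsep b).2 (h.bS_of_rel hjk hjk')
        exact hside b rfl hjk' ⟨hb.1, hb.2, hs'.2.2⟩ fun i hi => amalgamLE_none hi _
  rcases h1 with rfl | h1 | h1
  · rcases s with _ | b
    · exact hnone rfl
    · exact hside b rfl (fun he => hne (by rw [he])) hs fun i hi => amalgamLE_same hi _
  · exact hnone h1
  · exact hK h1

theorem mk_range_amalgamPt_lt (hκ : ℵ₀ ≤ κ) (hJ : #J < lift.{u + 1} κ) :
    #(Set.range (amalgamPt x K w)) < lift.{u + 1} κ := by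
  refine mk_range_le.trans_lt ?_
  rw [mk_prod, Cardinal.lift_id', mk_fintype (Option Bool)]
  simp only [Cardinal.lift_natCast]
  exact mul_lt_of_lt (aleph0_le_lift.2 hκ) hJ ((natCast_lt_aleph0).trans_le (aleph0_le_lift.2 hκ))

/-- Two isomorphic conditions that can be bridged are compatible. -/
theorem exists_common_extension (hε : IsClubChoice ε) (hκ : ℵ₀ ≤ κ)
    (hδκ : δ < (succ (succ κ)).ord) (hF : StronglyUnbounded κ lam F)
    (h : IsomorphicPair p x R M bS K) (hw : Bridge p x R bS K w) (hJ : #J < lift.{u + 1} κ) :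
    ∃ r : Cond κ lam δ ε F, ∀ b, r ≤ p b := by
  obtain ⟨r, h1, h2, h3, h4⟩ := exists_cond_of_preorder (κ := κ) (lam := lam) (δ := δ) (ε := ε)
    (F := F) (amalgamPt x K w) (amalgamLE R K)
    (by
      intro u v huv a
      rcases (h.amalgamPt_eq_iff hw).1 huv with rfl | ⟨h1, h2⟩
      · simp
      · obtain ⟨j, s⟩ := u
        obtain ⟨k, t⟩ := v
        simp only at h1 h2
        subst h1
        rw [h.amalgamLE_of_mem_left h2, h.amalgamLE_of_mem_left h2, h.amalgamLE_of_mem_right h2,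
          h.amalgamLE_of_mem_right h2]
        simp)
    (h.amalgamPt_mem_underlying hε hκ hw)
    (mk_range_amalgamPt_lt hκ hJ)
    (fun u => amalgamLE_same (h.refl u.1) u.2)
    (fun u v t => h.amalgamLE_trans)
    (fun u v => h.amalgam_height hε hκ hw)
    (fun u v => h.amalgam_block hw)
    (fun u v _ => h.amalgam_meet hε hκ hδκ hF hw u v)
    (by
      intro u v hne huv Λ hΛ hs
      obtain ⟨z, a1, a2, a3, a4, a5⟩ := h.amalgam_between hε hκ hw hne huv hΛ hs
      exact ⟨z, a1, h.fst_ne_of_amalgamPt_ne hw a2 _ _, a3, h.fst_ne_of_amalgamPt_ne hw a4 _ _, a5⟩)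
  refine ⟨r, fun b => ⟨?_, ?_, ?_⟩⟩
  · rw [h1, ← h.range_eq b]
    rintro _ ⟨j, rfl⟩
    exact ⟨(j, some b), rfl⟩
  · rw [← h.range_eq b]
    rintro _ ⟨j, rfl⟩ _ ⟨k, rfl⟩
    rw [h.le_iff, ← amalgamPt_some (x := x) (K := K) (w := w) b j,
      ← amalgamPt_some (x := x) (K := K) (w := w) b k, h2]
    exact ⟨fun hjk => amalgamLE_same hjk _, fun hjk => hjk.1⟩
  · rw [← h.range_eq b]
    rintro _ ⟨j, rfl⟩ _ ⟨k, rfl⟩ hne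
    have hjk : j ≠ k := fun he => hne (by rw [he])
    rw [h.i_eq]
    cases hM : M j k with
    | some l =>
      exact (h3 (j, some b) (k, some b) (l, some b) hne
        (h.amalgam_glb_same (h.meet_glb hjk hM) _)).symm
    | none =>
      refine (h4 (j, some b) (k, some b) hne ?_).symm
      rintro ⟨a, ha1, ha2⟩
      obtain ⟨l, hl, -⟩ := (h.meet_iff hjk a.1).1 ⟨ha1.1, ha2.1⟩
      rw [hM] at hl
      exact absurd hl (by simp)

end IsomorphicPair

end Amalgamation

/-! ### Uniform families of conditions -/

section Uniform

variable {κ lam : Cardinal.{u}} {δ : Ordinal.{u}} {ε : OrdInterval.{u} → Ordinal.{u} → Ordinal.{u}}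
  {F : Sym2 Ordinal.{u} → Ordinal.{u}}

/-- A family `B` of conditions enumerated by one index set `J`, so that the order `R`, the meets
`M`, the block types `bS` and the ranks `N` of the levels do not depend on the condition, the points
form a `Δ`-system with kernel `K`, and the levels form one with kernel `L`; moreover the
intervals of the tree around the level of each point are either all equal or pairwise
distinct. -/
structure UniformFamily (B : Set (Cond κ lam δ ε F)) {J : Type (u + 1)}
    (x : Cond κ lam δ ε F → J → Pt.{u}) (R : J → J → Prop) (M : J → J → Option J) (bS : J → Prop)
    (N : J → ℕ) (K L : Set J) : Prop where
  inj : ∀ p ∈ B, Function.Injective (x p)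
  range_eq : ∀ p ∈ B, Set.range (x p) = p.A
  le_iff : ∀ p ∈ B, ∀ j k, p.le (x p j) (x p k) ↔ R j k
  i_eq : ∀ p ∈ B, ∀ j k, p.i s(x p j, x p k) = (M j k).map (x p)
  block_iff : ∀ p ∈ B, ∀ j, blockOf κ (x p j) = none ↔ bS j
  rank_eq : ∀ p ∈ B, ∀ j, rankOf δ ε (x p j).1 = N j
  agree : ∀ j ∈ K, ∀ p ∈ B, ∀ q ∈ B, x p j = x q j
  disj : ∀ p ∈ B, ∀ q ∈ B, p ≠ q → ∀ j ∉ K, ∀ k ∉ K, x p j ≠ x q k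
  level_agree : ∀ j ∈ L, ∀ p ∈ B, ∀ q ∈ B, (x p j).1 = (x q j).1
  level_disj : ∀ p ∈ B, ∀ q ∈ B, p ≠ q → ∀ j ∉ L, ∀ k ∉ L, (x p j).1 ≠ (x q k).1
  snd_disj : ∀ p ∈ B, ∀ q ∈ B, p ≠ q → ∀ j ∉ K, ∀ k ∉ K, j ∈ L → k ∈ L → (x p j).2 ≠ (x q k).2
  interval : ∀ j, ∀ m ≤ N j,
    (∀ p ∈ B, ∀ q ∈ B, intervalAt δ ε (x p j).1 m = intervalAt δ ε (x q j).1 m) ∨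
    ∀ p ∈ B, ∀ q ∈ B, p ≠ q → intervalAt δ ε (x p j).1 m ≠ intervalAt δ ε (x q j).1 m

theorem lift_power_le {c : Cardinal.{u}} (hpow : c ^< c = c) :
    ∀ θ < lift.{u + 1} c, lift.{u + 1} c ^ θ ≤ lift.{u + 1} c := by
  intro θ hθ
  obtain ⟨θ, rfl⟩ := mem_range_lift_of_le hθ.le
  rw [← lift_power, Cardinal.lift_le]
  exact (le_powerlt c (Cardinal.lift_lt.1 hθ)).trans hpow.le

theorem exists_uniformFamily (hκ : κ.IsRegular) (hκpow : κ ^< κ = κ) {S : Set (Cond κ lam δ ε F)}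
    (hS : lift.{u + 1} κ < #S) :
    ∃ B ⊆ S, lift.{u + 1} κ < #B ∧ ∃ (J : Type (u + 1)) (x : Cond κ lam δ ε F → J → Pt.{u})
      (R : J → J → Prop) (M : J → J → Option J) (bS : J → Prop) (N : J → ℕ) (K L : Set J),
      #J < lift.{u + 1} κ ∧ UniformFamily B x R M bS N K L := by
  classical
  have hpow := lift_power_le hκpow
  have hreg : (lift.{u + 1} κ).IsRegular := hκ.lift
  have hc : ℵ₀ ≤ lift.{u + 1} κ := hreg.aleph0_le
  generalize hcdef : lift.{u + 1} κ = c at *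
  -- All conditions get the same size.
  have hcard : ∀ p : Cond κ lam δ ε F, ∃ o : Set.Iio κ.ord, #p.A = lift.{u + 1} o.1.card := by
    intro p
    have h1 := p.card_lt
    obtain ⟨θ, hθ⟩ := mem_range_lift_of_le h1.le
    rw [← hθ, Cardinal.lift_lt] at h1
    exact ⟨⟨θ.ord, ord_lt_ord.2 h1⟩, by rw [card_ord, hθ]⟩
  choose o ho using hcard
  obtain ⟨B₁, hB₁S, hB₁, o₁, ho₁⟩ := exists_large_fiber hc o
    (by rw [Cardinal.mk_Iio_ordinal, card_ord, hcdef]) hS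
  obtain ⟨p₀, hp₀⟩ : B₁.Nonempty := by
    rw [Set.nonempty_iff_ne_empty]
    rintro rfl
    simp at hB₁
  have hequiv : ∀ p ∈ B₁, Nonempty (p₀.A ≃ p.A) := by
    intro p hp
    rw [← Cardinal.eq, ho, ho, ho₁ p hp, ho₁ p₀ hp₀]
  let J : Type (u + 1) := p₀.A
  have hJ : #J < c := hcdef ▸ p₀.card_lt
  have hJJ : #(J × J) < c := by
    rw [← mul_def]
    exact mul_lt_of_lt hc hJ hJ
  let x : Cond κ lam δ ε F → J → Pt.{u} := fun p j =>
    if hp : p ∈ B₁ then ((hequiv p hp).some j : Pt.{u}) else (0, 0)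
  have hx : ∀ p, ∀ hp : p ∈ B₁, ∀ j, x p j = ((hequiv p hp).some j : Pt.{u}) := fun p hp j =>
    dif_pos hp
  have hinj : ∀ p ∈ B₁, Function.Injective (x p) := by
    intro p hp j k hjk
    rw [hx p hp, hx p hp] at hjk
    exact (hequiv p hp).some.injective (Subtype.ext hjk)
  have hrange : ∀ p ∈ B₁, Set.range (x p) = p.A := by
    intro p hp
    ext y
    constructor
    · rintro ⟨j, rfl⟩
      rw [hx p hp]
      exact Subtype.coe_prop _
    · intro hy
      refine ⟨(hequiv p hp).some.symm ⟨y, hy⟩, ?_⟩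
      rw [hx p hp, Equiv.apply_symm_apply]
  -- The structure on the index set is made independent of the condition.
  have hfin : ∀ (T : Type) [Finite T], #(ULift.{u + 1} T) ≤ c := fun T _ =>
    (lt_aleph0_of_finite _).le.trans hc
  obtain ⟨B₂, hB₂₁, hB₂, R, hR⟩ := exists_large_subset_const hc hpow hJJ (hfin Prop)
    (fun p (jk : J × J) => ULift.up.{u + 1} (p.le (x p jk.1) (x p jk.2))) hB₁
  obtain ⟨B₃, hB₃₂, hB₃, M, hM⟩ := exists_large_subset_const hc hpow hJJ (T := Option J)
    (by rw [mk_option]; exact add_le_of_le hc hJ.le (one_le_aleph0.trans hc))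
    (fun p (jk : J × J) => if h : ∃ l, p.i s(x p jk.1, x p jk.2) = some (x p l) then
      some h.choose else none) hB₂
  obtain ⟨B₄, hB₄₃, hB₄, bS, hbS⟩ := exists_large_subset_const hc hpow hJ (hfin Prop)
    (fun p j => ULift.up.{u + 1} (blockOf κ (x p j) = none)) hB₃
  obtain ⟨B₅, hB₅₄, hB₅, N, hN⟩ := exists_large_subset_const hc hpow hJ
    (T := ULift.{u + 1} ℕ) (by simpa using hc)
    (fun p j => ULift.up.{u + 1} (rankOf δ ε (x p j).1)) hB₄
  -- Four applications of the `Δ`-system lemma: points, levels, second coordinates, intervals.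
  obtain ⟨B₆, hB₆₅, hB₆, K, hK, hK'⟩ := exists_deltaSystem hc hpow hJ x hB₅
  obtain ⟨B₇, hB₇₆, hB₇, L, hL, hL'⟩ := exists_deltaSystem hc hpow hJ (fun p j => (x p j).1) hB₆
  obtain ⟨B₈, hB₈₇, hB₈, L₂, hL₂, hL₂'⟩ :=
    exists_deltaSystem hc hpow hJ (fun p j => (x p j).2) hB₇
  have hsig : #(Σ j : J, ULift.{u + 1} (Fin ((N j).down + 1))) < c := by
    rw [mk_sigma]
    exact sum_lt_of_isRegular hreg hJ fun j => (lt_aleph0_of_finite _).trans_le hc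
  obtain ⟨B₉, hB₉₈, hB₉, L₃, hL₃, hL₃'⟩ := exists_deltaSystem hc hpow hsig
    (fun p jm => intervalAt δ ε (x p jm.1).1 jm.2.down.1) hB₈
  have h98 := hB₉₈
  have h97 := h98.trans hB₈₇
  have h96 := h97.trans hB₇₆
  have h95 := h96.trans hB₆₅
  have h94 := h95.trans hB₅₄
  have h93 := h94.trans hB₄₃
  have h92 := h93.trans hB₃₂
  have h91 := h92.trans hB₂₁
  obtain ⟨p₁, hp₁, p₂, hp₂, hp₁₂⟩ : ∃ p ∈ B₉, ∃ q ∈ B₉, p ≠ q := by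
    by_contra! hcon
    have : B₉.Subsingleton := fun p hp q hq => hcon p hp q hq
    exact ((mk_le_one_iff_set_subsingleton.2 this).trans (one_le_aleph0.trans hc)).not_gt hB₉
  refine ⟨B₉, h91.trans hB₁S, hB₉, J, x, fun j k => (R (j, k)).down, fun j k => M (j, k),
    fun j => (bS j).down, fun j => (N j).down, K, L, hJ, ?_⟩
  refine
    { inj := fun p hp => hinj p (h91 hp)
      range_eq := fun p hp => hrange p (h91 hp)
      le_iff := ?_
      i_eq := ?_
      block_iff := ?_
      rank_eq := ?_
      agree := fun j hj p hp q hq => hK j hj p (h96 hp) q (h96 hq)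
      disj := fun p hp q hq => hK' p (h96 hp) q (h96 hq)
      level_agree := fun j hj p hp q hq => hL j hj p (h97 hp) q (h97 hq)
      level_disj := fun p hp q hq => hL' p (h97 hp) q (h97 hq)
      snd_disj := ?_
      interval := ?_ }
  · intro p hp j k
    rw [← hR p (h92 hp) (j, k)]
  · intro p hp j k
    rw [← hM p (h93 hp) (j, k)]
    by_cases h : ∃ l, p.i s(x p j, x p k) = some (x p l)
    · simp only [dif_pos h, Option.map_some]
      exact h.choose_spec
    · simp only [dif_neg h, Option.map_none]
      by_contra hne
      obtain ⟨z, hz⟩ := Option.ne_none_iff_exists'.1 hne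
      have hzA := p.i_val _ _ _ hz
      rw [← hrange p (h91 hp)] at hzA
      obtain ⟨l, rfl⟩ := hzA
      exact h ⟨l, hz⟩
  · intro p hp j
    rw [← hbS p (h94 hp) j]
  · intro p hp j
    rw [← hN p (h95 hp) j]
  · intro p hp q hq hpq j hj k hk hjL hkL
    have key : ∀ j ∉ K, j ∈ L → j ∉ L₂ := by
      intro j hj hjL hjL₂
      refine hK' p₁ (h96 hp₁) p₂ (h96 hp₂) hp₁₂ j hj j hj (Prod.ext ?_ ?_)
      · exact hL j hjL p₁ (h97 hp₁) p₂ (h97 hp₂)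
      · exact hL₂ j hjL₂ p₁ (h98 hp₁) p₂ (h98 hp₂)
    exact hL₂' p (h98 hp) q (h98 hq) hpq j (key j hj hjL) k (key k hk hkL)
  · intro j m hm
    let jm : Σ j : J, ULift.{u + 1} (Fin ((N j).down + 1)) := ⟨j, ⟨⟨m, Nat.lt_succ_of_le hm⟩⟩⟩
    by_cases hjm : jm ∈ L₃
    · exact Or.inl fun p hp q hq => hL₃ jm hjm p hp q hq
    · exact Or.inr fun p hp q hq hpq => hL₃' p hp q hq hpq jm hjm jm hjm

end Uniform

section Uniform

variable {κ lam : Cardinal.{u}} {δ : Ordinal.{u}} {ε : OrdInterval.{u} → Ordinal.{u} → Ordinal.{u}}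
  {F : Sym2 Ordinal.{u} → Ordinal.{u}}

theorem mk_le_of_injOn_of_mapsTo {α β : Type (u + 1)} {B : Set α} {f : α → β} {s : Set β}
    (hf : Set.InjOn f B) (hs : ∀ p ∈ B, f p ∈ s) : #B ≤ #s := by
  rw [← mk_image_eq_of_injOn f B hf]
  exact mk_le_mk_of_subset (Set.image_subset_iff.2 hs)

namespace UniformFamily

variable {B : Set (Cond κ lam δ ε F)} {J : Type (u + 1)} {x : Cond κ lam δ ε F → J → Pt.{u}}
  {R : J → J → Prop} {M : J → J → Option J} {bS : J → Prop} {N : J → ℕ} {K L : Set J}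

theorem mem_A (h : UniformFamily B x R M bS N K L) {p : Cond κ lam δ ε F} (hp : p ∈ B) (j : J) :
    x p j ∈ p.A :=
  h.range_eq p hp ▸ ⟨j, rfl⟩

theorem mem_underlying (h : UniformFamily B x R M bS N K L) {p : Cond κ lam δ ε F} (hp : p ∈ B)
    (j : J) : x p j ∈ underlying κ lam δ :=
  p.subset_underlying (h.mem_A hp j)

theorem injOn_level (h : UniformFamily B x R M bS N K L) {j : J} (hj : j ∉ L) :
    Set.InjOn (fun p => (x p j).1) B := by
  intro p hp q hq heq
  by_contra hne
  exact h.level_disj p hp q hq hne j hj j hj heq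

theorem lt_of_rel (h : UniformFamily B x R M bS N K L) {p : Cond κ lam δ ε F} (hp : p ∈ B)
    {i j : J} (h1 : R i j) (hne : i ≠ j) : (x p i).1 < (x p j).1 :=
  (p.le_height _ _ ((h.le_iff p hp i j).2 h1)).resolve_left fun he => hne (h.inj p hp he)

theorem bS_of_rel (h : UniformFamily B x R M bS N K L) {p : Cond κ lam δ ε F} (hp : p ∈ B)
    {i j : J} (h1 : R i j) (hne : i ≠ j) : bS i := by
  by_contra hb
  exact hne (h.inj p hp (p.le_block _ _ ((h.le_iff p hp i j).2 h1)
    fun hb' => hb ((h.block_iff p hp i).1 hb')))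

theorem refl (h : UniformFamily B x R M bS N K L) {p : Cond κ lam δ ε F} (hp : p ∈ B) (j : J) :
    R j j :=
  (h.le_iff p hp j j).1 (p.le_refl _ (h.mem_A hp j))

theorem nonempty (hB : lift.{u + 1} κ < #B) : B.Nonempty := by
  rw [Set.nonempty_iff_ne_empty]
  rintro rfl
  simp at hB

/-- The points in the block `S` that vary have varying levels, because each level contains only
`κ` points of `S`. -/
theorem notMem_L (h : UniformFamily B x R M bS N K L) (hB : lift.{u + 1} κ < #B) {j : J}
    (hj : j ∉ K) (hb : bS j) : j ∉ L := by
  intro hL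
  refine hB.not_ge ?_
  have h1 := mk_le_of_injOn_of_mapsTo (B := B) (f := fun p => (x p j).2) (s := Set.Iio κ.ord)
    (by
      intro p hp q hq heq
      by_contra hne
      exact h.disj p hp q hq hne j hj j hj (Prod.ext (h.level_agree j hL p hp q hq) heq))
    (fun p hp => blockOf_eq_none.1 ((h.block_iff p hp j).2 hb))
  rwa [Cardinal.mk_Iio_ordinal, card_ord] at h1

theorem K_subset_L (h : UniformFamily B x R M bS N K L) (hκ : ℵ₀ ≤ κ)
    (hB : lift.{u + 1} κ < #B) : K ⊆ L := by
  intro j hj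
  by_contra hL
  refine hB.not_ge ((mk_le_of_injOn_of_mapsTo (h.injOn_level hL)
    (s := {(x (nonempty hB).some j).1}) ?_).trans ?_)
  · intro p hp
    exact congrArg Prod.fst (h.agree j hj p hp _ (nonempty hB).some_mem)
  · rw [mk_singleton]
    exact one_le_aleph0.trans (aleph0_le_lift.2 hκ)

/-- A meet of a fixed point with a fixed point, or of a fixed point of `S` with any point, is
fixed: its level stays in a set of size `κ`. -/
theorem meet_mem (hε : IsClubChoice ε) (hκ : ℵ₀ ≤ κ) (hδκ : δ < (succ (succ κ)).ord)
    (hF : StronglyUnbounded κ lam F) (h : UniformFamily B x R M bS N K L)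
    (hB : lift.{u + 1} κ < #B) {j k l : J} (hk : k ∈ K) (hjk : ¬ R j k) (hor : bS k ∨ j ∈ K)
    (hl : M j k = some l) : l ∈ K := by
  obtain ⟨p₀, hp₀⟩ := nonempty hB
  have hi : ∀ p ∈ B, p.i s(x p j, x p k) = some (x p l) := fun p hp => by
    rw [h.i_eq p hp, hl]; rfl
  have hne : j ≠ k := fun he => hjk (he ▸ h.refl hp₀ j)
  have hglb : ∀ p ∈ B, ∀ a, (R a j ∧ R a k) ↔ R a l := by
    intro p hp a
    rw [← h.le_iff p hp, ← h.le_iff p hp, ← h.le_iff p hp,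
      p.inf_spec _ (h.mem_A hp j) _ (h.mem_A hp k) (fun he => hne (h.inj p hp he)) _
      (h.mem_A hp a), hi p hp]
    simp
  obtain ⟨hlj, hlk⟩ := (hglb p₀ hp₀ l).2 (h.refl hp₀ l)
  by_cases hkj : R k j
  · have hkl := (hglb p₀ hp₀ k).1 ⟨hkj, h.refl hp₀ k⟩
    have : l = k := h.inj p₀ hp₀ (p₀.le_antisymm _ _ ((h.le_iff p₀ hp₀ _ _).2 hlk)
      ((h.le_iff p₀ hp₀ _ _).2 hkl))
    exact this ▸ hk
  by_contra hlK
  have hlb : bS l := h.bS_of_rel hp₀ hlj fun he => hjk (he ▸ hlk)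
  have hlL := h.notMem_L hB hlK hlb
  have hmem : ∀ p ∈ B, (x p l).1 ∈ pairOrbit κ δ ε F (x p j) (x p k) := by
    intro p hp
    obtain ⟨z, hz, hz'⟩ := p.inf_mem _ (h.mem_A hp j) _ (h.mem_A hp k)
      (fun he => hne (h.inj p hp he)) (fun he => hjk ((h.le_iff p hp _ _).1 he))
      (fun he => hkj ((h.le_iff p hp _ _).1 he))
      ⟨x p l, h.mem_A hp l, (h.le_iff p hp _ _).2 hlj, (h.le_iff p hp _ _).2 hlk⟩
    rw [hi p hp] at hz
    rwa [← Option.some.inj hz] at hz'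
  have hne' : ∀ p ∈ B, x p j ≠ x p k := fun p hp he => hne (h.inj p hp he)
  refine hB.not_ge ?_
  rcases hor with hb | hj
  · refine (mk_le_of_injOn_of_mapsTo (h.injOn_level hlL) (s := orbit κ δ ε (x p₀ k)) ?_).trans
      (mk_orbit_le_of_blockOf_eq_none hε hκ hδκ (h.mem_underlying hp₀ k)
        ((h.block_iff p₀ hp₀ k).2 hb))
    intro p hp
    rw [h.agree k hk p₀ hp₀ p hp]
    exact (pairOrbit_subset hε hκ hδκ hF (h.mem_underlying hp j) (h.mem_underlying hp k)
      (hne' p hp) (hmem p hp)).2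
  · refine (mk_le_of_injOn_of_mapsTo (h.injOn_level hlL)
      (s := pairOrbit κ δ ε F (x p₀ j) (x p₀ k)) ?_).trans
      (mk_pairOrbit_le hε hκ hδκ hF (h.mem_underlying hp₀ j) (h.mem_underlying hp₀ k)
        (hne' p₀ hp₀))
    intro p hp
    rw [h.agree k hk p₀ hp₀ p hp, h.agree j hj p₀ hp₀ p hp]
    exact hmem p hp

theorem isomorphicPair (hε : IsClubChoice ε) (hκ : ℵ₀ ≤ κ) (hδκ : δ < (succ (succ κ)).ord)
    (hF : StronglyUnbounded κ lam F) (h : UniformFamily B x R M bS N K L)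
    (hB : lift.{u + 1} κ < #B) {P : Bool → Cond κ lam δ ε F} (hP : ∀ b, P b ∈ B)
    (hne : P true ≠ P false) : IsomorphicPair P (fun b => x (P b)) R M bS K where
  inj b := h.inj _ (hP b)
  range_eq b := h.range_eq _ (hP b)
  le_iff b := h.le_iff _ (hP b)
  i_eq b := h.i_eq _ (hP b)
  block_iff b := h.block_iff _ (hP b)
  agree j hj b := h.agree j hj _ (hP b) _ (hP true)
  disj := h.disj _ (hP true) _ (hP false) hne
  meet_mem _ _ _ := h.meet_mem hε hκ hδκ hF hB
  level_ne j hj k hk hbj hbk := h.level_disj _ (hP true) _ (hP false) hne j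
    (h.notMem_L hB hj hbj) k (h.notMem_L hB hk hbk)

end UniformFamily

/-- The interval `I` and the ordinal `γ` towards which the level of the varying index `j` tends:
either the level is constantly `γ` and `I = J(γ)`, or the levels are distinct, lie in `I`, and are
unbounded in `γ = I⁺`, which has cofinality `κ⁺`. -/
structure Target (B : Set (Cond κ lam δ ε F)) {J : Type (u + 1)}
    (x : Cond κ lam δ ε F → J → Pt.{u}) (L : Set J) (j : J) (I : OrdInterval.{u})
    (γ : Ordinal.{u}) : Prop where
  mem_tree : I ∈ tree δ ε
  isSuccLimit : IsSuccLimit I.hi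
  lo_lt : I.lo < γ
  le_hi : γ ≤ I.hi
  le_cof : κ ≤ γ.cof
  cofinal : ∀ b < γ, ∃ e ∈ clubSet ε I, b < e ∧ e < γ
  level_const : j ∈ L → I = limitInterval δ ε γ ∧ ∀ p ∈ B, (x p j).1 = γ
  level_inj : j ∉ L → γ = I.hi ∧ ∀ p ∈ B, I.lo ≤ (x p j).1 ∧ (x p j).1 < γ
  small : ∀ b < γ, #{p ∈ B | (x p j).1 ≤ b} ≤ lift.{u + 1} κ

namespace UniformFamily

variable {B : Set (Cond κ lam δ ε F)} {J : Type (u + 1)} {x : Cond κ lam δ ε F → J → Pt.{u}}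
  {R : J → J → Prop} {M : J → J → Option J} {bS : J → Prop} {N : J → ℕ} {K L : Set J}

theorem exists_target_of_mem (hε : IsClubChoice ε) (hκ : ℵ₀ ≤ κ)
    (h : UniformFamily B x R M bS N K L) (hB : lift.{u + 1} κ < #B) {j : J} (hj : j ∉ K)
    (hL : j ∈ L) : ∃ I γ, Target B x L j I γ := by
  obtain ⟨p₀, hp₀⟩ := nonempty hB
  have hb : blockOf κ (x p₀ j) ≠ none := fun hb =>
    h.notMem_L hB hj ((h.block_iff p₀ hp₀ j).1 hb) hL
  have hx := h.mem_underlying hp₀ j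
  have hl := isSuccLimit_of_blockOf_ne_none hκ hx hb
  have hxδ := (mem_underlying_iff.1 hx).1
  obtain ⟨h1, h2, h3, -⟩ := limitInterval_spec hε hxδ hl
  refine ⟨limitInterval δ ε (x p₀ j).1, (x p₀ j).1, h1, h2, h3, le_limitInterval_hi hε hxδ hl, ?_,
    fun b hb => limitInterval_cofinal hε hxδ hl hb,
    fun _ => ⟨rfl, fun p hp => h.level_agree j hL p hp p₀ hp₀⟩, fun hn => absurd hL hn, ?_⟩
  · rcases cof_of_blockOf_ne_none hx hb with h4 | h4 <;> rw [h4]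
    exact le_succ κ
  · intro b hb
    have : {p ∈ B | (x p j).1 ≤ b} = ∅ := by
      ext p
      simp only [Set.mem_sep_iff, Set.mem_empty_iff_false, iff_false, not_and, not_le]
      intro hp
      rwa [h.level_agree j hL p hp p₀ hp₀]
    rw [this]
    simp

theorem exists_target_of_notMem (hε : IsClubChoice ε) (hκ : ℵ₀ ≤ κ)
    (hδκ : δ < (succ (succ κ)).ord) (h : UniformFamily B x R M bS N K L)
    (hB : lift.{u + 1} κ < #B) {j : J} (hL : j ∉ L) : ∃ I γ, Target B x L j I γ := by
  obtain ⟨p₀, hp₀⟩ := nonempty hB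
  have hc : ℵ₀ ≤ lift.{u + 1} κ := aleph0_le_lift.2 hκ
  have hxδ : ∀ p ∈ B, (x p j).1 < δ := fun p hp => (mem_underlying_iff.1 (h.mem_underlying hp j)).1
  have hδ : 0 < δ := pos_of_gt (hxδ p₀ hp₀)
  obtain ⟨p₁, hp₁, hne⟩ : ∃ p ∈ B, p ≠ p₀ := by
    by_contra! hcon
    have : B ⊆ {p₀} := hcon
    refine hB.not_ge ((mk_le_mk_of_subset this).trans ?_)
    rw [mk_singleton]
    exact one_le_aleph0.trans hc
  let Inj : ℕ → Prop := fun m => ∀ p ∈ B, ∀ q ∈ B, p ≠ q →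
    intervalAt δ ε (x p j).1 m ≠ intervalAt δ ε (x q j).1 m
  -- The interval that starts at the level varies with the level; `[0, δ)` does not.
  have hN : Inj (N j) := by
    intro p hp q hq hpq heq
    have key : ∀ p ∈ B, (intervalAt δ ε (x p j).1 (N j)).lo = (x p j).1 := by
      intro p hp
      obtain ⟨h1, h2⟩ := intervalAt_spec (δ := δ) hε (N j) (hxδ p hp)
      exact (rankOf_le_iff hε (hxδ p hp) h1 h2).1 (h.rank_eq p hp j).le
    exact h.level_disj p hp q hq hpq j hL j hL
      ((key p hp).symm.trans ((congrArg OrdInterval.lo heq).trans (key q hq)))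
  classical
  have hex : ∃ m, Inj m := ⟨_, hN⟩
  obtain ⟨m, hm⟩ : ∃ m, Nat.find hex = m + 1 := by
    refine Nat.exists_eq_succ_of_ne_zero fun h0 => ?_
    have := Nat.find_spec hex
    rw [h0] at this
    refine this p₁ hp₁ p₀ hp₀ hne ?_
    rw [intervalAt_eq hε (n := 0) (I := ⟨0, δ⟩) (hxδ p₁ hp₁) rfl ⟨zero_le, hxδ p₁ hp₁⟩,
      intervalAt_eq hε (n := 0) (I := ⟨0, δ⟩) (hxδ p₀ hp₀) rfl ⟨zero_le, hxδ p₀ hp₀⟩]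
  have hm1 : Inj (m + 1) := hm ▸ Nat.find_spec hex
  have hmconst := (h.interval j m (by have := Nat.find_min' hex hN; omega)).resolve_right
    (Nat.find_min hex (m := m) (by omega))
  let I := intervalAt δ ε (x p₀ j).1 m
  have hIl : I ∈ level δ ε m := (intervalAt_spec hε m (hxδ p₀ hp₀)).1
  have hIlt := level_lt hε hδ hIl
  have hxI : ∀ p ∈ B, (x p j).1 ∈ I.toSet := by
    intro p hp
    change (x p j).1 ∈ (intervalAt δ ε (x p₀ j).1 m).toSet
    rw [← hmconst p hp p₀ hp₀]
    exact (intervalAt_spec hε m (hxδ p hp)).2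
  have hpiece : ∀ p ∈ B, intervalAt δ ε (x p j).1 (m + 1) ∈ pieces ε I ∧
      (x p j).1 ∈ (intervalAt δ ε (x p j).1 (m + 1)).toSet := by
    intro p hp
    obtain ⟨Q, hQ, hxQ⟩ := exists_piece hε (hxI p hp)
    rw [intervalAt_eq hε (hxδ p hp) (mem_level_succ.2 ⟨I, hIl, hQ⟩) hxQ]
    exact ⟨hQ, hxQ⟩
  have hinj : Set.InjOn (fun p => intervalAt δ ε (x p j).1 (m + 1)) B := by
    intro p hp q hq heq
    by_contra hpq
    exact hm1 p hp q hq hpq heq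
  have hIhi : IsSuccLimit I.hi := by
    rcases Ordinal.zero_or_succ_or_isSuccLimit I.hi with h0 | ⟨β, hβ⟩ | hl
    · exact absurd hIlt.1 (h0 ▸ not_lt_zero)
    · exfalso
      rw [Order.succ_eq_add_one] at hβ
      have h1 := mk_le_of_injOn_of_mapsTo hinj (s := {⟨I.lo, β⟩, ⟨β, β + 1⟩}) (by
        intro p hp
        rcases (hpiece p hp).1 with ⟨hl, -⟩ | ⟨β', hβ', hQ, -⟩
        · rw [← hβ] at hl
          exact absurd hl (Order.not_isSuccLimit_succ _)
        · obtain rfl : β = β' := by simpa using hβ.trans hβ'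
          exact hQ)
      exact hB.not_ge (h1.trans ((Set.Finite.lt_aleph0 (Set.toFinite _)).le.trans hc))
    · exact hl
  have he := hε I hIlt.1 hIhi
  have hν : ∀ p ∈ B, ∃ ν < I.hi.cof.ord, ε I ν ≤ (x p j).1 ∧
      intervalAt δ ε (x p j).1 (m + 1) = ⟨ε I ν, ε I (ν + 1)⟩ := by
    intro p hp
    obtain ⟨h1, h2⟩ := hpiece p hp
    obtain ⟨ν, hν, heq⟩ := (mem_pieces_of_isSuccLimit hIhi).1 h1
    rw [heq] at h2
    exact ⟨ν, hν, h2.1, heq⟩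
  have hsmall : ∀ μ : Ordinal.{u}, ∀ B' ⊆ B, (∀ p ∈ B', ∀ ν < I.hi.cof.ord, ε I ν ≤ (x p j).1 →
      ν < μ) → #B' ≤ lift.{u + 1} μ.card := by
    intro μ B' hB' hlt
    have h1 := mk_le_of_injOn_of_mapsTo (hinj.mono hB')
      (s := (fun ν => (⟨ε I ν, ε I (ν + 1)⟩ : OrdInterval.{u})) '' Set.Iio μ) (by
        intro p hp
        obtain ⟨ν, hν, h1, h2⟩ := hν p (hB' hp)
        exact ⟨ν, hlt p hp ν hν h1, h2.symm⟩)
    refine h1.trans (mk_image_le.trans ?_)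
    rw [Cardinal.mk_Iio_ordinal]
  have hcof : I.hi.cof = succ κ := by
    refine le_antisymm (cof_hi_le hδκ hIlt.2) (Order.succ_le_of_lt ?_)
    have := hsmall I.hi.cof.ord B subset_rfl fun p _ ν hν _ => hν
    rw [card_ord] at this
    exact Cardinal.lift_lt.1 (hB.trans_le this)
  refine ⟨I, I.hi, Set.mem_iUnion.2 ⟨m, hIl⟩, hIhi, hIlt.1, le_rfl, hcof ▸ le_succ κ, ?_,
    fun hn => absurd hn hL, fun _ => ⟨rfl, fun p hp => hxI p hp⟩, ?_⟩
  · intro b hb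
    obtain ⟨ν, hν, hle⟩ := he.cofinal (b + 1) (hIhi.add_one_lt hb)
    exact ⟨_, Or.inl ⟨hIhi, ν, hν, rfl⟩, (lt_add_one b).trans_le hle, he.lt_hi ν hν⟩
  · intro b hb
    obtain ⟨μ, hμ, hle⟩ := he.cofinal b hb
    refine (hsmall (μ + 1) _ (Set.sep_subset _ _) ?_).trans ?_
    · rintro p ⟨-, hpb⟩ ν hν hνp
      rw [Order.lt_add_one_iff]
      by_contra! hlt
      exact (he.strictMono _ _ hlt hν).not_ge (hνp.trans (hpb.trans hle))
    · rw [Cardinal.lift_le]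
      refine Order.lt_succ_iff.1 ?_
      rw [← hcof]
      exact lt_ord.1 (IsClubEnum.succ_lt hIhi hμ)

theorem exists_target (hε : IsClubChoice ε) (hκ : ℵ₀ ≤ κ)
    (hδκ : δ < (succ (succ κ)).ord) (h : UniformFamily B x R M bS N K L)
    (hB : lift.{u + 1} κ < #B) {j : J} (hj : j ∉ K) : ∃ I γ, Target B x L j I γ := by
  by_cases hL : j ∈ L
  · exact h.exists_target_of_mem hε hκ hB hj hL
  · exact h.exists_target_of_notMem hε hκ hδκ hB hL

end UniformFamily

theorem Target.le {B : Set (Cond κ lam δ ε F)} {J : Type (u + 1)}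
    {x : Cond κ lam δ ε F → J → Pt.{u}} {L : Set J} {j : J} {I : OrdInterval.{u}}
    {γ : Ordinal.{u}} (ht : Target B x L j I γ) {p : Cond κ lam δ ε F} (hp : p ∈ B) :
    (x p j).1 ≤ γ := by
  by_cases hL : j ∈ L
  · exact ((ht.level_const hL).2 p hp).le
  · exact ((ht.level_inj hL).2 p hp).2.le

end Uniform

/-! ### Choice of the bridging points -/

/-- Along a well-founded relation on a small set one can choose points of given cofinal sets that
increase along the relation and exceed given bounds. -/
theorem exists_increasing_choice {J : Type (u + 1)} {r : J → J → Prop} (hr : WellFounded r)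
    {c : Cardinal.{u + 1}} (hc : ℵ₀ ≤ c) (hJ : #J < c) {T : Set J} {γ : J → Ordinal.{u}}
    (hγ : ∀ j ∈ T, c ≤ lift.{u + 1} (γ j).cof) {C : J → Set Ordinal.{u}}
    (hC : ∀ j ∈ T, ∀ b < γ j, ∃ e ∈ C j, b < e ∧ e < γ j) {D : J → Set Ordinal.{u}}
    (hDc : ∀ j ∈ T, #(D j) < c) (hD : ∀ j ∈ T, ∀ s ∈ D j, s < γ j)
    (hrγ : ∀ j ∈ T, ∀ l ∈ T, r l j → γ l ≤ γ j) :
    ∃ e : J → Ordinal.{u}, ∀ j ∈ T, e j ∈ C j ∧ e j < γ j ∧ (∀ s ∈ D j, s < e j) ∧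
      ∀ l ∈ T, r l j → e l < e j := by
  let e : J → Ordinal.{u} := hr.fix fun j ih => Classical.epsilon fun η =>
    η ∈ C j ∧ η < γ j ∧ (∀ s ∈ D j, s < η) ∧ ∀ l ∈ T, ∀ h : r l j, ih l h < η
  have he : ∀ j, e j = Classical.epsilon fun η =>
      η ∈ C j ∧ η < γ j ∧ (∀ s ∈ D j, s < η) ∧ ∀ l ∈ T, r l j → e l < η := fun j => hr.fix_eq _ j
  refine ⟨e, fun j => hr.induction (C := fun j => j ∈ T → e j ∈ C j ∧ e j < γ j ∧
    (∀ s ∈ D j, s < e j) ∧ ∀ l ∈ T, r l j → e l < e j) j fun j ih hj => ?_⟩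
  rw [he j]
  refine Classical.epsilon_spec (p := fun η => η ∈ C j ∧ η < γ j ∧ (∀ s ∈ D j, s < η) ∧
    ∀ l ∈ T, r l j → e l < η) ?_
  let D' : Set Ordinal.{u} := D j ∪ e '' {l | l ∈ T ∧ r l j}
  have hD' : ∀ s ∈ D', s < γ j := by
    rintro s (hs | ⟨l, ⟨hl, hlj⟩, rfl⟩)
    · exact hD j hj s hs
    · exact (ih l hlj hl).2.1.trans_le (hrγ j hj l hl hlj)
  have hcard : #D' < c :=
    (mk_union_le _ _).trans_lt (add_lt_of_lt hc (hDc j hj)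
      (mk_image_le.trans_lt ((mk_set_le _).trans_lt hJ)))
  have hsup : sSup D' < γ j := by
    refine sSup_lt_of_lt_cof ?_ hD'
    rw [← lift_cof]
    exact hcard.trans_le (hγ j hj)
  have hbdd : BddAbove D' := ⟨γ j, fun s hs => (hD' s hs).le⟩
  obtain ⟨η, h1, h2, h3⟩ := hC j hj _ hsup
  exact ⟨η, h1, h3, fun s hs => (le_csSup hbdd (Or.inl hs)).trans_lt h2,
    fun l hl hlj => (le_csSup hbdd (Or.inr ⟨l, ⟨hl, hlj⟩, rfl⟩)).trans_lt h2⟩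

section Choice

variable {κ lam : Cardinal.{u}} {δ : Ordinal.{u}} {ε : OrdInterval.{u} → Ordinal.{u} → Ordinal.{u}}
  {F : Sym2 Ordinal.{u} → Ordinal.{u}}

variable {B : Set (Cond κ lam δ ε F)} {J : Type (u + 1)} {x : Cond κ lam δ ε F → J → Pt.{u}}
  {R : J → J → Prop} {M : J → J → Option J} {bS : J → Prop} {N : J → ℕ} {K L : Set J}

/-- Levels `e j ∈ E(I j)` for the bridging points: `e j` is below the target `γ j` of the index
`j`, above `(I j)⁻`, and above all fixed levels and all targets which are less than `γ j`. -/
structure Approximation (B : Set (Cond κ lam δ ε F)) {J : Type (u + 1)}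
    (x : Cond κ lam δ ε F → J → Pt.{u}) (R : J → J → Prop) (K L : Set J) (I : J → OrdInterval.{u})
    (γ e : J → Ordinal.{u}) : Prop where
  target : ∀ j ∉ K, Target B x L j (I j) (γ j)
  mem_clubSet : ∀ j ∉ K, e j ∈ clubSet ε (I j)
  lt_target : ∀ j ∉ K, e j < γ j
  lo_lt : ∀ j ∉ K, (I j).lo < e j
  level_lt : ∀ j ∉ K, ∀ k ∈ L, ∀ p ∈ B, (x p k).1 < γ j → (x p k).1 < e j
  target_lt : ∀ j ∉ K, ∀ l ∉ K, γ l < γ j → γ l < e j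
  lt_of_rel : ∀ l ∉ K, ∀ j ∉ K, R l j → l ≠ j → e l < e j

namespace UniformFamily

theorem target_le_of_rel (h : UniformFamily B x R M bS N K L) (hB : lift.{u + 1} κ < #B)
    {l j : J} {I I' : OrdInterval.{u}} {γ γ' : Ordinal.{u}} (hl : Target B x L l I γ)
    (hj : Target B x L j I' γ') (h1 : R l j) (hne : l ≠ j) : γ ≤ γ' := by
  by_contra! hlt
  have : {p ∈ B | (x p l).1 ≤ γ'} = B :=
    Set.sep_eq_self_iff_mem_true.2 fun p hp => (h.lt_of_rel hp h1 hne).le.trans (hj.le hp)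
  exact hB.not_ge (this ▸ hl.small γ' hlt)

theorem exists_approximation (hε : IsClubChoice ε) (hκ : ℵ₀ ≤ κ)
    (hδκ : δ < (succ (succ κ)).ord) (h : UniformFamily B x R M bS N K L)
    (hB : lift.{u + 1} κ < #B) (hJ : #J < lift.{u + 1} κ) :
    ∃ I γ e, Approximation B x R K L I γ e := by
  have hc : ℵ₀ ≤ lift.{u + 1} κ := aleph0_le_lift.2 hκ
  obtain ⟨p₀, hp₀⟩ := nonempty hB
  have hT : ∀ j : J, ∃ I γ, j ∉ K → Target B x L j I γ := fun j => by
    by_cases hj : j ∈ K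
    · exact ⟨default, 0, fun hn => absurd hj hn⟩
    · obtain ⟨I, γ, ht⟩ := h.exists_target hε hκ hδκ hB hj
      exact ⟨I, γ, fun _ => ht⟩
  choose I γ ht using hT
  have hwf : WellFounded fun l j : J => R l j ∧ l ≠ j :=
    Subrelation.wf (r := InvImage (· < ·) fun j => (x p₀ j).1)
      (fun {_ _} h1 => h.lt_of_rel hp₀ h1.1 h1.2) (InvImage.wf _ wellFounded_lt)
  let g : J → Option (J ⊕ J) → Ordinal.{u} := fun j o =>
    o.elim (I j).lo (Sum.elim (fun k => (x p₀ k).1) γ)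
  obtain ⟨e, he⟩ := exists_increasing_choice hwf hc hJ (T := Kᶜ) (γ := γ)
    (fun j hj => Cardinal.lift_le.2 (ht j hj).le_cof) (C := fun j => clubSet ε (I j))
    (fun j hj => (ht j hj).cofinal) (D := fun j => Set.range (g j) ∩ Set.Iio (γ j))
    (fun j _ => by
      refine (mk_le_mk_of_subset Set.inter_subset_left).trans_lt (mk_range_le.trans_lt ?_)
      simp only [mk_option, mk_sum, Cardinal.lift_id]
      exact add_lt_of_lt hc (add_lt_of_lt hc hJ hJ) (one_lt_aleph0.trans_le hc))
    (fun j _ s hs => hs.2)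
    (fun j hj l hl hlj => h.target_le_of_rel hB (ht l hl) (ht j hj) hlj.1 hlj.2)
  refine ⟨I, γ, e, ht, fun j hj => (he j hj).1, fun j hj => (he j hj).2.1,
    fun j hj => (he j hj).2.2.1 _ ⟨⟨none, rfl⟩, (ht j hj).lo_lt⟩, ?_,
    fun j hj l hl hlt => (he j hj).2.2.1 _ ⟨⟨some (Sum.inr l), rfl⟩, hlt⟩,
    fun l hl j hj h1 h2 => (he j hj).2.2.2 l hl ⟨h1, h2⟩⟩
  intro j hj k hk p hp hlt
  rw [h.level_agree k hk p hp p₀ hp₀] at hlt ⊢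
  exact (he j hj).2.2.1 _ ⟨⟨some (Sum.inl k), rfl⟩, hlt⟩

theorem blockOf_ne_none (h : UniformFamily B x R M bS N K L) (hB : lift.{u + 1} κ < #B) {j : J}
    (hj : j ∉ K) (hL : j ∈ L) {p : Cond κ lam δ ε F} (hp : p ∈ B) : blockOf κ (x p j) ≠ none :=
  fun hb => h.notMem_L hB hj ((h.block_iff p hp j).1 hb) hL

/-- The levels of the varying points of all but `κ` conditions exceed the approximating levels. -/
theorem exists_subset_lt {I : J → OrdInterval.{u}} {γ e : J → Ordinal.{u}}
    (hB : lift.{u + 1} κ < #B) (hκ : ℵ₀ ≤ κ) (hJ : #J < lift.{u + 1} κ)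
    (ha : Approximation B x R K L I γ e) :
    ∃ B' ⊆ B, lift.{u + 1} κ < #B' ∧ ∀ p ∈ B', ∀ j ∉ K, e j < (x p j).1 := by
  have hc : ℵ₀ ≤ lift.{u + 1} κ := aleph0_le_lift.2 hκ
  refine ⟨{p ∈ B | ∀ j ∉ K, e j < (x p j).1}, Set.sep_subset _ _, ?_, fun p hp => hp.2⟩
  by_contra! hle
  refine hB.not_ge ((mk_le_mk_of_subset (t := {p ∈ B | ∀ j ∉ K, e j < (x p j).1} ∪
    ⋃ j : (Kᶜ : Set J), {p ∈ B | (x p j).1 ≤ e j}) ?_).trans (mk_union_le_of_le hc hle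
      (mk_iUnion_le_of_le hc ((mk_set_le _).trans hJ.le) _ fun j =>
        (ha.target j j.2).small _ (ha.lt_target j j.2))))
  intro p hp
  by_cases hpe : ∀ j ∉ K, e j < (x p j).1
  · exact Or.inl ⟨hp, hpe⟩
  · push Not at hpe
    obtain ⟨j, hj, hle⟩ := hpe
    exact Or.inr (Set.mem_iUnion.2 ⟨⟨j, hj⟩, hp, hle⟩)

/-- Strong unboundedness yields two conditions at whose varying points of fixed level the
values of `F` are large. -/
theorem exists_pair (hκ : ℵ₀ ≤ κ) (hF : StronglyUnbounded κ lam F)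
    (h : UniformFamily B x R M bS N K L) (hB : lift.{u + 1} κ < #B) (hJ : #J < lift.{u + 1} κ)
    {B' : Set (Cond κ lam δ ε F)} (hB'B : B' ⊆ B) (hB' : lift.{u + 1} κ < #B')
    {ϑ : Ordinal.{u}} (hϑ : ϑ < (succ κ).ord) :
    ∃ p ∈ B', ∃ q ∈ B', p ≠ q ∧
      ∀ j ∈ L \ K, ∀ k ∈ L \ K, ϑ < F s((x p j).2, (x q k).2) := by
  rcases (L \ K).eq_empty_or_nonempty with he | ⟨j₀, hj₀⟩
  · obtain ⟨p, hp, q, hq, hne⟩ : B'.Nontrivial := by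
      rw [← Set.nontrivial_coe_sort, ← one_lt_iff_nontrivial]
      exact (one_lt_aleph0.trans_le (aleph0_le_lift.2 hκ)).trans hB'
    exact ⟨p, hp, q, hq, hne, by simp [he]⟩
  obtain ⟨B₂, hB₂, hB₂c⟩ := le_mk_iff_exists_subset.1 (show lift.{u + 1} (succ κ) ≤ #B' by
    rw [Cardinal.lift_succ]; exact Order.succ_le_of_lt hB')
  let a : Cond κ lam δ ε F → Set Ordinal.{u} := fun p => (fun j => (x p j).2) '' (L \ K)
  have hdisj : ∀ p ∈ B₂, ∀ q ∈ B₂, p ≠ q → Disjoint (a p) (a q) := by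
    intro p hp q hq hne
    rw [Set.disjoint_left]
    rintro _ ⟨j, hj, rfl⟩ ⟨k, hk, heq⟩
    exact h.snd_disj q (hB'B (hB₂ hq)) p (hB'B (hB₂ hp)) hne.symm k hk.2 j hj.2 hk.1 hj.1 heq
  have hinj : Set.InjOn a B₂ := by
    intro p hp q hq heq
    by_contra hne
    have h1 : (x p j₀).2 ∈ a p := ⟨j₀, hj₀, rfl⟩
    exact Set.disjoint_left.1 (hdisj p hp q hq hne) h1 (heq ▸ h1)
  obtain ⟨_, ⟨p, hp, rfl⟩, _, ⟨q, hq, rfl⟩, hne, hlt⟩ := hF.unbounded ϑ hϑ (a '' B₂) (by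
      rintro _ ⟨p, hp, rfl⟩
      refine ⟨?_, mk_image_le.trans_lt ((mk_set_le _).trans_lt hJ)⟩
      rintro _ ⟨j, hj, rfl⟩
      have hpB := hB'B (hB₂ hp)
      have hb := h.blockOf_ne_none hB hj.2 hj.1 hpB
      rw [Ne, blockOf_eq_none] at hb
      exact ((mem_underlying_iff.1 (h.mem_underlying hpB j)).2.resolve_left hb).2.2) (by
      rintro _ ⟨p, hp, rfl⟩ _ ⟨q, hq, rfl⟩ hne
      exact hdisj p hp q hq fun he => hne (he ▸ rfl)) (by
      rw [mk_image_eq_of_injOn a B₂ hinj, hB₂c])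
  exact ⟨p, hB₂ hp, q, hB₂ hq, fun he => hne (he ▸ rfl),
    fun j hj k hk => hlt _ ⟨j, hj, rfl⟩ _ ⟨k, hk, rfl⟩⟩

/-- The second coordinates of the bridging points can be taken distinct and new. -/
theorem exists_fresh (hκ : κ.IsRegular) (hJ : #J < lift.{u + 1} κ) {P : Bool → Cond κ lam δ ε F} :
    ∃ τ : J → Ordinal.{u}, Function.Injective τ ∧ (∀ j, τ j < κ.ord) ∧
      ∀ b, ∀ y ∈ (P b).A, ∀ j, y.2 ≠ τ j := by
  have hc : ℵ₀ ≤ lift.{u + 1} κ := aleph0_le_lift.2 hκ.aleph0_le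
  let D : Set Ordinal.{u} := Prod.snd '' (P true).A ∪ Prod.snd '' (P false).A
  have hD : #D < lift.{u + 1} κ := (mk_union_le _ _).trans_lt (add_lt_of_lt hc
    (mk_image_le.trans_lt (P true).card_lt) (mk_image_le.trans_lt (P false).card_lt))
  have hle : #J ≤ #(Set.Iio κ.ord \ D : Set Ordinal.{u}) := by
    by_contra! hlt
    have h1 := (mk_le_mk_of_subset (Set.subset_sdiff_union (Set.Iio κ.ord) D)).trans
      (mk_union_le _ _)
    rw [Cardinal.mk_Iio_ordinal, card_ord] at h1
    exact (add_lt_of_lt hc (hlt.trans hJ) hD).not_ge h1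
  obtain ⟨ι⟩ := (Cardinal.le_def _ _).1 hle
  refine ⟨fun j => (ι j).1, fun i j hij => ι.injective (Subtype.ext hij), fun j => (ι j).2.1, ?_⟩
  intro b y hy j heq
  refine (ι j).2.2 ?_
  rw [show (ι j).1 = y.2 from heq.symm]
  cases b
  · exact Or.inr ⟨y, hy, rfl⟩
  · exact Or.inl ⟨y, hy, rfl⟩

theorem anchors (hB : lift.{u + 1} κ < #B) (h : UniformFamily B x R M bS N K L)
    {I : J → OrdInterval.{u}} {γ e : J → Ordinal.{u}} (ha : Approximation B x R K L I γ e) {j : J}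
    (hj : j ∉ K) {p : Cond κ lam δ ε F} (hp : p ∈ B) (hlt : e j < (x p j).1) :
    Anchors κ δ ε (I j) (x p j) := by
  have ht := ha.target j hj
  refine ⟨ht.mem_tree, ?_⟩
  by_cases hL : j ∈ L
  · obtain ⟨h1, h2⟩ := ht.level_const hL
    exact Or.inr ⟨h.blockOf_ne_none hB hj hL hp, (h2 p hp).symm ▸ h1⟩
  · obtain ⟨h1, h2⟩ := ht.level_inj hL
    exact Or.inl ⟨(ha.lo_lt j hj).trans hlt, h1 ▸ (h2 p hp).2⟩

/-- A varying level which exceeds its approximation is not a fixed level: the fixed levels below the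
target lie below the approximation. -/
theorem level_ne_of_mem_of_notMem
    {I : J → OrdInterval.{u}} {γ e : J → Ordinal.{u}} (ha : Approximation B x R K L I γ e)
    {j k : J} (hk : k ∉ K) (hjL : j ∈ L) (hkL : k ∉ L)
    {p q : Cond κ lam δ ε F} (hp : p ∈ B) (hq : q ∈ B) (hlt : e k < (x q k).1) :
    (x p j).1 ≠ (x q k).1 := by
  intro heq
  have h1 := ha.level_lt k hk j hjL p hp (heq.trans_lt (((ha.target k hk).level_inj hkL).2 q hq).2)
  exact (h1.trans hlt).ne heq

theorem bridge (hε : IsClubChoice ε) (hκ : ℵ₀ ≤ κ)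
    (hδκ : δ < (succ (succ κ)).ord) (h : UniformFamily B x R M bS N K L)
    (hF : StronglyUnbounded κ lam F) (hB : lift.{u + 1} κ < #B)
    {I : J → OrdInterval.{u}} {γ e : J → Ordinal.{u}} (ha : Approximation B x R K L I γ e)
    {P : Bool → Cond κ lam δ ε F} (hP : ∀ b, P b ∈ B) (hne : P true ≠ P false)
    (hlt : ∀ b, ∀ j ∉ K, e j < (x (P b) j).1) {τ : J → Ordinal.{u}} (hτ : Function.Injective τ)
    (hτκ : ∀ j, τ j < κ.ord) (hτP : ∀ b, ∀ y ∈ (P b).A, ∀ j, y.2 ≠ τ j)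
    {ϑ : Ordinal.{u}}
    (hϑ : ∀ j ∈ L \ K, ∀ l, ∀ η < (succ κ).ord,
      (middle (fun b => x (P b)) K (fun j => (e j, τ j)) l).1 =
        ε (limitInterval δ ε (x (P true) j).1) η → ∃ θ ≤ ϑ,
      (middle (fun b => x (P b)) K (fun j => (e j, τ j)) l).1 =
        ε (limitInterval δ ε (x (P true) j).1) θ)
    (hϑF : ∀ j ∈ L \ K, ∀ k ∈ L \ K, ϑ < F s((x (P true) j).2, (x (P false) k).2)) :
    Bridge P (fun b => x (P b)) R bS K (fun j => (e j, τ j)) := by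
  have hiso := h.isomorphicPair hε hκ hδκ hF hB hP hne
  have hxu : ∀ b j, x (P b) j ∈ underlying κ lam δ := fun b j => h.mem_underlying (hP b) j
  have hxδ : ∀ b j, (x (P b) j).1 < δ := fun b j => (mem_underlying_iff.1 (hxu b j)).1
  have hanc : ∀ b, ∀ j ∉ K, Anchors κ δ ε (I j) (x (P b) j) := fun b j hj =>
    h.anchors hB ha hj (hP b) (hlt b j hj)
  have hKL := h.K_subset_L hκ hB
  refine
    { block_w := hτκ
      w_inj := fun i j hij => hτ (congrArg Prod.snd hij)
      w_notMem := fun j b hw => hτP b _ hw j rfl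
      mem_orbit := fun j hj b =>
        (hanc b j hj).mem_orbit hε hκ (hxu b j) (ha.mem_clubSet j hj) (hlt b j hj)
      orbit_subset := fun j hj b =>
        (hanc b j hj).basicOrbit_subset hε hκ (hxu b j) (ha.mem_clubSet j hj) (ha.lo_lt j hj)
          (hlt b j hj)
      lt_of_rel := ha.lt_of_rel
      lt_of_mem := ?_
      not_separated := ?_
      between_or_mem := ?_
      orbit_transfer := ?_
      pairOrbit_mem := ?_ }
  · intro k hk j hj hkj
    refine ha.level_lt j hj k (hKL hk) _ (hP true) ?_
    have hkj' : k ≠ j := fun he => hj (he ▸ hk)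
    exact (hiso.lt_of_rel hkj hkj' true).trans_le ((ha.target j hj).le (hP true))
  · intro j hj Λ hΛ h1 h2 b
    have ht := ha.target j hj
    have hsub := subset_of_mem_clubSet hε (pos_of_gt (hxδ b j)) ht.mem_tree hΛ
      (ha.mem_clubSet j hj) h1 h2
    refine ⟨(ht.le (hP b)).trans (ht.le_hi.trans hsub.2), fun hb => ⟨h1.trans (hlt b j hj), ?_⟩⟩
    obtain ⟨h3, h4⟩ := ht.level_inj (h.notMem_L hB hj hb)
    exact (h4 _ (hP b)).2.trans_le (h3 ▸ hsub.2)
  · intro l hl j hj hlj hne'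
    have hlL := h.notMem_L hB hl (h.bS_of_rel (hP true) hlj hne')
    have htl := ha.target l hl
    obtain ⟨hγl, hxl⟩ := htl.level_inj hlL
    rcases (h.target_le_of_rel hB htl (ha.target j hj) hlj hne').lt_or_eq with hγ | hγ
    · -- `I l` separates both copies of `l` from those of `j`.
      obtain ⟨c, hc, h1, -, h2, -⟩ := hiso.exists_between_mem hlj hne' htl.mem_tree fun b =>
        ⟨(ha.lo_lt l hl).trans (hlt b l hl), hγl ▸ (hxl _ (hP b)).2,
          hγl ▸ (ha.target_lt j hj l hl hγ).trans (hlt b j hj)⟩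
      exact Or.inl ⟨c, hc, h1, h2⟩
    · right
      have hej := ha.lt_of_rel l hl j hj hlj hne'
      have hA : Anchors κ δ ε (I l) (x (P true) j) := by
        refine ⟨htl.mem_tree, ?_⟩
        by_cases hjL : j ∈ L
        · obtain ⟨-, h2⟩ := (ha.target j hj).level_const hjL
          have h3 : (x (P true) j).1 = (I l).hi := (h2 _ (hP true)).trans (hγ.symm.trans hγl)
          exact Or.inr ⟨h.blockOf_ne_none hB hj hjL (hP true),
            eq_limitInterval_of_hi_eq hε (hxδ true j) (h3 ▸ htl.isSuccLimit) htl.mem_tree h3.symm⟩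
        · obtain ⟨-, h2⟩ := (ha.target j hj).level_inj hjL
          exact Or.inl ⟨(ha.lo_lt l hl).trans (hej.trans (hlt true j hj)),
            hγl ▸ hγ ▸ (h2 _ (hP true)).2⟩
      exact mem_basicOrbit_of_mem_orbit hε hκ (hxu true j)
        (hA.mem_orbit hε hκ (hxu true j) (ha.mem_clubSet l hl) (hej.trans (hlt true j hj)))
        hej (hlt true j hj)
  · intro l hl j hlj hne' b hmem
    have htl := ha.target l hl
    have hlL := h.notMem_L hB hl (h.bS_of_rel (hP true) hlj hne')
    obtain ⟨hγl, hxl⟩ := htl.level_inj hlL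
    exact mem_orbit_of_mem_clubSet hε hκ (hxu b j) htl.mem_tree htl.isSuccLimit
      ((ha.lo_lt l hl).trans (hlt b l hl)) (hγl ▸ (hxl _ (hP b)).2) hmem (ha.mem_clubSet l hl)
      ((hlt b l hl).trans (hiso.lt_of_rel hlj hne' b))
  · intro j hj k hk hb hb' hcof l hl
    have heq := fst_eq_of_blockOf_eq hb hb'
    have hjk : j ∈ L ∧ k ∈ L := by
      by_cases hjL : j ∈ L
      · exact ⟨hjL, by_contra fun hkL =>
          level_ne_of_mem_of_notMem ha hk hjL hkL (hP true) (hP false) (hlt false k hk) heq⟩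
      · by_cases hkL : k ∈ L
        · exact absurd heq.symm (level_ne_of_mem_of_notMem ha hj hkL hjL (hP false) (hP true)
            (hlt true j hj))
        · exact absurd heq (h.level_disj _ (hP true) _ (hP false) hne j hjL k hkL)
    rw [pairOrbit, if_pos ⟨hb, hb', hcof⟩]
    rw [orbit, if_neg hb'] at hl
    rcases hl with hl | ⟨hl, -⟩
    · exact Or.inl hl
    · have hlim := isSuccLimit_of_blockOf_ne_none hκ (hxu true j) hb'
      have hhi := limitInterval_hi_eq hε hδκ (hxδ true j) hlim hcof
      obtain ⟨η, hη, heη⟩ := (mem_clubSet_of_isSuccLimit (hhi.symm ▸ hlim)).1 hl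
      rw [hhi, hcof] at hη
      obtain ⟨θ, hθ, heθ⟩ := hϑ j ⟨hjk.1, hj⟩ l η hη heη
      exact Or.inr ⟨θ, hθ.trans_lt (hϑF j ⟨hjk.1, hj⟩ k ⟨hjk.2, hk⟩), heθ⟩

/-- A uniform family of more than `κ` conditions contains two compatible ones. -/
theorem exists_compatible (hκ : κ.IsRegular) (hε : IsClubChoice ε)
    (hδκ : δ < (succ (succ κ)).ord) (hF : StronglyUnbounded κ lam F)
    (h : UniformFamily B x R M bS N K L) (hB : lift.{u + 1} κ < #B) (hJ : #J < lift.{u + 1} κ) :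
    ∃ p ∈ B, ∃ q ∈ B, p ≠ q ∧ ∃ r, r ≤ p ∧ r ≤ q := by
  have hκ' := hκ.aleph0_le
  obtain ⟨p₀, hp₀⟩ := nonempty hB
  obtain ⟨I, γ, e, ha⟩ := h.exists_approximation hε hκ' hδκ hB hJ
  obtain ⟨B', hB'B, hB', hlt⟩ := exists_subset_lt hB hκ' hJ ha
  -- The levels of the points of the third copy of `J` and their indices in the clubs `E(J(ζ))`.
  classical
  let v : J → Ordinal.{u} := fun l => if l ∈ K then (x p₀ l).1 else e l
  let θ : J × J → Ordinal.{u} := fun a =>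
    sInf {η | η < (succ κ).ord ∧ v a.2 = ε (limitInterval δ ε (x p₀ a.1).1) η}
  have hθ : ∀ a, θ a < (succ κ).ord := by
    intro a
    by_cases hs : {η | η < (succ κ).ord ∧ v a.2 = ε (limitInterval δ ε (x p₀ a.1).1) η}.Nonempty
    · exact (csInf_mem hs).1
    · change sInf _ < _
      rw [Set.not_nonempty_iff_eq_empty.1 hs, Ordinal.sInf_empty]
      exact (isSuccLimit_ord (hκ'.trans (le_succ κ))).bot_lt
  have hθr : ∀ s ∈ Set.range θ, s < (succ κ).ord := by
    rintro _ ⟨a, rfl⟩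
    exact hθ a
  have hϑ : sSup (Set.range θ) < (succ κ).ord := by
    refine sSup_lt_of_lt_cof ?_ hθr
    rw [← lift_cof, (isRegular_succ hκ').cof_ord]
    refine mk_range_le.trans_lt ?_
    simp only [mk_prod, Cardinal.lift_id]
    exact (mul_lt_of_lt (aleph0_le_lift.2 hκ') hJ hJ).trans (Cardinal.lift_lt.2 (lt_succ κ))
  obtain ⟨p, hp, q, hq, hne, hFpq⟩ := h.exists_pair hκ' hF hB hJ hB'B hB' hϑ
  let P : Bool → Cond κ lam δ ε F := fun b => if b then p else q
  have hP : ∀ b, P b ∈ B' := by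
    rintro (_ | _)
    · exact hq
    · exact hp
  obtain ⟨τ, hτ, hτκ, hτP⟩ := exists_fresh (P := P) hκ hJ
  have hv : ∀ l, (middle (fun b => x (P b)) K (fun j => (e j, τ j)) l).1 = v l := by
    intro l
    by_cases hl : l ∈ K
    · simp only [middle, v, if_pos hl]
      exact congrArg Prod.fst (h.agree l hl _ (hB'B hp) _ hp₀)
    · simp only [middle, v, if_neg hl]
  have hbr := h.bridge hε hκ' hδκ hF hB ha (P := P) (fun b => hB'B (hP b)) hne
    (fun b => hlt _ (hP b)) hτ hτκ hτP (ϑ := sSup (Set.range θ)) (by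
      intro j hj l η hη heq
      rw [hv, show (x (P true) j).1 = (x p₀ j).1 from
        h.level_agree j hj.1 _ (hB'B hp) _ hp₀] at heq ⊢
      exact ⟨θ (j, l), le_csSup ⟨_, fun s hs => (hθr s hs).le⟩ ⟨_, rfl⟩,
        (csInf_mem (s := {η | η < (succ κ).ord ∧
          v l = ε (limitInterval δ ε (x p₀ j).1) η}) ⟨η, hη, heq⟩).2⟩) hFpq
  obtain ⟨r, hr⟩ := (h.isomorphicPair hε hκ' hδκ hF hB (P := P) (fun b => hB'B (hP b))
    hne).exists_common_extension hε hκ' hδκ hF hbr hJ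
  exact ⟨p, hB'B hp, q, hB'B hq, hne, r, hr true, hr false⟩

end UniformFamily

end Choice

end OrbitForcing

theorem mainTheorem5 (κ lam : Cardinal.{u}) (δ : Ordinal.{u})
    (ε : OrbitForcing.OrdInterval.{u} → Ordinal.{u} → Ordinal.{u})
    (F : Sym2 Ordinal.{u} → Ordinal.{u})
    (hκ : κ.IsRegular) (hlam : lam.IsRegular) (hκlam : κ < lam)
    (hκpow : κ ^< κ = κ) (hlampow : lam ^ κ = lam)
    (hδ : δ < (Order.succ (Order.succ κ)).ord)
    (hε : OrbitForcing.IsClubChoice ε)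
    (hF : OrbitForcing.StronglyUnbounded κ lam F) :
    OrbitForcing.ChainCondition (OrbitForcing.Cond κ lam δ ε F)
      (Cardinal.lift.{u + 1} (Order.succ κ)) := by
  intro S hS
  by_contra! hle
  rw [Cardinal.lift_succ, Order.succ_le_iff] at hle
  obtain ⟨B, hBS, hB, J, x, R, M, bS, N, K, L, hJ, h⟩ :=
    OrbitForcing.exists_uniformFamily hκ hκpow hle
  obtain ⟨p, hp, q, hq, hne, hr⟩ := h.exists_compatible hκ hε hδ hF hB hJ
  exact hS p (hBS hp) q (hBS hq) hne hr
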